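/- Let $t$ range over an open set $U\subset\mathbb C$ not containing $0$, and let $q_0(t)$ be a holomorphic branch on $U$ of $\sqrt{-t/6}$, i.e. $6q_0^2+t=0$. Let $q(t,\hbar)=\sum_{k\ge0}\hbar^{2k}q_{2k}(t)$ be the formal power series solution, with leading term $q_0$, of the first Painlevé equation $\hbar^2 q''=6q^2+t$; that is, for $k\ge 0$, $$q_{2(k+1)}=\frac1{12q_0}\Bigl(q_{2k}''-6\sum_{k_1+k_2=k+1,\ k_i>0}q_{2k_1}q_{2k_2}\Bigr),$$ and let $p=\hbar\,dq/dt$. The scalar isomonodromy system associated with the first Painlevé equation is $$\Bigl(\bigl(\hbar\tfrac{\partial}{\partial x}\bigr)^2+f\,\hbar\tfrac{\partial}{\partial x}+g\Bigr)\psi=0,\qquad \hbar\frac{\partial\psi}{\partial t}=\frac1{2(x-q)}\Bigl(\hbar\frac{\partial\psi}{\partial x}-p\psi\Bigr),\tag{1}$$ $$f=-\frac{\hbar}{x-q},\qquad g=-(4x^3+2tx+p^2-4q^3-2tq)+\frac{\hbar p}{x-q},$$ where everything is expanded in powers of $\hbar$. Consider the curve $y^2=4(x-q_0)^2(x+2q_0)$,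 parametrized by $x(z)=z^2-2q_0$, $y(z)=2z(z^2-3q_0)$, and write $\bar z=-z$. Its Eynard–Orantin differentials are $W_{0,1}(z_1)=y(z_1)\,dx(z_1)$, $W_{0,2}(z_1,z_2)=\dfrac{dz_1dz_2}{(z_1-z_2)^2}$ and, for $g\ge0$, $n\ge1$ with $2g-2+n\ge1$, $$W_{g,n}(z_1,\dots,z_n)=\operatorname*{Res}_{z=0}K(z,z_1)\Bigl[W_{g-1,n+1}(z,\bar z,z_2,\dots,z_n)+{\sum}'\,W_{g_1,|I|+1}(z,z_I)\,W_{g_2,|J|+1}(\bar z,z_J)\Bigr],$$ $$K(z,z_1)=-\frac{\int_z^{\bar z}W_{0,2}(\cdot,z_1)}{2(y(z)-y(\bar z))\,dx(z)},$$ where the first term is absent for $g=0$ and $\sum'$ runs over $g_1+g_2=g$, $I\sqcup J=\{2,\dots,n\}$, omitting the terms that contain $W_{0,1}$. For $2g-2+n\ge1$ put $$F_{g,n}(z_1,\dots,z_n)=\frac1{2^n}\int_{\bar z_1}^{z_1}\cdots\int_{\bar z_n}^{z_n}W_{g,n},$$ the paths of integration avoiding $0$. Let $(x,t)$ range over an open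 set $\Omega\subset\mathbb C\times U$ on which $x\ne q_0(t)$ and $x\ne-2q_0(t)$ and on which holomorphic branches of $z=z(x,t)=\sqrt{x+2q_0(t)}$ and of $\log\bigl(y(z)/(2(x-q_0))\bigr)$ are given. Define $$S_0=\int_{v}^{x}y\,dx\quad(v=-2q_0),\qquad S_1=-\frac12\log\frac{y(z)}{2(x-q_0)},$$ $$S_m=\sum_{\substack{2g-2+n=m-1\\ g\ge0,\ n\ge1}}\frac{F_{g,n}(z,\dots,z)}{n!}\Big|_{z=z(x,t)}\qquad(m\ge2),$$ where $S_0$ is the integral along the curve from the branch point $z=0$ to the point $z=z(x,t)$. **Theorem.** All $S_m$ are holomorphic on $\Omega$, and the following holds at every point of $\Omega$. The WKB-type formal series $\psi=\exp(S)$, $S=\sum_{m\ge0}\hbar^{m-1}S_m(x,t)$, that is, $\psi=e^{S_0/\hbar}\cdot e^{S_1}\exp\bigl(\sum_{m\ge2}\hbar^{m-1}S_m\bigr)$, satisfies both equations of (1). Equivalently, $S$ satisfies $$\hbar^2\Bigl(\bigl(\tfrac{\partial S}{\partial x}\bigr)^2+\tfrac{\partial^2S}{\partial x^2}\Bigr)=\frac{\hbar}{x-q}\Bigl(\hbar\frac{\partial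 S}{\partial x}-p\Bigr)+(4x^3+2tx+p^2-4q^3-2tq),$$ $$\hbar\frac{\partial S}{\partial t}=\frac1{2(x-q)}\Bigl(\hbar\frac{\partial S}{\partial x}-p\Bigr),$$ and both forms hold. The semi-classical limit of the first equation of (1) is the given curve: if $f_0$, $g_0$ are the coefficients of $\hbar^0$ in $f$, $g$, then $y^2+f_0\,y+g_0=y^2-4(x-q_0)^2(x+2q_0)$. In this sense the isomonodromy system is a quantum curve of the spectral curve. -/

import Mathlib

noncomputable section

namespace PainleveOne

open scoped Topology

/-! ### Formal series in `ħ` -/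

/-- The formal parameter `ħ`, as an element of the field `ℂ((ħ))`. -/
def hbar : LaurentSeries ℂ := HahnSeries.single 1 1

/-- A complex number as a constant element of `ℂ((ħ))`. -/
def cst (c : ℂ) : LaurentSeries ℂ := HahnSeries.C c

/-- The series `∑_{m ≥ 0} a m * ħ ^ m`, as an element of `ℂ((ħ))`. -/
def ser (a : ℕ → ℂ) : LaurentSeries ℂ := ((PowerSeries.mk a : PowerSeries ℂ) : LaurentSeries ℂ)

/-- The partial derivative `∂F/∂x` of a function `F(x,t)`. -/
def pdx (F : ℂ → ℂ → ℂ) (x t : ℂ) : ℂ := deriv (fun x' => F x' t) x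

/-- The partial derivative `∂F/∂t` of a function `F(x,t)`. -/
def pdt (F : ℂ → ℂ → ℂ) (x t : ℂ) : ℂ := deriv (fun t' => F x t') t

/-! ### The formal power series solution of the first Painlevé equation -/

/-- The coefficients `q_{2k}(t)` of the formal solution `q = ∑ ħ ^ (2k) q_{2k}(t)` of
`ħ² q'' = 6 q² + t` with top term `q₀`:
`q_{2(k+1)} = (q_{2k}'' - 6 ∑ q_{2k₁} q_{2k₂}) / (12 q₀)`, the sum being over
`k₁ + k₂ = k + 1`, `k₁, k₂ > 0` (below `k₁ = i + 1` and `k₂ = k - i` with `0 ≤ i < k`). -/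
def qEven (q₀ : ℂ → ℂ) : ℕ → ℂ → ℂ
  | 0 => q₀
  | k + 1 => fun t =>
      1 / (12 * q₀ t) *
        (iteratedDeriv 2 (qEven q₀ k) t
          - 6 * ∑ i : Fin k, qEven q₀ (i + 1) t * qEven q₀ (k - i) t)
  termination_by k => k
  decreasing_by all_goals omega

/-- The coefficient of `ħ ^ n` in the formal solution `q(t,ħ)`. -/
def qCoeff (q₀ : ℂ → ℂ) (n : ℕ) (t : ℂ) : ℂ :=
  if Even n then qEven q₀ (n / 2) t else 0

/-- The coefficient of `ħ ^ n` in `p(t,ħ) = ħ dq/dt`. -/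
def pCoeff (q₀ : ℂ → ℂ) : ℕ → ℂ → ℂ
  | 0 => fun _ => 0
  | n + 1 => fun t => deriv (qCoeff q₀ n) t

/-- The formal series `q(t,ħ)` at the point `t`. -/
def qSer (q₀ : ℂ → ℂ) (t : ℂ) : LaurentSeries ℂ := ser fun n => qCoeff q₀ n t

/-- The formal series `p(t,ħ)` at the point `t`. -/
def pSer (q₀ : ℂ → ℂ) (t : ℂ) : LaurentSeries ℂ := ser fun n => pCoeff q₀ n t

/-! ### The coefficients of the scalar isomonodromy system -/

/-- `4x³ + 2tx + p² - 4q³ - 2tq`. -/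
def potential (q₀ : ℂ → ℂ) (x t : ℂ) : LaurentSeries ℂ :=
  cst (4 * x ^ 3 + 2 * t * x) + pSer q₀ t ^ 2 - 4 * qSer q₀ t ^ 3 - cst (2 * t) * qSer q₀ t

/-- `f = - ħ / (x - q)`. -/
def fSer (q₀ : ℂ → ℂ) (x t : ℂ) : LaurentSeries ℂ := -(hbar / (cst x - qSer q₀ t))

/-- `g = - (4x³ + 2tx + p² - 4q³ - 2tq) + ħ p / (x - q)`. -/
def gSer (q₀ : ℂ → ℂ) (x t : ℂ) : LaurentSeries ℂ :=
  -potential q₀ x t + hbar * pSer q₀ t / (cst x - qSer q₀ t)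

/-! ### Topological recursion for the curve `y² = 4 (x - a)² (x + 2a)`

Multidifferentials are represented by their coefficient functions with respect to
`dz₁ ⋯ dzₙ`. The parameter `a` is the value of `q₀`. -/

/-- `x(z) = z² - 2a`. -/
def curveX (a z : ℂ) : ℂ := z ^ 2 - 2 * a

/-- `y(z) = 2z (z² - 3a)`. -/
def curveY (a z : ℂ) : ℂ := 2 * z * (z ^ 2 - 3 * a)

/-- The Bergman kernel `dz₁ dz₂ / (z₁ - z₂)²`. -/
def bergman (z₁ z₂ : ℂ) : ℂ := 1 / (z₁ - z₂) ^ 2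

/-- The integral of `f(ζ) dζ` along the straight segment from `u` to `w`. -/
def segInt (f : ℂ → ℂ) (u w : ℂ) : ℂ :=
  ∫ s in (0 : ℝ)..1, f (u + (s : ℂ) * (w - u)) * (w - u)

/-- `(2πi)⁻¹ ∮ f(z) dz` along a small positively oriented circle around `0`
(the limit is that of an eventually constant function when `f` is meromorphic at `0`). -/
def residueZero (f : ℂ → ℂ) : ℂ :=
  Filter.limUnder (𝓝[>] (0 : ℝ)) fun r => (2 * Real.pi * Complex.I)⁻¹ * ∮ z in C(0, r), f z

/-- The recursion kernel
`K(z,z₁) = - (∫_z^{-z} B(·,z₁)) / (2 (y(z) - y(-z)) dx(z))`; this is the coefficient of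
`dz₁ / dz`. -/
def kernel (a z z₁ : ℂ) : ℂ :=
  -segInt (fun ζ => bergman ζ z₁) z (-z) /
    (2 * (curveY a z - curveY a (-z)) * deriv (curveX a) z)

/-- The Eynard–Orantin differentials `W_{g,n}(z₁,…,zₙ)`. With `z̄ = -z`, for `2g - 2 + n ≥ 1`
`W_{g,n}` is the residue at the ramification point `z = 0` of `K(z,z₁)` times
`W_{g-1,n+1}(z,z̄,z₂,…,zₙ) + ∑ W_{g₁,|I|+1}(z,z_I) W_{g₂,|J|+1}(z̄,z_J)`,
where `g₁ + g₂ = g`, `I ⊔ J = {2,…,n}`, and the terms containing `W_{0,1}` are left out. The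
terms of this sum that contain `W_{0,2}`, i.e. those with `g₁ = 0`, `I = {j}` or `g₂ = 0`,
`J = {j}`, are the terms `W_{0,2}(z,z_j) W_{g,n-1}(z̄,⋯) + W_{0,2}(z̄,z_j) W_{g,n-1}(z,⋯)`
(for `(g,n) = (0,3)` every such product occurs once); all other terms are stable.
Each term contains the argument `z̄` exactly once, so that `dz̄ = -dz` gives the overall sign
`-1` of the coefficient function. -/
def W (a : ℂ) : (g n : ℕ) → (Fin n → ℂ) → ℂ
  | _, 0, _ => 0
  | g, n + 1, v =>
    if g = 0 ∧ n = 0 then curveY a (v 0) * deriv (curveX a) (v 0)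
    else if g = 0 ∧ n = 1 then bergman (v 0) (v (Fin.last n))
    else residueZero fun z => kernel a z (v 0) *
      -((if 1 ≤ g then
            W a (g - 1) (n + 2)
              (Fin.cons z (Fin.cons (-z) (Fin.tail v : Fin n → ℂ) : Fin (n + 1) → ℂ))
          else 0)
        + ∑ g₁ : Fin (g + 1), ∑ I : Finset (Fin n),
            if ((g₁ : ℕ) = 0 ∧ I.card = 0) ∨ (g - (g₁ : ℕ) = 0 ∧ Iᶜ.card = 0) then 0
            else
              W a g₁ (I.card + 1)
                  (Fin.cons z fun i => Fin.tail v (I.orderEmbOfFin rfl i))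
                * W a (g - g₁) (Iᶜ.card + 1)
                  (Fin.cons (-z) fun j => Fin.tail v (Iᶜ.orderEmbOfFin rfl j)))
  termination_by g n => 2 * g + n
  decreasing_by
    · omega
    · have h1 := Finset.card_add_card_compl I
      have h2 := g₁.isLt
      rw [Fintype.card_fin] at h1
      omega
    · have h1 := Finset.card_add_card_compl I
      have h2 := g₁.isLt
      rw [Fintype.card_fin] at h1
      omega

/-- The integral of `f(ζ) dζ` from `-z` to `z` along the half circle `ζ = z e^{iθ}`,
`-π ≤ θ ≤ 0`, which avoids the ramification point `0`. -/
def halfCircleInt (f : ℂ → ℂ) (z : ℂ) : ℂ :=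
  ∫ θ in (-Real.pi)..0,
    f (z * Complex.exp (θ * Complex.I)) * (Complex.I * z * Complex.exp (θ * Complex.I))

/-- The iterated integral `∫_{-z₁}^{z₁} ⋯ ∫_{-zₙ}^{zₙ} f(ζ₁,…,ζₙ) dζ₁ ⋯ dζₙ`. -/
def multiInt : (n : ℕ) → ((Fin n → ℂ) → ℂ) → (Fin n → ℂ) → ℂ
  | 0, f, v => f v
  | n + 1, f, v =>
      halfCircleInt
        (fun ζ => multiInt n (fun w => f (Fin.cons ζ w)) (Fin.tail v)) (v 0)

/-- The open free energy `F_{g,n}(z₁,…,zₙ)` (for `2g - 2 + n ≥ 1`). -/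
def openF (a : ℂ) (g n : ℕ) (v : Fin n → ℂ) : ℂ := 1 / 2 ^ n * multiInt n (W a g n) v

/-! ### The functions `S_m` -/

/-- The functions `S_m(x,t)`. Here `z(x,t)` is the branch of `√(x + 2q₀(t))`, and `ℓ(x,t)` the
branch of `log (y / (2 (x - q₀)))` in use.
`S_0 = ∫_v^x y dx` is taken from the branch point `v = -2q₀` (i.e. `z = 0`) on the spectral
curve; `S_1 = - ℓ / 2`; and for `m ≥ 2`, `S_m` is the sum of `F_{g,n}(z,…,z) / n!` over
`g ≥ 0`, `n ≥ 1` with `2g - 2 + n = m - 1`, i.e. `2g + n = m + 1`. -/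
def S (q₀ : ℂ → ℂ) (z ℓ : ℂ → ℂ → ℂ) : ℕ → ℂ → ℂ → ℂ
  | 0 => fun x t =>
      segInt (fun ζ => curveY (q₀ t) ζ * deriv (curveX (q₀ t)) ζ) 0 (z x t)
  | 1 => fun x t => -(1 / 2) * ℓ x t
  | m + 2 => fun x t =>
      ∑ gn ∈ (Finset.range (m + 4) ×ˢ Finset.range (m + 4)).filter
          (fun gn => 1 ≤ gn.2 ∧ 2 * gn.1 + gn.2 = (m + 2) + 1),
        openF (q₀ t) gn.1 gn.2 (fun _ => z x t) / (gn.2.factorial : ℂ)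

/-- For a family of functions `s_m(x,t)`, the value at `(x,t)` of the formal series
`∑_{m ≥ 0} ħ ^ (m - 1) s_m`. -/
def serS (s : ℕ → ℂ → ℂ → ℂ) (x t : ℂ) : LaurentSeries ℂ := hbar⁻¹ * ser fun m => s m x t

/-! ### WKB-type formal series -/

/-- A WKB-type formal series `exp (φ(x,t) / ħ) * ∑_{m ≥ 0} ħ ^ m a_m(x,t)`, with phase `φ` and
amplitude `∑ ħ ^ m a_m`. -/
structure WKB where
  phase : ℂ → ℂ → ℂ
  amp : ℕ → ℂ → ℂ → ℂ

/-- The action of `ħ ∂/∂x`: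
`ħ ∂_x (e^{φ/ħ} ∑ ħ^m a_m) = e^{φ/ħ} ∑ ħ^m (φ_x a_m + ∂_x a_{m-1})`. -/
def WKB.hdx (ψ : WKB) : WKB where
  phase := ψ.phase
  amp
    | 0 => fun x t => pdx ψ.phase x t * ψ.amp 0 x t
    | m + 1 => fun x t => pdx ψ.phase x t * ψ.amp (m + 1) x t + pdx (ψ.amp m) x t

/-- The action of `ħ ∂/∂t`. -/
def WKB.hdt (ψ : WKB) : WKB where
  phase := ψ.phase
  amp
    | 0 => fun x t => pdt ψ.phase x t * ψ.amp 0 x t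
    | m + 1 => fun x t => pdt ψ.phase x t * ψ.amp (m + 1) x t + pdt (ψ.amp m) x t

/-- The amplitude of a WKB-type series at `(x,t)`, i.e. the series divided by its exponential
factor `e^{φ/ħ}`. -/
def WKB.ampSer (ψ : WKB) (x t : ℂ) : LaurentSeries ℂ := ser fun m => ψ.amp m x t

/-- The WKB-type formal series `exp (∑_{m ≥ 0} ħ ^ (m - 1) s_m)`: its phase is `s_0` and its
amplitude is `exp (s_1) * exp (∑_{k ≥ 1} ħ ^ k s_{k+1})`. -/
def expWKB (s : ℕ → ℂ → ℂ → ℂ) : WKB where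
  phase := s 0
  amp m x t :=
    Complex.exp (s 1 x t) *
      PowerSeries.coeff m
        ((PowerSeries.exp ℂ).subst
          (PowerSeries.mk fun k => if k = 0 then 0 else s (k + 1) x t : PowerSeries ℂ))

end PainleveOne

end

open PainleveOne

/-! ### Virasoro operators on the polynomial Fock space and their first order parts. -/

noncomputable section
namespace PainleveOne
open MvPolynomial Finset

/-! Put μ² = 3q₀ and rescale z to ζ = z/μ. Then y becomes 2(ζ³ - ζ) up to a power of μ, and all
dependence on t sits in ζ, in powers of μ and in the weighted parameter ħ/μ⁵.

The topological recursion for this curve is a system of Virasoro constraints, (`virOp k` - 8κ⁻¹(∂ₖ -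
∂ₖ₊₁)) Z = 0 for k ≥ 0, on a series Z in a parameter κ whose coefficients are polynomials in times
x₀, x₁, …. The operators close under commutators (`virOp_comm`), so the constraints are integrable,
and a Poincaré lemma (`exists_pderiv_eq`) produces Z order by order. Let Φ = log Z
(`exists_freeEnergy`). The Taylor coefficients of Φ at the origin, contracted with the powers of
1/zᵢ in `pt`, satisfy the loop equations. The residue in the recursion only extracts a principal
part, so these coefficients are the W_{g,n} up to powers of 1/μ (`W_eq_wFormula`). Integrating and
summing over n is Taylor's formula: for m ≥ 2, S_m is Φ_{m-1} at xₖ = -ζ⁻²ᵏ⁻¹/(2k+1), up to a power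
of 1/μ (`S_eq`).

On this diagonal the loop equation contains, besides ζ-derivatives, only the unknown ∂₀Φ. The
constraint k = 0 and a homogeneity identity of dilaton type (`exists_variation`) trade it for a
scaling derivative, that is ∂_t, and for constants c n. The result (`diagonal_equation`,
`schroedinger_series`) is a Schrödinger equation ħ²(S_x² + S_xx) = 2ħ² S_t + 4x³ + 2tx + 2H, where H
depends on t and ħ only and is built from the constants c n.

It remains to prove the evolution equation and to recognize H. Define q by H' = -q, let p = ħq', and
let R = 2(x - q)ħS_t - ħS_x + p. The Schrödinger equation and the equality of mixed derivatives give
a linear equation for R whose inhomogeneity is affine in x (`residual_identity`); its coefficients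
measure the failure of the Painlevé equation for q and of the identity 2H = p² - 4q³ - 2tq. Order by
order, the linear operator is (ζ² - 1)((ζ² - 1) d/dζ - 2ζ). Its kernel is spanned by ζ² - 1, while R
has degree at most one in ζ. Hence R and both coefficients vanish together (`eq_zero_of_linearized`,
`residual_vanishes`). So q is the formal Painlevé solution with leading term q₀, which the recursion
determines (`qEven_eq`), and both equations for S follow (`BranchData.riccati`). Passing from S to
exp S is a formal chain rule (`hasDerivAt_expAmp`). -/

/-- The polynomial Fock space: `X k` stands for `z⁻²ᵏ⁻¹`. -/
abbrev Fock := MvPolynomial ℕ ℂ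

/-- The derivation `∑ᵢ (2i+1) xᵢ ∂_{i+k-1}`. -/
def vir (k : ℕ) : Derivation ℂ Fock Fock :=
  mkDerivation ℂ fun j => if k ≤ j + 1 then C (2 * ((j + 1 - k : ℕ) : ℂ) + 1) * X (j + 1 - k) else 0

/-- The second order operator `∑_{i+j=k-2} ∂ᵢ ∂ⱼ`. -/
def quad (k : ℕ) (f : Fock) : Fock := ∑ i ∈ range (k - 1), pderiv i (pderiv (k - 2 - i) f)

/-- The multiplication parts of the Virasoro operators. -/
def anom (k : ℕ) : Fock := if k = 0 then X 0 ^ 2 else if k = 1 then C (1 / 4) else 0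

/-- The Virasoro operators, without their first order constant coefficient part. -/
def virOp (k : ℕ) (f : Fock) : Fock := 2 * vir k f + quad k f + anom k * f

theorem C_two : (2 : Fock) = C 2 := (map_ofNat C 2).symm

theorem pderiv_comm (i j : ℕ) (f : Fock) : pderiv i (pderiv j f) = pderiv j (pderiv i f) := by
  have : ⁅(pderiv i : Derivation ℂ Fock Fock), pderiv j⁆ = (0 : Derivation ℂ Fock Fock) := by
    apply derivation_ext; intro k
    rw [Derivation.commutator_apply, pderiv_X, pderiv_X]
    simp [Pi.single_apply, apply_ite]
  have h := congrArg (fun D => D f) this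
  simp only [Derivation.commutator_apply, Derivation.coe_zero, Pi.zero_apply] at h
  exact sub_eq_zero.1 h

/-- A commutator of derivations is a derivation, so it suffices to compare values on the variables;
all first order commutators below are computed in this way. For l = k = 0 the extra term would be
∂₋₁, which is absent. -/
theorem pderiv_vir (l k : ℕ) (f : Fock) :
    pderiv l (vir k f) = vir k (pderiv l f)
      + (if 1 ≤ l + k then C (2 * (l : ℂ) + 1) * pderiv (l + k - 1) f else 0) := by
  have : ⁅(pderiv l : Derivation ℂ Fock Fock), vir k⁆
      = if 1 ≤ l + k then (2 * (l : ℂ) + 1) • (pderiv (l + k - 1)) else 0 := by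
    apply derivation_ext; intro j
    rw [Derivation.commutator_apply, vir, mkDerivation_X, pderiv_X]
    -- The only variable that contributes is the one with j = l + k - 1. The second conjunct
    -- excludes truncated subtraction.
    by_cases hj : l = j + 1 - k ∧ k ≤ j + 1
    · obtain ⟨rfl, h⟩ := hj
      have h1 : 1 ≤ j + 1 - k + k ∨ ¬ (1 ≤ j + 1 - k + k) := em _
      have h2 : j + 1 - k + k - 1 = j := by omega
      have h3 : 1 ≤ j + 1 - k + k := by omega
      rw [if_pos h, if_pos h3, h2, Derivation.leibniz]
      simp [Pi.single_apply, apply_ite, MvPolynomial.smul_eq_C_mul]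
    · have : (if 1 ≤ l + k then (2 * (l : ℂ) + 1) • (pderiv (l + k - 1)) else 0 :
          Derivation ℂ Fock Fock) (X j) = 0 := by
        split_ifs with h
        · rw [Derivation.smul_apply, pderiv_X_of_ne, smul_zero]
          intro h'; apply hj; omega
        · rfl
      rw [this]
      have hs : vir k (Pi.single (M := fun _ => Fock) l 1 j) = 0 := by
        by_cases h : l = j
        · subst h; simp
        · rw [Pi.single_eq_of_ne (Ne.symm h)]; simp
      rw [vir] at hs
      rw [hs]
      split_ifs with h
      · rw [pderiv_C_mul, pderiv_X_of_ne (by intro h'; exact hj ⟨h'.symm, h⟩)]; simp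
      · simp
  have h := congrArg (fun D => D f) this
  simp only [Derivation.commutator_apply] at h
  rw [sub_eq_iff_eq_add'] at h
  rw [h]
  split_ifs <;> simp [MvPolynomial.smul_eq_C_mul]

theorem pderiv_quad (l k : ℕ) (f : Fock) : pderiv l (quad k f) = quad k (pderiv l f) := by
  simp only [quad, map_sum]
  exact sum_congr rfl fun i _ => by rw [pderiv_comm l, pderiv_comm l]

/-- The multiplication part does not contribute, because ∂ₗ x₀² ≠ 0 would require l = k = 0, which
`h` excludes. -/
theorem pderiv_virOp (l k : ℕ) (h : 1 ≤ l + k) (f : Fock) :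
    pderiv l (virOp k f) = virOp k (pderiv l f) + C (2 * (2 * (l : ℂ) + 1)) * pderiv (l + k - 1) f := by
  have ha : pderiv l (anom k) = 0 := by
    unfold anom
    split_ifs with h1 h2
    · rw [pderiv_pow, pderiv_X_of_ne (by omega)]; simp
    · simp
    · simp
  have h2 : pderiv l (2 : Fock) = 0 := by
    rw [C_two]; exact pderiv_C
  simp only [virOp, map_add, pderiv_mul, pderiv_vir, pderiv_quad, if_pos h, ha, h2, C_mul]
  rw [C_two]
  ring

/-- Both compositions send the variable of index k + l + i to a multiple of the one of index i. The
multiples share the factor 2i + 1 and differ in 2(k + i) + 1 against 2(l + i) + 1. -/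
theorem vir_vir_succ (k l : ℕ) (f : Fock) :
    vir (k + 1) (vir (l + 1) f) - vir (l + 1) (vir (k + 1) f)
      = C (2 * ((k : ℂ) - l)) * vir (k + l + 1) f := by
  have : ⁅vir (k + 1), vir (l + 1)⁆ = (2 * ((k : ℂ) - l)) • vir (k + l + 1) := by
    apply derivation_ext; intro j
    rw [Derivation.commutator_apply, Derivation.smul_apply]
    simp only [vir, mkDerivation_X]
    by_cases h : k + l ≤ j
    · obtain ⟨i, rfl⟩ := Nat.exists_eq_add_of_le h
      rw [if_pos (by omega), if_pos (by omega), if_pos (by omega), Derivation.leibniz,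
        Derivation.leibniz]
      simp only [mkDerivation_X, derivation_C, smul_zero, add_zero]
      rw [if_pos (by omega), if_pos (by omega)]
      have e1 : k + l + i + 1 - (l + 1) = k + i := by omega
      have e2 : k + l + i + 1 - (k + 1) = l + i := by omega
      have e3 : k + l + i + 1 - (k + l + 1) = i := by omega
      have e4 : k + i + 1 - (k + 1) = i := by omega
      have e5 : l + i + 1 - (l + 1) = i := by omega
      rw [e1, e2, e3, e4, e5]
      simp only [smul_eq_mul, MvPolynomial.smul_eq_C_mul, ← mul_assoc, ← C_mul, ← sub_mul, ← C_sub]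
      congr 2; push_cast; ring
    · rw [if_neg (show ¬ (k + l + 1 ≤ j + 1) by omega), smul_zero]
      have aux : ∀ a b : ℕ, ¬ (a + b ≤ j) →
        (mkDerivation ℂ fun j => if a + 1 ≤ j + 1 then C (2 * ((j + 1 - (a + 1) : ℕ) : ℂ) + 1)
          * X (j + 1 - (a + 1)) else 0 : Derivation ℂ Fock Fock)
          (if b + 1 ≤ j + 1 then C (2 * ((j + 1 - (b + 1) : ℕ) : ℂ) + 1) * X (j + 1 - (b + 1)) else 0)
          = 0 := by
        intro a b hab
        split_ifs with hb
        · rw [Derivation.leibniz, mkDerivation_X, if_neg (by omega)]; simp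
        · simp
      rw [aux k l h, aux l k (by omega), sub_zero]
  have h := congrArg (fun D => D f) this
  simpa [Derivation.commutator_apply, MvPolynomial.smul_eq_C_mul] using h

/-- The term x₀ ∂_{l-1} is a boundary effect: on the variable of index l - 1 only one of the two
compositions survives. It will cancel against the commutator of `quad` with x₀². -/
theorem vir_zero_vir_succ (l : ℕ) (f : Fock) :
    vir 0 (vir (l + 1) f) - vir (l + 1) (vir 0 f)
      = -(C (2 * ((l : ℂ) + 1)) * vir l f) + (if 1 ≤ l then X 0 * pderiv (l - 1) f else 0) := by
  have : ⁅vir 0, vir (l + 1)⁆ = -((2 * ((l : ℂ) + 1)) • vir l)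
      + (if 1 ≤ l then (X 0 : Fock) • pderiv (l - 1) else 0) := by
    apply derivation_ext; intro j
    rw [Derivation.commutator_apply, Derivation.add_apply, Derivation.neg_apply,
      Derivation.smul_apply]
    simp only [vir, mkDerivation_X]
    rcases lt_trichotomy l (j + 1) with h | rfl | h
    · obtain ⟨i, rfl⟩ := Nat.exists_eq_add_of_le (Nat.lt_succ_iff.1 h)
      have hz : (if 1 ≤ l then (X 0 : Fock) • pderiv (l - 1) else 0 : Derivation ℂ Fock Fock)
          (X (l + i)) = 0 := by
        split_ifs with h
        · rw [Derivation.smul_apply, pderiv_X_of_ne (by omega), smul_zero]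
        · rfl
      rw [hz, if_pos (by omega), if_pos (by omega), if_pos (by omega), Derivation.leibniz,
        Derivation.leibniz]
      simp only [mkDerivation_X, derivation_C, smul_zero, add_zero]
      rw [if_pos (by omega), if_pos (by omega)]
      have e1 : l + i + 1 - (l + 1) = i := by omega
      have e2 : l + i + 1 - 0 + 1 - (l + 1) = i + 1 := by omega
      have e3 : l + i + 1 - l = i + 1 := by omega
      rw [e1, e2, e3]
      simp only [smul_eq_mul, MvPolynomial.smul_eq_C_mul, ← mul_assoc, ← C_mul, ← sub_mul, ← C_sub,
        Nat.sub_zero, ← neg_mul, ← C_neg]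
      congr 2; push_cast; ring
    · rw [if_neg (by omega), if_pos (by omega), if_pos (by omega), if_pos (by omega)]
      simp [Derivation.leibniz, mkDerivation_X, MvPolynomial.smul_eq_C_mul]
      rw [← C_two]; ring
    · rw [if_neg (by omega), if_pos (by omega), if_neg (by omega), if_pos (by omega)]
      rw [Derivation.leibniz, mkDerivation_X, if_neg (by omega), Derivation.smul_apply,
        pderiv_X_of_ne (by omega)]
      simp
  have h := congrArg (fun D => D f) this
  simp only [Derivation.commutator_apply] at h
  rw [h, Derivation.add_apply, Derivation.neg_apply]
  split_ifs <;> simp [MvPolynomial.smul_eq_C_mul]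
end PainleveOne
end

/-! ### Commutators of the full Virasoro operators. -/

noncomputable section
namespace PainleveOne
open MvPolynomial Finset

theorem D_C_mul (D : Derivation ℂ Fock Fock) (a : ℂ) (f : Fock) : D (C a * f) = C a * D f := by
  rw [C_mul', C_mul', D.map_smul]

theorem D_two_mul (D : Derivation ℂ Fock Fock) (f : Fock) : D (2 * f) = 2 * D f := by
  rw [C_two, D_C_mul]

theorem C_four : (4 : Fock) = C 4 := (map_ofNat C 4).symm

theorem anom_succ (k : ℕ) : anom (k + 1) = C (if k = 0 then 1 / 4 else 0) := by
  rcases k with _ | k <;> simp [anom]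

/-- Either of the two derivatives in ∂ᵢ∂ⱼ can hit the coefficients of `vir k`. The reflection i ↔ j
exchanges the two contributions, hence the factor 2. -/
theorem quad_vir (k l : ℕ) (f : Fock) :
    quad (l + 1) (vir k f) - vir k (quad (l + 1) f)
      = 2 * ∑ i ∈ range l, if 1 ≤ i + k then
          C (2 * (i : ℂ) + 1) * pderiv (i + k - 1) (pderiv (l - 1 - i) f) else 0 := by
  have key : ∀ i j : ℕ, pderiv i (pderiv j (vir k f)) - vir k (pderiv i (pderiv j f))
      = (if 1 ≤ i + k then C (2 * (i : ℂ) + 1) * pderiv (i + k - 1) (pderiv j f) else 0)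
        + (if 1 ≤ j + k then C (2 * (j : ℂ) + 1) * pderiv (j + k - 1) (pderiv i f) else 0) := by
    intro i j
    rw [pderiv_vir j, map_add, pderiv_vir i]
    split_ifs <;> simp only [map_zero, pderiv_C_mul, pderiv_comm i (j + k - 1)] <;> ring
  simp only [quad, map_sum, ← sum_sub_distrib, Nat.add_sub_cancel]
  rw [two_mul]
  nth_rewrite 3 [← sum_range_reflect]
  rw [← sum_add_distrib]
  refine sum_congr rfl fun i hi => ?_
  have hi := mem_range.1 hi
  rw [show l + 1 - 2 - i = l - 1 - i by omega, key, show l - 1 - (l - 1 - i) = i by omega]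

/-- Averaging the weight 2i + c over the reflection i ↔ n - 1 - i replaces it by its mean value n -
1 + c. -/
theorem sum_symm_weight (n : ℕ) (c : ℂ) (g : ℕ → Fock) (hg : ∀ i < n, g (n - 1 - i) = g i) :
    ∑ i ∈ range n, C (2 * (i : ℂ) + c) * g i = C ((n : ℂ) - 1 + c) * ∑ i ∈ range n, g i := by
  have h : ∑ i ∈ range n, C (2 * (i : ℂ) + c) * g i
      = ∑ i ∈ range n, C (2 * ((n : ℂ) - 1 - i) + c) * g i := by
    rw [← sum_range_reflect]
    refine sum_congr rfl fun i hi => ?_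
    have hi := mem_range.1 hi
    rw [hg i hi, show n - 1 - i = n - (1 + i) by omega, Nat.cast_sub (by omega)]
    congr 2; push_cast; ring
  have h2 : ∑ i ∈ range n, C (2 * (i : ℂ) + c) * g i + ∑ i ∈ range n, C (2 * (i : ℂ) + c) * g i
      = 2 * (C ((n : ℂ) - 1 + c) * ∑ i ∈ range n, g i) := by
    nth_rewrite 2 [h]
    rw [← sum_add_distrib, mul_sum, mul_sum]
    refine sum_congr rfl fun i _ => ?_
    rw [C_two, ← add_mul, ← mul_assoc, ← C_add, ← C_mul]
    congr 2; ring
  rw [← two_mul] at h2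
  exact mul_left_cancel₀ two_ne_zero h2

/-- The two commutators of a quadratic with a first order part cover complementary ranges of the
terms `g` of `quad (k + l + 1)`. After a reflection they form one sum with weight 2i - 2k + 1, whose
mean is l - k. The scalar in `anom (k + l + 1)` is harmless: it occurs only for k = l = 0, where the
factor k - l vanishes. -/
theorem virOp_comm_succ (k l : ℕ) (f : Fock) :
    virOp (k + 1) (virOp (l + 1) f) - virOp (l + 1) (virOp (k + 1) f)
      = C (4 * ((k : ℂ) - l)) * virOp (k + l + 1) f := by
  obtain ⟨g, hg⟩ : ∃ g : ℕ → Fock, g = fun i => pderiv i (pderiv (k + l - 1 - i) f) := ⟨_, rfl⟩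
  have hsymm : ∀ i < k + l, g (k + l - 1 - i) = g i := fun i hi => by
    rw [hg]; dsimp only
    rw [pderiv_comm, show k + l - 1 - (k + l - 1 - i) = i by omega]
  have h1 := quad_vir (k + 1) l f
  have h2 := quad_vir (l + 1) k f
  have hw := sum_symm_weight (k + l) (-2 * (k : ℂ) + 1) g hsymm
  have hs1 : (∑ i ∈ range l, if 1 ≤ i + (k + 1) then
          C (2 * (i : ℂ) + 1) * pderiv (i + (k + 1) - 1) (pderiv (l - 1 - i) f) else 0)
      = ∑ i ∈ range l, C (2 * ((k + i : ℕ) : ℂ) + (-2 * (k : ℂ) + 1)) * g (k + i) := by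
    refine sum_congr rfl fun i hi => ?_
    have hi := mem_range.1 hi
    rw [if_pos (by omega), hg]; dsimp only
    rw [show i + (k + 1) - 1 = k + i by omega, show k + l - 1 - (k + i) = l - 1 - i by omega]
    congr 2; push_cast; ring
  have hs2 : (∑ i ∈ range k, if 1 ≤ i + (l + 1) then
          C (2 * (i : ℂ) + 1) * pderiv (i + (l + 1) - 1) (pderiv (k - 1 - i) f) else 0)
      = -∑ i ∈ range k, C (2 * (i : ℂ) + (-2 * (k : ℂ) + 1)) * g i := by
    rw [← sum_range_reflect, ← sum_neg_distrib]
    refine sum_congr rfl fun i hi => ?_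
    have hi := mem_range.1 hi
    rw [if_pos (by omega), hg]; dsimp only
    rw [show k - 1 - i + (l + 1) - 1 = k + l - 1 - i by omega,
      show k - 1 - (k - 1 - i) = i by omega, pderiv_comm,
      show k - 1 - i = k - (1 + i) by omega, Nat.cast_sub (by omega), ← neg_mul, ← C_neg]
    congr 2; push_cast; ring
  have hq : ∑ i ∈ range (k + l), g i = quad (k + l + 1) f := by
    rw [hg, quad]; rfl
  rw [hs1] at h1
  rw [hs2] at h2
  rw [sum_range_add, hq] at hw
  have hv := vir_vir_succ k l f
  have hqq : quad (k + 1) (quad (l + 1) f) = quad (l + 1) (quad (k + 1) f) := by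
    simp only [quad, map_sum]
    rw [sum_comm]
    refine sum_congr rfl fun i _ => sum_congr rfl fun j _ => ?_
    rw [pderiv_comm _ i, pderiv_comm j i, pderiv_comm _ (l + 1 - 2 - i),
      pderiv_comm j (l + 1 - 2 - i)]
  have hvl : ∀ m n a, vir m (2 * vir n f + quad n f + C a * f)
      = 2 * vir m (vir n f) + vir m (quad n f) + C a * vir m f := by
    intro m n a; rw [C_two]; simp only [map_add, D_C_mul]
  have hql : ∀ m n a, quad m (2 * vir n f + quad n f + C a * f)
      = 2 * quad m (vir n f) + quad m (quad n f) + C a * quad m f := by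
    intro m n a; rw [C_two]
    simp only [quad, map_add, pderiv_C_mul, sum_add_distrib, mul_sum]
  have ha' : C ((k : ℂ) - l) * anom (k + l + 1) = 0 := by
    rw [anom_succ, ← C_mul]
    split_ifs with h
    · have : k = 0 ∧ l = 0 := by omega
      simp [this]
    · simp
  simp only [virOp] at *
  rw [anom_succ k, anom_succ l, hvl, hvl, hql, hql]
  rw [show (C (4 * ((k : ℂ) - l)) : Fock) = 4 * C ((k : ℂ) - l) by rw [C_mul, C_four]]
  rw [show (C (2 * ((k : ℂ) - l)) : Fock) = 2 * C ((k : ℂ) - l) by rw [C_mul, C_two]] at hv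
  rw [show (((k + l : ℕ) : ℂ) - 1 + (-2 * (k : ℂ) + 1)) = -((k : ℂ) - l) by push_cast; ring,
    C_neg] at hw
  linear_combination (exp := 1) 4 * hv - 2 * h1 + 2 * h2 - 4 * hw + hqq - 4 * f * ha'

/-- The scalar term arises only from ∂₀∂₀, that is for l = 1. It is this term that forces the value
1/4 in `anom 1`. -/
theorem quad_X_sq_mul (l : ℕ) (f : Fock) :
    quad (l + 1) (X 0 ^ 2 * f) = X 0 ^ 2 * quad (l + 1) f
      + (if 1 ≤ l then 4 * X 0 * pderiv (l - 1) f else 0) + (if l = 1 then 2 * f else 0) := by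
  have key : ∀ i j : ℕ, pderiv i (pderiv j (X 0 ^ 2 * f)) = X 0 ^ 2 * pderiv i (pderiv j f)
      + ((if i = 0 then 2 * X 0 * pderiv j f else 0)
        + (if j = 0 then 2 * X 0 * pderiv i f else 0))
      + (if i = 0 then (if j = 0 then 2 * f else 0) else 0) := by
    intro i j
    rw [pow_two, pderiv_mul, pderiv_mul, map_add, pderiv_mul, pderiv_mul, pderiv_mul, map_add,
      pderiv_mul, pderiv_mul]
    have hX : ∀ l, pderiv l (X 0 : Fock) = if l = 0 then 1 else 0 := by
      intro l
      split_ifs with h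
      · rw [h, pderiv_X_self]
      · exact pderiv_X_of_ne (Ne.symm h)
    rw [hX i, hX j]
    by_cases hi : i = 0 <;> by_cases hj : j = 0 <;> simp [hi, hj] <;> ring
  rw [quad]
  simp only [key, sum_add_distrib, ← mul_sum, Nat.add_sub_cancel]
  rw [quad, Nat.add_sub_cancel]
  rcases l with _ | l
  · simp
  · have e : ∀ F : ℕ → Fock, ∑ i ∈ range (l + 1), (if l + 1 + 1 - 2 - i = 0 then F i else 0) = F l := by
      intro F
      rw [sum_eq_single l]
      · rw [if_pos (by omega)]
      · intro i hi hil; have := mem_range.1 hi; rw [if_neg (by omega)]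
      · intro h; simp at h
    rw [e, sum_ite_eq' , sum_ite_eq']
    simp only [mem_range, Nat.zero_lt_succ, if_true, le_add_iff_nonneg_left, zero_le,
      Nat.add_sub_cancel]
    rw [show l + 1 + 1 - 2 - 0 = l by omega]
    by_cases h : l = 0 <;> simp [h] <;> ring

theorem virOp_comm_zero (l : ℕ) (f : Fock) :
    virOp 0 (virOp (l + 1) f) - virOp (l + 1) (virOp 0 f)
      = -(C (4 * ((l : ℂ) + 1)) * virOp l f) := by
  have h1 := quad_vir 0 l f
  have hv := vir_zero_vir_succ l f
  have hX := quad_X_sq_mul l f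
  have hs : (∑ i ∈ range l, if 1 ≤ i + 0 then
          C (2 * (i : ℂ) + 1) * pderiv (i + 0 - 1) (pderiv (l - 1 - i) f) else 0)
      = C ((l : ℂ) + 1) * quad l f := by
    rcases l with _ | l
    · simp [quad]
    · rw [sum_range_succ', if_neg (by omega), add_zero]
      have hw := sum_symm_weight l 3 (fun i => pderiv i (pderiv (l - 1 - i) f)) (by
        intro i hi
        rw [pderiv_comm, show l - 1 - (l - 1 - i) = i by omega])
      rw [quad, Nat.add_sub_cancel]
      rw [show ((l + 1 : ℕ) : ℂ) + 1 = (l : ℂ) - 1 + 3 by push_cast; ring,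
        show l + 1 - 2 = l - 1 by omega, ← hw]
      refine sum_congr rfl fun i hi => ?_
      have hi := mem_range.1 hi
      rw [if_pos (by omega), show i + 1 + 0 - 1 = i by omega,
        show l - (i + 1) = l - 1 - i by omega]
      congr 2; push_cast; ring
  rw [hs] at h1
  have hq0 : ∀ g, quad 0 g = 0 := fun g => by simp [quad]
  have hql : quad (l + 1) (2 * vir 0 f + X 0 ^ 2 * f)
      = 2 * quad (l + 1) (vir 0 f) + quad (l + 1) (X 0 ^ 2 * f) := by
    rw [C_two]
    simp only [quad, map_add, pderiv_C_mul, sum_add_distrib, mul_sum]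
  have hvX : vir (l + 1) (X 0 ^ 2 * f)
      = X 0 ^ 2 * vir (l + 1) f + (if l = 0 then 2 * X 0 ^ 2 * f else 0) := by
    rw [Derivation.leibniz, Derivation.leibniz_pow, vir, mkDerivation_X]
    by_cases h : l = 0
    · subst h; simp; ring
    · rw [if_neg (by omega), if_neg h]; simp
  have ha := anom_succ l
  have ha' : C (4 * ((l : ℂ) + 1)) * anom l * f
      = (if l = 0 then 4 * X 0 ^ 2 * f else 0) + (if l = 1 then 2 * f else 0) := by
    rcases l with _ | _ | l
    · simp [anom, C_four]
    · simp only [anom]; norm_num [← C_mul]; exact Or.inl C_two.symm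
    · simp [anom]
  simp only [virOp]
  rw [hq0, ha, anom, if_pos rfl, hq0, add_zero, add_zero, hql, hX, map_add, map_add, map_add,
    hvX, D_C_mul, D_two_mul, D_two_mul]
  rw [show (C (4 * ((l : ℂ) + 1)) : Fock) = 4 * C ((l : ℂ) + 1) by rw [C_mul, C_four]] at ha' ⊢
  rw [show (C (2 * ((l : ℂ) + 1)) : Fock) = 2 * C ((l : ℂ) + 1) by rw [C_mul, C_two]] at hv
  have hL : (if 1 ≤ l then 4 * X 0 * pderiv (l - 1) f else 0 : Fock)
      = 4 * if 1 ≤ l then X 0 * pderiv (l - 1) f else 0 := by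
    split_ifs <;> ring
  have hM : (if l = 0 then 4 * X 0 ^ 2 * f else 0 : Fock)
      = 2 * if l = 0 then 2 * X 0 ^ 2 * f else 0 := by
    split_ifs <;> ring
  rw [hL]
  rw [hM] at ha'
  linear_combination (exp := 1) 4 * hv - 2 * h1 + ha'
end PainleveOne
end

/-! ### Integration of the constraints: Poincaré lemma and partition function. -/

noncomputable section
namespace PainleveOne
open MvPolynomial Finset

theorem coeff_X_mul_pderiv (k : ℕ) (g : Fock) (m : ℕ →₀ ℕ) :
    coeff m (X k * pderiv k g) = (m k : ℂ) * coeff m g := by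
  induction g using MvPolynomial.induction_on' with
  | add p q hp hq => simp only [map_add, mul_add, coeff_add, hp, hq]
  | monomial n a =>
    rw [X_mul_pderiv_monomial, coeff_smul, coeff_monomial]
    split_ifs with h
    · subst h; simp
    · simp

/-- The Poincaré lemma for polynomials in infinitely many variables. -/
theorem exists_pderiv_eq (g : ℕ → Fock) (B : ℕ) (hB : ∀ k, B ≤ k → g k = 0)
    (hg : ∀ j k, pderiv j (g k) = pderiv k (g j)) :
    ∃ G : Fock, coeff 0 G = 0 ∧ ∀ k, pderiv k G = g k := by
  -- T divides the homogeneous part of degree d by d and kills constants, since 0⁻¹ = 0. Thus it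
  -- inverts the Euler operator, and the primitive is T applied to ∑ xₖ gₖ.
  obtain ⟨T, hT⟩ : ∃ T : Fock →ₗ[ℂ] Fock, ∀ m f,
      coeff m (T f) = ((m.degree : ℂ))⁻¹ * coeff m f := by
    refine ⟨(basisMonomials ℕ ℂ).constr ℂ fun m => monomial m ((m.degree : ℂ)⁻¹), fun m f => ?_⟩
    induction f using MvPolynomial.induction_on' with
    | add p q hp hq => simp only [map_add, coeff_add, hp, hq, mul_add]
    | monomial n a =>
      rw [show (monomial n a : Fock) = a • basisMonomials ℕ ℂ n by
        simp [coe_basisMonomials, smul_monomial], map_smul, Module.Basis.constr_basis,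
        coe_basisMonomials]
      simp only [coeff_smul, coeff_monomial, smul_eq_mul]
      split_ifs with h
      · subst h; ring
      · simp
  have key : ∀ j k m, coeff (m + Finsupp.single j 1) (X k * g k) * (m j + 1)
      = (((m + Finsupp.single j 1 : ℕ →₀ ℕ) k : ℕ) : ℂ) * coeff m (g j) := by
    intro j k m
    rw [← coeff_pderiv, pderiv_mul, hg, coeff_add, coeff_X_mul_pderiv k]
    by_cases h : k = j
    · subst h; simp; ring
    · rw [pderiv_X_of_ne h]; simp [Ne.symm h]
  refine ⟨∑ k ∈ range B, T (X k * g k), ?_, fun j => ?_⟩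
  · rw [coeff_sum]
    exact sum_eq_zero fun k _ => by rw [hT]; simp
  · ext m
    rw [coeff_pderiv, coeff_sum]
    simp only [hT, ← mul_sum]
    rw [mul_assoc, sum_mul]
    simp only [key]
    rw [← sum_mul]
    by_cases h0 : coeff m (g j) = 0
    · simp [h0]
    -- A variable of index k ≥ B cannot occur in m when `g j` has a nonzero coefficient there,
    -- because ∂ₖ gⱼ = ∂ⱼ gₖ = 0. So the sum over `range B` sees the full degree.
    have hsub : (m + Finsupp.single j 1 : ℕ →₀ ℕ).support ⊆ range B := by
      intro k hk
      by_contra hkB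
      have hkB : B ≤ k := by simpa using hkB
      rw [Finsupp.mem_support_iff] at hk
      by_cases hkj : k = j
      · subst hkj; exact h0 (by rw [hB k hkB]; simp)
      · have h1 := coeff_X_mul_pderiv k (g j) m
        rw [hg, hB k hkB] at h1
        simp only [map_zero, mul_zero, coeff_zero] at h1
        rcases mul_eq_zero.1 h1.symm with h | h
        · apply hk; simpa [Finsupp.single_apply, Ne.symm hkj] using Nat.cast_eq_zero.1 h
        · exact h0 h
    have hd : ∑ k ∈ range B, (((m + Finsupp.single j 1 : ℕ →₀ ℕ) k : ℕ) : ℂ)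
        = ((m + Finsupp.single j 1).degree : ℂ) := by
      rw [Finsupp.degree_apply, Nat.cast_sum]
      exact (sum_subset hsub fun k _ hk => by rw [Finsupp.notMem_support_iff.1 hk, Nat.cast_zero]).symm
    rw [hd, ← mul_assoc, inv_mul_cancel₀, one_mul]
    rw [map_add, Finsupp.degree_single]
    exact_mod_cast Nat.succ_ne_zero (Finsupp.degree m)

theorem exists_pderiv_eq_zero (f : Fock) : ∃ B, ∀ k, B ≤ k → pderiv k f = 0 := by
  obtain ⟨B, hB⟩ := f.vars.exists_nat_subset_range
  refine ⟨B, fun k hk => pderiv_eq_zero_of_notMem_vars fun h => ?_⟩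
  have := mem_range.1 (hB h)
  omega

theorem D_eq_sum (D : Derivation ℂ Fock Fock) (f : Fock) (B : ℕ)
    (hB : ∀ k, B ≤ k → pderiv k f = 0) : D f = ∑ i ∈ range B, D (X i) * pderiv i f := by
  obtain ⟨B', hB'⟩ := f.vars.exists_nat_subset_range
  have hE : ∀ C g, (∑ i ∈ range C, D (X i) • pderiv i : Derivation ℂ Fock Fock) g
      = ∑ i ∈ range C, D (X i) * pderiv i g := by
    intro C g
    induction C with
    | zero => simp
    | succ C ih => rw [sum_range_succ, sum_range_succ, Derivation.add_apply, ih]; rfl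
  have h1 : D f = ∑ i ∈ range (max B B'), D (X i) * pderiv i f := by
    rw [← hE]
    apply derivation_eq_of_forall_mem_vars
    intro i hi
    have hi := mem_range.1 (hB' hi)
    rw [hE, sum_eq_single i]
    · rw [pderiv_X_self, mul_one]
    · intro b _ hb; rw [pderiv_X_of_ne (Ne.symm hb), mul_zero]
    · intro h; simp at h; omega
  rw [h1]
  refine (sum_subset (range_subset_range.2 (le_max_left _ _)) fun k _ hk => ?_).symm
  rw [hB k (by simpa using hk), mul_zero]

theorem exists_virOp_eq_zero (f : Fock) : ∃ B, ∀ k, B ≤ k → virOp k f = 0 := by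
  obtain ⟨B, hB⟩ := exists_pderiv_eq_zero f
  refine ⟨2 * B + 2, fun k hk => ?_⟩
  have hv : vir k f = 0 := by
    rw [D_eq_sum _ f B hB]
    refine sum_eq_zero fun i hi => ?_
    have := mem_range.1 hi
    rw [vir, mkDerivation_X, if_neg (by omega), zero_mul]
  have hq : quad k f = 0 := by
    refine sum_eq_zero fun i hi => ?_
    have := mem_range.1 hi
    by_cases h : B ≤ i
    · rw [pderiv_comm, hB i h, map_zero]
    · rw [hB (k - 2 - i) (by omega), map_zero]
  have ha : anom k = 0 := by
    obtain ⟨l, rfl⟩ := Nat.exists_eq_add_of_le' (show 2 ≤ k by omega)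
    simp [anom]
  rw [virOp, hv, hq, ha]; simp

theorem virOp_sub (k : ℕ) (f g : Fock) : virOp k (f - g) = virOp k f - virOp k g := by
  simp only [virOp, quad, map_sub, sum_sub_distrib]; ring

theorem virOp_add (k : ℕ) (f g : Fock) : virOp k (f + g) = virOp k f + virOp k g := by
  simp only [virOp, quad, map_add, sum_add_distrib]; ring

theorem virOp_C_mul (k : ℕ) (a : ℂ) (f : Fock) : virOp k (C a * f) = C a * virOp k f := by
  simp only [virOp, quad, D_C_mul, ← mul_sum]; ring

/-- The difference operator `∂ₖ - ∂ₖ₊₁`. -/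
def dd (k : ℕ) : Derivation ℂ Fock Fock := pderiv k - pderiv (k + 1)

theorem dd_apply (k : ℕ) (f : Fock) : dd k f = pderiv k f - pderiv (k + 1) f := rfl

theorem eq_zero_of_succ {g : ℕ → Fock} (h : ∀ k, g k = g (k + 1)) {B : ℕ}
    (hB : ∀ k, B ≤ k → g k = 0) (k : ℕ) : g k = 0 := by
  have : ∀ n, g k = g (k + n) := by
    intro n; induction n with
    | zero => rfl
    | succ n ih => rw [ih, h]; rfl
  rw [this B]; exact hB _ (by omega)

theorem pderiv_eq_zero_of_dd {f : Fock} (h : ∀ k, dd k f = 0) (k : ℕ) : pderiv k f = 0 := by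
  obtain ⟨B, hB⟩ := exists_pderiv_eq_zero f
  exact eq_zero_of_succ (g := fun k => pderiv k f) (fun k => sub_eq_zero.1 (h k)) hB k

/-- Together with `virOp_comm` this says that the shifted operators `virOp k` - 8κ⁻¹ `dd k` satisfy
the same Virasoro relations: it is their part of order κ⁻¹. -/
theorem dd_virOp_comm (k l : ℕ) (f : Fock) :
    dd l (virOp k f) - dd k (virOp l f) - (virOp k (dd l f) - virOp l (dd k f))
      = if 1 ≤ l + k then C (4 * ((l : ℂ) - k)) * dd (l + k - 1) f else 0 := by
  by_cases h : 1 ≤ l + k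
  · obtain ⟨n, hn⟩ : ∃ n, l + k = n + 1 := ⟨l + k - 1, by omega⟩
    simp only [dd_apply, virOp_sub]
    rw [pderiv_virOp l k h, pderiv_virOp (l + 1) k (by omega), pderiv_virOp k l (by omega),
      pderiv_virOp (k + 1) l (by omega), if_pos h, hn, show l + 1 + k - 1 = n + 1 by omega,
      show k + l - 1 = n by omega, show k + 1 + l - 1 = n + 1 by omega, Nat.add_sub_cancel]
    simp only [C_mul, C_add, C_sub, Nat.cast_add, Nat.cast_one, C_1, ← C_two, ← C_four]
    ring
  · obtain ⟨rfl, rfl⟩ : l = 0 ∧ k = 0 := by omega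
    simp

theorem virOp_comm (k l : ℕ) (f : Fock) :
    virOp k (virOp l f) - virOp l (virOp k f)
      = if 1 ≤ l + k then C (4 * ((k : ℂ) - l)) * virOp (l + k - 1) f else 0 := by
  rcases k with _ | k <;> rcases l with _ | l
  · simp
  · rw [virOp_comm_zero, if_pos (by omega), ← neg_mul, ← C_neg]
    rw [show l + 1 + 0 - 1 = l by omega]; congr 2; push_cast; ring
  · rw [← neg_inj, neg_sub, virOp_comm_zero, if_pos (by omega)]
    rw [show 0 + (k + 1) - 1 = k by omega]; congr 3; push_cast; ring
  · rw [virOp_comm_succ, if_pos (by omega), show l + 1 + (k + 1) - 1 = k + l + 1 by omega]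
    congr 2; push_cast; ring

/-- One step of the construction of the partition function. -/
theorem exists_next {Y Z : Fock} (h : ∀ k, dd k Z = C (1 / 8) * virOp k Y) :
    ∃ Z' : Fock, coeff 0 Z' = 0 ∧ ∀ k, dd k Z' = C (1 / 8) * virOp k Z := by
  obtain ⟨f, hf⟩ : ∃ f : ℕ → Fock, f = fun k => C (1 / 8) * virOp k Z := ⟨_, rfl⟩
  obtain ⟨B, hB⟩ := exists_virOp_eq_zero Z
  -- Integrability. The commutator of the operators on Y and the term with `dd (l + k - 1) Z` carry
  -- opposite factors 4(k - l) and 4(l - k), and they cancel by the recursion that is already known.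
  have hclosed : ∀ k l, dd l (f k) = dd k (f l) := by
    intro k l
    have h1 := dd_virOp_comm k l Z
    rw [h, h, virOp_C_mul, virOp_C_mul, ← mul_sub, virOp_comm] at h1
    rw [hf]; dsimp only
    rw [D_C_mul, D_C_mul, ← sub_eq_zero, ← mul_sub, sub_eq_iff_eq_add.1 h1]
    split_ifs with hkl
    · rw [h]
      simp only [C_mul, C_sub]; ring
    · simp
  -- The prescribed differences are summed from infinity; this is the solution of g k - g (k + 1) =
  -- f k with g k = 0 for large k.
  obtain ⟨g, hg⟩ : ∃ g : ℕ → Fock, g = fun k => ∑ j ∈ range B, f (k + j) := ⟨_, rfl⟩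
  have hfB : ∀ k, B ≤ k → f k = 0 := fun k hk => by rw [hf]; simp [hB k hk]
  have hgs : ∀ k, g k - g (k + 1) = f k := by
    intro k
    rw [hg]; dsimp only
    have := sum_range_succ' (fun j => f (k + j)) B
    rw [sum_range_succ, hfB (k + B) (by omega), add_zero, add_zero] at this
    rw [this]
    simp [add_comm, add_left_comm]
  have hgB : ∀ k, B ≤ k → g k = 0 := fun k hk => by
    rw [hg]; exact sum_eq_zero fun j _ => hfB _ (by omega)
  have hgc : ∀ j k, pderiv j (g k) = pderiv k (g j) := by
    -- The curl H of g has vanishing mixed second difference because f is closed. It is zero far out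
    -- in each index, so it is zero, by descending first in one index and then in the other.
    obtain ⟨H, hH⟩ : ∃ H : ℕ → ℕ → Fock, H = fun l k => pderiv l (g k) - pderiv k (g l) := ⟨_, rfl⟩
    have h1 : ∀ l k, H l k - H (l + 1) k = H l (k + 1) - H (l + 1) (k + 1) := by
      intro l k
      have := hclosed k l
      rw [← hgs, ← hgs, dd_apply, dd_apply] at this
      simp only [map_sub] at this
      rw [hH]; linear_combination this
    have h2 : ∀ l, ∃ b, ∀ k, b ≤ k → H l k = 0 := by
      intro l
      obtain ⟨b, hb⟩ := exists_pderiv_eq_zero (g l)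
      refine ⟨max B b, fun k hk => ?_⟩
      rw [hH]; dsimp only
      rw [hgB k (le_of_max_le_left hk), hb k (le_of_max_le_right hk)]; simp
    have h3 : ∀ l k, H l k = H (l + 1) k := by
      intro l k
      obtain ⟨b, hb⟩ := h2 l
      obtain ⟨b', hb'⟩ := h2 (l + 1)
      exact sub_eq_zero.1 <| eq_zero_of_succ (g := fun k => H l k - H (l + 1) k) (h1 l)
        (B := max b b') (fun k hk => by
          rw [hb k (le_of_max_le_left hk), hb' k (le_of_max_le_right hk), sub_zero]) k
    intro j k
    obtain ⟨b, hb⟩ := h2 k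
    have := eq_zero_of_succ (g := fun l => H l k) (fun l => h3 l k) (B := b) (fun l hl => by
      have := hb l hl
      rw [hH] at this ⊢
      rw [← neg_eq_zero, neg_sub]; exact this) j
    rw [hH] at this
    exact sub_eq_zero.1 this
  obtain ⟨Z', h0, hZ'⟩ := exists_pderiv_eq g B hgB hgc
  exact ⟨Z', h0, fun k => by rw [dd_apply, hZ', hZ', hgs, hf]⟩

/-- The iteration carries pairs of consecutive terms, because integrability at one order uses the
recursion that led to that order. -/
theorem exists_partition : ∃ Z : ℕ → Fock, Z 0 = 1 ∧ (∀ n, coeff 0 (Z (n + 1)) = 0) ∧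
    ∀ n k, dd k (Z (n + 1)) = C (1 / 8) * virOp k (Z n) := by
  obtain ⟨Z₁, h0, h1⟩ := exists_next (Y := 0) (Z := 1) (fun k => by
    simp [dd, virOp, quad])
  let step : {p : Fock × Fock // ∀ k, dd k p.2 = C (1 / 8) * virOp k p.1} →
      {p : Fock × Fock // ∀ k, dd k p.2 = C (1 / 8) * virOp k p.1} := fun p =>
    ⟨(p.1.2, (exists_next p.2).choose), (exists_next p.2).choose_spec.2⟩
  let s : ℕ → {p : Fock × Fock // ∀ k, dd k p.2 = C (1 / 8) * virOp k p.1} := fun n =>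
    n.rec ⟨(1, Z₁), h1⟩ fun _ p => step p
  refine ⟨fun n => (s n).1.1, rfl, fun n => ?_, fun n k => ?_⟩
  · rcases n with _ | n
    · exact h0
    · exact (exists_next (s n).2).choose_spec.1
  · exact (s n).2 k

end PainleveOne
end

/-! ### Homogeneity, the variation identity and the free energy. -/

noncomputable section
namespace PainleveOne
open MvPolynomial Finset

/-- The weighted Euler derivation `∑ (2k+1) xₖ ∂ₖ`. -/
def eu : Derivation ℂ Fock Fock := mkDerivation ℂ fun k => C (2 * (k : ℂ) + 1) * X k

theorem pderiv_eu (l : ℕ) (f : Fock) :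
    pderiv l (eu f) = eu (pderiv l f) + C (2 * (l : ℂ) + 1) * pderiv l f := by
  have : ⁅(pderiv l : Derivation ℂ Fock Fock), eu⁆ = (2 * (l : ℂ) + 1) • pderiv l := by
    apply derivation_ext; intro j
    rw [Derivation.commutator_apply, eu, mkDerivation_X, D_C_mul, Derivation.smul_apply]
    by_cases h : j = l
    · subst h; simp [MvPolynomial.smul_eq_C_mul]
    · rw [pderiv_X_of_ne h]; simp
  have h := congrArg (fun D => D f) this
  simp only [Derivation.commutator_apply, Derivation.smul_apply, MvPolynomial.smul_eq_C_mul] at h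
  linear_combination h

/-- If xₖ has weight 2k + 1, then every term of `virOp k` shifts the weight by 2 - 2k. -/
theorem eu_virOp (k : ℕ) (f : Fock) :
    eu (virOp k f) = virOp k (eu f) + C (2 - 2 * (k : ℂ)) * virOp k f := by
  have hv : eu (vir k f) = vir k (eu f) + C (2 - 2 * (k : ℂ)) * vir k f := by
    have : ⁅eu, vir k⁆ = (2 - 2 * (k : ℂ)) • vir k := by
      apply derivation_ext; intro j
      rw [Derivation.commutator_apply, Derivation.smul_apply]
      simp only [eu, vir, mkDerivation_X, D_C_mul, MvPolynomial.smul_eq_C_mul]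
      split_ifs with h
      · obtain ⟨i, hi⟩ := Nat.exists_eq_add_of_le h
        have hc : (j : ℂ) = k + i - 1 := by
          have : (j : ℂ) + 1 = k + i := by exact_mod_cast hi
          linear_combination this
        rw [hi, Nat.add_sub_cancel_left, D_C_mul, mkDerivation_X, hc]
        simp only [C_mul, C_add, C_sub]
        rw [C_1]
        ring
      · simp
    have h := congrArg (fun D => D f) this
    simp only [Derivation.commutator_apply, Derivation.smul_apply, MvPolynomial.smul_eq_C_mul] at h
    linear_combination h
  have hq : eu (quad k f) = quad k (eu f) + C (2 - 2 * (k : ℂ)) * quad k f := by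
    simp only [quad, map_sum, mul_sum]
    rw [← sum_add_distrib]
    refine sum_congr rfl fun i hi => ?_
    have hi := mem_range.1 hi
    rw [pderiv_eu, map_add, pderiv_eu, pderiv_C_mul]
    obtain ⟨j, hj⟩ := Nat.exists_eq_add_of_le (show i ≤ k - 2 by omega)
    have hc : (k : ℂ) = i + j + 2 := by
      have : k = i + j + 2 := by omega
      rw [this]; push_cast; ring
    rw [hj, Nat.add_sub_cancel_left, hc]
    simp only [C_mul, C_add, C_sub]
    rw [C_1, ← C_two]; ring
  have ha : eu (anom k) = C (2 - 2 * (k : ℂ)) * anom k := by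
    rcases k with _ | k
    · simp only [anom, if_true]
      rw [Derivation.leibniz_pow, eu, mkDerivation_X]
      simp [C_two]; rw [pow_two]
    · rw [anom_succ, ← C_mul, derivation_C]
      split_ifs with h
      · subst h; simp
      · simp
  simp only [virOp, map_add, D_two_mul, hv, hq]
  rw [Derivation.leibniz, ha, smul_eq_mul, smul_eq_mul]
  ring

theorem eq_C_of_pderiv_eq_zero {f : Fock} (h : ∀ k, pderiv k f = 0) : f = C (coeff 0 f) := by
  ext m
  rw [coeff_C]
  split_ifs with hm
  · rw [hm]
  · obtain ⟨i, hi⟩ : ∃ i, m i ≠ 0 := by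
      by_contra hc; push Not at hc; exact hm (Finsupp.ext fun i => (hc i).symm)
    have h1 := coeff_pderiv (i := i) f (m - Finsupp.single i 1)
    have h2 : m - Finsupp.single i 1 + Finsupp.single i 1 = m :=
      tsub_add_cancel_of_le (by simpa using Nat.one_le_iff_ne_zero.2 hi)
    rw [h i, h2, coeff_zero] at h1
    rcases mul_eq_zero.1 h1.symm with h | h
    · exact h
    · exact absurd h (by exact_mod_cast Nat.succ_ne_zero ((m - Finsupp.single i 1 : ℕ →₀ ℕ) i))

/-- Uniqueness: the recursion fixes the differences of consecutive derivatives, hence all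
derivatives since almost all of them vanish, and the constant term is prescribed. -/
theorem eq_zero_of_recursion {V : ℕ → Fock} (h0 : ∀ n, coeff 0 (V n) = 0)
    (h1 : ∀ k, dd k (V 0) = 0) (h2 : ∀ n k, dd k (V (n + 1)) = C (1 / 8) * virOp k (V n)) (n : ℕ) :
    V n = 0 := by
  induction n with
  | zero => rw [eq_C_of_pderiv_eq_zero (pderiv_eq_zero_of_dd h1), h0, C_0]
  | succ n ih =>
    have : ∀ k, dd k (V (n + 1)) = 0 := fun k => by rw [h2, ih]; simp [virOp, quad]
    rw [eq_C_of_pderiv_eq_zero (pderiv_eq_zero_of_dd this), h0, C_0]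

theorem dd_eu (k : ℕ) (f : Fock) :
    dd k (eu f) = eu (dd k f) + C (2 * (k : ℂ) + 1) * dd k f - 2 * pderiv (k + 1) f := by
  simp only [dd_apply, pderiv_eu, map_sub]
  rw [C_two]; push_cast
  simp only [C_mul, C_add]; rw [C_1, ← C_two]; ring

/-- The left side solves the same linear recursion as Z, so by uniqueness it is the product of Z
with the series of its constant terms. Since `eu` is the vector field `vir 1`, the constraint k = 1
turns the identity into the dilaton equation up to constants. -/
theorem exists_variation {Z : ℕ → Fock} (hZ0 : Z 0 = 1) (hZc : ∀ n, coeff 0 (Z (n + 1)) = 0)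
    (hZ : ∀ n k, dd k (Z (n + 1)) = C (1 / 8) * virOp k (Z n)) :
    ∃ c : ℕ → ℂ, ∀ n : ℕ, eu (Z n) - C (5 * (n : ℂ)) * Z n + C (8 / 3) * pderiv 1 (Z (n + 1))
      = ∑ p ∈ antidiagonal n, C (c p.1) * Z p.2 := by
  obtain ⟨Y, hY⟩ : ∃ Y : ℕ → Fock, Y = fun n : ℕ =>
    eu (Z n) - C (5 * (n : ℂ)) * Z n + C (8 / 3) * pderiv 1 (Z (n + 1)) := ⟨_, rfl⟩
  have hdZ0 : ∀ k, dd k (Z 0) = 0 := fun k => by rw [hZ0]; simp [dd]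
  have hdp : ∀ k n, dd k (pderiv 1 (Z (n + 1)))
      = C (1 / 8) * (virOp k (pderiv 1 (Z n)) + 6 * pderiv k (Z n)) := by
    intro k n
    have : dd k (pderiv 1 (Z (n + 1))) = pderiv 1 (dd k (Z (n + 1))) := by
      simp only [dd_apply, map_sub]; rw [pderiv_comm, pderiv_comm (k + 1)]
    rw [this, hZ, D_C_mul, pderiv_virOp 1 k (by omega), Nat.add_sub_cancel_left]
    rw [show (6 : Fock) = C 6 from (map_ofNat C 6).symm]; norm_num
  have hY1 : ∀ k, dd k (Y 0) = 0 := by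
    intro k
    rw [hY]; simp only [map_add, map_sub, D_C_mul, hdp, dd_eu, hdZ0]
    rw [hZ0]; simp [virOp]
    simp [quad]
  -- Commuting `eu` through `dd k` leaves -2∂ₖ₊₁, and the factor 8/3 supplies the 2∂ₖ that completes
  -- it to 2 `dd k`. The weights (2k + 1) + (2 - 2k) = 3 and 2 add up to 5, which is the increment
  -- of 5n.
  have hY2 : ∀ n k, dd k (Y (n + 1)) = C (1 / 8) * virOp k (Y n) := by
    intro n k
    rw [hY]; simp only [map_add, map_sub, D_C_mul, hdp, dd_eu, virOp_add, virOp_sub, virOp_C_mul, hZ,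
      eu_virOp]
    have h := hZ n k
    rw [dd_apply] at h
    rw [sub_eq_iff_eq_add] at h
    rw [h]
    have e3 : (C (8 / 3) * 6 : Fock) = C 16 := by
      rw [show (6 : Fock) = C 6 from (map_ofNat C 6).symm, ← C_mul]; norm_num
    have e4 : (C 16 * C (1 / 8) : Fock) = 2 := by rw [C_two, ← C_mul]; norm_num
    have e5 : (C 5 : Fock) = 5 := map_ofNat C 5
    push_cast
    simp only [C_mul, C_add, ← C_two, C_1, e5]
    linear_combination (C (1 / 8) * virOp k (Z n) * C (1 / 8)) * e3 +
      (C (1 / 8) * virOp k (Z n) + pderiv (k + 1) (Z (n + 1))) * e4 +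
       C (1 / 8) * pderiv (k + 1) (Z (n + 1)) * e3
  refine ⟨fun n => coeff 0 (Y n), fun n => ?_⟩
  have hV := eq_zero_of_recursion (V := fun n => Y n - ∑ p ∈ antidiagonal n, C (coeff 0 (Y p.1)) * Z p.2)
    (fun n => ?_) (fun k => ?_) (fun n k => ?_) n
  · rw [hY] at hV ⊢; exact sub_eq_zero.1 hV
  · rw [coeff_sub, sub_eq_zero]
    rcases n with _ | n
    · simp [hZ0]
    · rw [Nat.sum_antidiagonal_succ', coeff_add, coeff_C_mul, hZ0, coeff_sum]
      simp [coeff_C_mul, hZc]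
  · rw [map_sub, hY1]; simp [hdZ0]
  · rw [map_sub, hY2, virOp_sub, Nat.sum_antidiagonal_succ', map_add, map_sum, D_C_mul, hdZ0,
      mul_zero, zero_add, mul_sub]
    simp only [D_C_mul, hZ]
    congr 1
    have hs : ∀ (s : Finset (ℕ × ℕ)) (F : ℕ × ℕ → Fock),
        virOp k (∑ p ∈ s, F p) = ∑ p ∈ s, virOp k (F p) := by
      intro s F
      induction s using Finset.cons_induction with
      | empty => simp [virOp, quad]
      | cons a s ha ih => rw [sum_cons, sum_cons, virOp_add, ih]
    rw [hs, mul_sum]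
    exact sum_congr rfl fun p _ => by rw [virOp_C_mul]; ring

/-! ### The logarithm of a power series and derivations -/

/-- The coefficientwise action of a derivation on power series. -/
def liftD (D : Derivation ℂ Fock Fock) (F : PowerSeries Fock) : PowerSeries Fock :=
  PowerSeries.mk fun n => D (PowerSeries.coeff n F)

/-- The Euler operator of the formal parameter. -/
def theta (F : PowerSeries Fock) : PowerSeries Fock :=
  PowerSeries.mk fun n => C (n : ℂ) * PowerSeries.coeff n F

theorem liftD_mul (D : Derivation ℂ Fock Fock) (F G : PowerSeries Fock) :
    liftD D (F * G) = F * liftD D G + G * liftD D F := by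
  ext1 n
  rw [mul_comm G]
  simp only [liftD, PowerSeries.coeff_mk, PowerSeries.coeff_mul, map_add, map_sum,
    Derivation.leibniz, smul_eq_mul, sum_add_distrib]
  congr 1
  exact sum_congr rfl fun p _ => mul_comm _ _

theorem theta_mul (F G : PowerSeries Fock) : theta (F * G) = F * theta G + G * theta F := by
  ext1 n
  rw [mul_comm G]
  simp only [theta, PowerSeries.coeff_mk, PowerSeries.coeff_mul, map_add, mul_sum,
    ← sum_add_distrib]
  refine sum_congr rfl fun p hp => ?_
  rw [← mem_antidiagonal.1 hp]
  push_cast; rw [C_add]; ring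

theorem liftD_theta (D : Derivation ℂ Fock Fock) (F : PowerSeries Fock) :
    liftD D (theta F) = theta (liftD D F) := by
  ext1 n; simp only [theta, liftD, PowerSeries.coeff_mk, D_C_mul]

/-- The logarithm is defined by `theta` Φ = Z⁻¹ · `theta` Z, without substitution into a power
series. Every derivation D commutes with `theta`, so DZ = Z · DΦ follows by comparing the `theta`
images; order zero, which `theta` kills, is checked directly. -/
theorem exists_log {Z : ℕ → Fock} (hZ0 : Z 0 = 1) (hZc : ∀ n, coeff 0 (Z (n + 1)) = 0) :
    ∃ Φ : ℕ → Fock, Φ 0 = 0 ∧ (∀ n, constantCoeff (Φ n) = 0) ∧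
      (∀ D, liftD D (PowerSeries.mk Z) = PowerSeries.mk Z * liftD D (PowerSeries.mk Φ)) ∧
      theta (PowerSeries.mk Z) = PowerSeries.mk Z * theta (PowerSeries.mk Φ) := by
  obtain ⟨Zs, hZs⟩ : ∃ Zs, Zs = PowerSeries.mk Z := ⟨_, rfl⟩
  obtain ⟨V, hV⟩ : ∃ V, Zs * V = 1 := by
    have : IsUnit Zs := by
      rw [PowerSeries.isUnit_iff_constantCoeff, hZs, PowerSeries.constantCoeff_mk, hZ0]
      exact isUnit_one
    exact this.exists_right_inv
  have hDV : ∀ D, liftD D V = -(V * V * liftD D Zs) := by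
    intro D
    have h := liftD_mul D Zs V
    have h1 : liftD D 1 = 0 := by
      ext1 n; rw [liftD, PowerSeries.coeff_mk, PowerSeries.coeff_one]; split_ifs <;> simp
    rw [hV, h1] at h
    linear_combination (-V) * h + (-liftD D V) * hV
  have hTV : theta V = -(V * V * theta Zs) := by
    have h := theta_mul Zs V
    have h1 : theta 1 = 0 := by
      ext1 n; rw [theta, PowerSeries.coeff_mk, PowerSeries.coeff_one]; split_ifs with h <;> simp [h]
    rw [hV, h1] at h
    linear_combination (-V) * h + (-theta V) * hV
  obtain ⟨Φ, hΦ⟩ : ∃ Φ : ℕ → Fock, Φ = fun n : ℕ => C ((n : ℂ)⁻¹) * PowerSeries.coeff n (theta Zs * V) :=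
    ⟨_, rfl⟩
  have hθ0 : PowerSeries.coeff 0 (theta Zs * V) = 0 := by
    simp [theta]
  have hθ : theta (PowerSeries.mk Φ) = theta Zs * V := by
    ext1 n
    rw [theta, PowerSeries.coeff_mk, PowerSeries.coeff_mk, hΦ]
    rcases Nat.eq_zero_or_pos n with rfl | hn
    · rw [hθ0]; simp
    · dsimp only
      rw [← mul_assoc, ← C_mul, mul_inv_cancel₀ (by exact_mod_cast hn.ne'), C_1, one_mul]
  refine ⟨Φ, ?_, fun n => ?_, fun D => ?_, ?_⟩
  · rw [hΦ]; dsimp only; rw [hθ0, mul_zero]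
  · have h1 : PowerSeries.map (constantCoeff : Fock →+* ℂ) (theta Zs) = 0 := by
      ext1 m
      rw [PowerSeries.coeff_map, theta, PowerSeries.coeff_mk, hZs, PowerSeries.coeff_mk, map_mul]
      rcases m with _ | m
      · simp
      · have := hZc m
        rw [← constantCoeff_eq] at this
        rw [this]; simp
    rw [hΦ]; dsimp only
    rw [map_mul, ← PowerSeries.coeff_map, map_mul, h1]; simp
  · rw [← hZs]
    have hA : theta (liftD D Zs * V) = theta (liftD D (PowerSeries.mk Φ)) := by
      rw [← liftD_theta, hθ, theta_mul, liftD_mul, hDV, hTV, liftD_theta]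
      ring
    have hB : liftD D Zs * V = liftD D (PowerSeries.mk Φ) := by
      ext1 n
      rcases Nat.eq_zero_or_pos n with rfl | hn
      · simp [liftD, hZs, hZ0, hΦ]
      · have := congrArg (PowerSeries.coeff n) hA
        rw [theta, theta, PowerSeries.coeff_mk, PowerSeries.coeff_mk] at this
        exact mul_left_cancel₀ (by
          rw [Ne, C_eq_zero]; exact_mod_cast hn.ne') this
    rw [← hB]; linear_combination (-liftD D Zs) * hV
  · rw [← hZs, hθ]; linear_combination (-theta Zs) * hV

/-- Dividing by Z turns the second derivatives of Z into second derivatives of Φ plus products of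
first ones. The variation identity becomes additive, with a scalar right side. -/
theorem exists_freeEnergy : ∃ (Φ : ℕ → Fock) (c : ℕ → ℂ), Φ 0 = 0 ∧
    (∀ n, constantCoeff (Φ n) = 0) ∧
    (∀ n k, dd k (Φ (n + 1)) = C (1 / 8) * (2 * vir k (Φ n) + quad k (Φ n)
      + ∑ p ∈ antidiagonal n, ∑ i ∈ range (k - 1), pderiv i (Φ p.1) * pderiv (k - 2 - i) (Φ p.2)
      + if n = 0 then anom k else 0)) ∧
    ∀ n : ℕ, eu (Φ n) - C (5 * (n : ℂ)) * Φ n + C (8 / 3) * pderiv 1 (Φ (n + 1)) = C (c n) := by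
  obtain ⟨Z, hZ0, hZc, hZ⟩ := exists_partition
  obtain ⟨c, hc⟩ := exists_variation hZ0 hZc hZ
  obtain ⟨Φ, hΦ0, hΦc, hD, hθ⟩ := exists_log hZ0 hZc
  obtain ⟨Zs, hZs⟩ : ∃ Zs, Zs = PowerSeries.mk Z := ⟨_, rfl⟩
  obtain ⟨F, hF⟩ : ∃ F, F = PowerSeries.mk Φ := ⟨_, rfl⟩
  rw [← hZs, ← hF] at hθ
  simp only [← hZs, ← hF] at hD
  have hne : Zs ≠ 0 := by
    intro h
    have := congrArg (PowerSeries.coeff 0) h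
    rw [hZs, PowerSeries.coeff_mk, hZ0] at this
    simp at this
  have hcoef : ∀ n, PowerSeries.coeff n F = Φ n := fun n => by rw [hF, PowerSeries.coeff_mk]
  have hcoefZ : ∀ n, PowerSeries.coeff n Zs = Z n := fun n => by rw [hZs, PowerSeries.coeff_mk]
  refine ⟨Φ, c, hΦ0, hΦc, fun n k => ?_, fun n => ?_⟩
  · have hq : ∀ i j, liftD (pderiv i) (liftD (pderiv j) Zs)
        = Zs * (liftD (pderiv i) (liftD (pderiv j) F) + liftD (pderiv i) F * liftD (pderiv j) F) := by
      intro i j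
      rw [hD, liftD_mul, hD]; ring
    have hqs : PowerSeries.mk (fun n => quad k (Z n)) = Zs * ∑ i ∈ range (k - 1),
        (liftD (pderiv i) (liftD (pderiv (k - 2 - i)) F)
          + liftD (pderiv i) F * liftD (pderiv (k - 2 - i)) F) := by
      rw [mul_sum]; simp only [← hq]
      ext1 n
      rw [map_sum, PowerSeries.coeff_mk, quad]
      simp only [liftD, PowerSeries.coeff_mk, hcoefZ]
    have h1 : liftD (dd k) Zs = PowerSeries.X * PowerSeries.C (C (1 / 8)) * (2 * liftD (vir k) Zs
        + PowerSeries.mk (fun n => quad k (Z n)) + PowerSeries.C (anom k) * Zs) := by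
      ext1 n
      rw [mul_assoc]
      rcases n with _ | n
      · simp [liftD, hcoefZ, hZ0]
      · rw [PowerSeries.coeff_succ_X_mul, PowerSeries.coeff_C_mul]
        rw [show (2 : PowerSeries Fock) = PowerSeries.C 2 from (map_ofNat _ 2).symm]
        simp only [map_add, PowerSeries.coeff_C_mul, liftD, PowerSeries.coeff_mk, hcoefZ, hZ, virOp]
    rw [hqs, hD, hD] at h1
    have h2 : liftD (dd k) F = PowerSeries.X * PowerSeries.C (C (1 / 8)) * (2 * liftD (vir k) F
        + ∑ i ∈ range (k - 1), (liftD (pderiv i) (liftD (pderiv (k - 2 - i)) F)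
          + liftD (pderiv i) F * liftD (pderiv (k - 2 - i)) F) + PowerSeries.C (anom k)) := by
      apply mul_left_cancel₀ hne
      rw [h1]; ring
    have h3 := congrArg (PowerSeries.coeff (n + 1)) h2
    rw [mul_assoc, PowerSeries.coeff_succ_X_mul, PowerSeries.coeff_C_mul,
      two_mul] at h3
    simp only [map_add, map_sum, liftD, PowerSeries.coeff_mk, hcoef,
      PowerSeries.coeff_mul, PowerSeries.coeff_C, sum_add_distrib] at h3
    rw [h3, sum_comm (s := antidiagonal n)]
    simp only [quad, two_mul, add_assoc]
  · have h1 : PowerSeries.X * (liftD eu Zs - PowerSeries.C (C 5) * theta Zs)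
        + PowerSeries.C (C (8 / 3)) * liftD (pderiv 1) Zs
        = PowerSeries.X * (PowerSeries.mk (fun n => C (c n)) * Zs) := by
      ext1 n
      rcases n with _ | n
      · simp [liftD, hcoefZ, hZ0]
      · rw [map_add, PowerSeries.coeff_succ_X_mul, PowerSeries.coeff_succ_X_mul,
          PowerSeries.coeff_C_mul, PowerSeries.coeff_mul]
        simp only [map_sub, PowerSeries.coeff_C_mul, liftD, theta, PowerSeries.coeff_mk, hcoefZ]
        rw [← hc n, C_mul]; ring
    rw [hD, hD, hθ] at h1
    have h2 : PowerSeries.X * (liftD eu F - PowerSeries.C (C 5) * theta F)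
        + PowerSeries.C (C (8 / 3)) * liftD (pderiv 1) F
        = PowerSeries.X * PowerSeries.mk (fun n => C (c n)) := by
      apply mul_left_cancel₀ hne
      linear_combination h1
    have h3 := congrArg (PowerSeries.coeff (n + 1)) h2
    rw [map_add, PowerSeries.coeff_succ_X_mul, PowerSeries.coeff_succ_X_mul,
          PowerSeries.coeff_C_mul] at h3
    simp only [map_sub, PowerSeries.coeff_C_mul, liftD, theta, PowerSeries.coeff_mk, hcoef] at h3
    rw [← h3, C_mul]; ring
end PainleveOne
end

/-! ### The loop equation as generating series of the constraints. -/

noncomputable section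
namespace PainleveOne
open MvPolynomial Finset

/-- The derivation `∑ₖ z⁻²ᵏ⁻² ∂ₖ` (insertion of the point `z`). -/
def dz (z : ℂ) : Derivation ℂ Fock Fock := mkDerivation ℂ fun k => C (z⁻¹ ^ (2 * k + 2))

/-- The derivation `∑ₖ z⁻²ᵏ vir k`. -/
def ez (z : ℂ) : Derivation ℂ Fock Fock := mkDerivation ℂ fun j =>
  ∑ k ∈ range (j + 2), C (z⁻¹ ^ (2 * k)) * vir k (X j)

theorem dz_eq_sum (z : ℂ) (f : Fock) (B : ℕ) (hB : ∀ k, B ≤ k → pderiv k f = 0) :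
    dz z f = ∑ i ∈ range B, C (z⁻¹ ^ (2 * i + 2)) * pderiv i f := by
  rw [D_eq_sum _ f B hB]
  exact sum_congr rfl fun i _ => by rw [dz, mkDerivation_X]

theorem ez_eq_sum (z : ℂ) (f : Fock) (B B' : ℕ) (hB : ∀ k, B ≤ k → pderiv k f = 0)
    (hB' : B + 1 ≤ B') : ez z f = ∑ k ∈ range B', C (z⁻¹ ^ (2 * k)) * vir k f := by
  rw [D_eq_sum _ f B hB]
  simp only [fun k => D_eq_sum (vir k) f B hB, mul_sum]
  rw [sum_comm]
  refine sum_congr rfl fun i hi => ?_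
  have hi := mem_range.1 hi
  rw [ez, mkDerivation_X, sum_mul]
  rw [sum_subset (range_subset_range.2 (show i + 2 ≤ B' by omega))]
  · exact sum_congr rfl fun k _ => mul_assoc _ _ _
  · intro k _ hk
    rw [vir, mkDerivation_X, if_neg (by simp at hk; omega)]; simp

/-- This is a Cauchy product: i + j = k - 2 means z⁻²ᵏ = z⁻²ⁱ⁻² z⁻²ʲ⁻². -/
theorem sum_diagonals (z : ℂ) (g : ℕ → ℕ → Fock) (B B' : ℕ)
    (hg : ∀ i j, B ≤ i ∨ B ≤ j → g i j = 0) (hB' : 2 * B ≤ B') :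
    ∑ k ∈ range (B' + 2), C (z⁻¹ ^ (2 * k)) * ∑ i ∈ range (k - 1), g i (k - 2 - i)
      = ∑ i ∈ range B, ∑ j ∈ range B, C (z⁻¹ ^ (2 * i + 2)) * (C (z⁻¹ ^ (2 * j + 2)) * g i j) := by
  rw [sum_range_succ', sum_range_succ']
  simp only [Nat.zero_sub, range_zero, sum_empty, mul_zero, add_zero, zero_add, Nat.sub_self]
  rw [← sum_product', ← sum_fiberwise_of_maps_to (t := range B') (g := fun p : ℕ × ℕ => p.1 + p.2)]
  · refine sum_congr rfl fun m _ => ?_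
    rw [show m + 1 + 1 - 1 = m + 1 by omega, show m + 1 + 1 - 2 = m by omega, mul_sum,
      ← Nat.sum_antidiagonal_eq_sum_range_succ (fun i j => C (z⁻¹ ^ (2 * (m + 1 + 1))) * g i j) m]
    symm
    have hsub : (range B ×ˢ range B).filter (fun p => p.1 + p.2 = m) ⊆ antidiagonal m := by
      intro p hp; simpa using (mem_filter.1 hp).2
    rw [sum_subset hsub]
    · refine sum_congr rfl fun p hp => ?_
      rw [← mem_antidiagonal.1 hp, ← mul_assoc, ← C_mul, ← pow_add]
      congr 3; ring
    · intro p hp hp'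
      rw [hg, mul_zero, mul_zero]
      by_contra hc
      push Not at hc
      exact hp' (mem_filter.2 ⟨by simpa using hc, mem_antidiagonal.1 hp⟩)
  · intro p hp
    have := mem_product.1 hp
    simp only [mem_range] at this ⊢
    omega

theorem pderiv_dz (k : ℕ) (z : ℂ) (f : Fock) : pderiv k (dz z f) = dz z (pderiv k f) := by
  have : ⁅(pderiv k : Derivation ℂ Fock Fock), dz z⁆ = 0 := by
    apply derivation_ext; intro j
    rw [Derivation.commutator_apply, pderiv_X, dz, mkDerivation_X]
    simp [Pi.single_apply, apply_ite]
  have h := congrArg (fun D => D f) this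
  simp only [Derivation.commutator_apply, Derivation.coe_zero, Pi.zero_apply] at h
  exact sub_eq_zero.1 h

/-- Multiply the k-th constraint by z⁻²ᵏ and sum over k. The index shift in `dd k` produces the
factor z⁴ - z² and, since the shifted sum starts at ∂₁, the boundary term with ∂₀. All sums are
finite beyond a common bound B for the derivatives involved. -/
theorem loop_equation {Φ : ℕ → Fock}
    (hΦ : ∀ n k, dd k (Φ (n + 1)) = C (1 / 8) * (2 * vir k (Φ n) + quad k (Φ n)
      + ∑ p ∈ antidiagonal n, ∑ i ∈ range (k - 1), pderiv i (Φ p.1) * pderiv (k - 2 - i) (Φ p.2)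
      + if n = 0 then anom k else 0)) (n : ℕ) {z : ℂ} (hz : z ≠ 0) :
    8 * (C (z ^ 4 - z ^ 2) * dz z (Φ (n + 1)) - C (z ^ 2) * pderiv 0 (Φ (n + 1)))
      + 2 * ez z (Φ n) + dz z (dz z (Φ n)) + ∑ p ∈ antidiagonal n, dz z (Φ p.1) * dz z (Φ p.2)
      + (if n = 0 then X 0 ^ 2 + C (z⁻¹ ^ 2 / 4) else 0) = 0 := by
  obtain ⟨b, hb⟩ := Classical.axiom_of_choice fun m => exists_pderiv_eq_zero (Φ m)
  obtain ⟨B, hB⟩ : ∃ B, ∀ m ≤ n + 1, ∀ k, B ≤ k → pderiv k (Φ m) = 0 := by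
    refine ⟨(range (n + 2)).sup b, fun m hm k hk => hb m k (le_trans ?_ hk)⟩
    exact le_sup (f := b) (mem_range.2 (by omega))
  have hmain : ∑ k ∈ range (2 * B + 2), C (z⁻¹ ^ (2 * k)) * (8 * dd k (Φ (n + 1)))
      = ∑ k ∈ range (2 * B + 2), C (z⁻¹ ^ (2 * k)) * (2 * vir k (Φ n) + quad k (Φ n)
      + ∑ p ∈ antidiagonal n, ∑ i ∈ range (k - 1), pderiv i (Φ p.1) * pderiv (k - 2 - i) (Φ p.2)
      + if n = 0 then anom k else 0) := by
    refine sum_congr rfl fun k _ => ?_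
    rw [hΦ, ← mul_assoc 8, show (8 : Fock) = C 8 from (map_ofNat C 8).symm, ← C_mul]
    norm_num
  have h1 : ∑ k ∈ range (2 * B + 2), C (z⁻¹ ^ (2 * k)) * pderiv k (Φ (n + 1))
      = C (z ^ 2) * dz z (Φ (n + 1)) := by
    rw [dz_eq_sum z _ (2 * B + 2) (fun k hk => hB _ le_rfl k (by omega)), mul_sum]
    refine sum_congr rfl fun k _ => ?_
    rw [← mul_assoc, ← C_mul]
    congr 2; rw [pow_add]; field_simp
  have h2 : ∑ k ∈ range (2 * B + 2), C (z⁻¹ ^ (2 * k)) * pderiv (k + 1) (Φ (n + 1))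
      = C (z ^ 4) * dz z (Φ (n + 1)) - C (z ^ 2) * pderiv 0 (Φ (n + 1)) := by
    rw [dz_eq_sum z _ (2 * B + 2 + 1) (fun k hk => hB _ le_rfl k (by omega)), sum_range_succ' _ (2 * B + 2),
      mul_add, mul_sum]
    have : C (z ^ 4) * (C (z⁻¹ ^ (2 * 0 + 2)) * pderiv 0 (Φ (n + 1)))
        = C (z ^ 2) * pderiv 0 (Φ (n + 1)) := by
      rw [← mul_assoc, ← C_mul]
      congr 2; rw [mul_zero, zero_add]; field_simp
    rw [this, add_sub_cancel_right]
    refine sum_congr rfl fun k _ => ?_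
    rw [← mul_assoc, ← C_mul]
    congr 2
    rw [show 2 * (k + 1) + 2 = 2 * k + 4 by ring, pow_add]; field_simp
  have h3 := ez_eq_sum z (Φ n) B (2 * B + 2) (hB n (by omega)) (by omega)
  have h4 : ∑ k ∈ range (2 * B + 2), C (z⁻¹ ^ (2 * k)) * quad k (Φ n) = dz z (dz z (Φ n)) := by
    have hB1 : ∀ k, B ≤ k → pderiv k (dz z (Φ n)) = 0 := fun k hk => by
      rw [pderiv_dz, hB n (by omega) k hk, map_zero]
    simp only [quad]
    rw [sum_diagonals z (fun i j => pderiv i (pderiv j (Φ n))) B (2 * B) _ le_rfl,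
      dz_eq_sum z _ B hB1]
    · refine sum_congr rfl fun i _ => ?_
      rw [dz_eq_sum z _ B (hB n (by omega)), map_sum, mul_sum]
      exact sum_congr rfl fun j _ => by rw [pderiv_C_mul]
    · rintro i j (h | h)
      · rw [pderiv_comm, hB n (by omega) i h, map_zero]
      · rw [hB n (by omega) j h, map_zero]
  have h5 : ∑ k ∈ range (2 * B + 2), C (z⁻¹ ^ (2 * k)) *
      ∑ p ∈ antidiagonal n, ∑ i ∈ range (k - 1), pderiv i (Φ p.1) * pderiv (k - 2 - i) (Φ p.2)
      = ∑ p ∈ antidiagonal n, dz z (Φ p.1) * dz z (Φ p.2) := by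
    simp only [mul_sum (antidiagonal n)]
    rw [sum_comm]
    refine sum_congr rfl fun p hp => ?_
    have hp := mem_antidiagonal.1 hp
    rw [sum_diagonals z (fun i j => pderiv i (Φ p.1) * pderiv j (Φ p.2)) B (2 * B) _ le_rfl,
      dz_eq_sum z _ B (hB p.1 (by omega)), dz_eq_sum z _ B (hB p.2 (by omega)), sum_mul_sum]
    · exact sum_congr rfl fun i _ => sum_congr rfl fun j _ => by ring
    · rintro i j (h | h)
      · rw [hB p.1 (by omega) i h, zero_mul]
      · rw [hB p.2 (by omega) j h, mul_zero]
  have h6 : ∑ k ∈ range (2 * B + 2), C (z⁻¹ ^ (2 * k)) * (if n = 0 then anom k else 0)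
      = if n = 0 then X 0 ^ 2 + C (z⁻¹ ^ 2 / 4) else 0 := by
    split_ifs
    · rw [sum_range_succ', sum_range_succ']
      simp only [anom_succ]
      rw [sum_eq_zero (fun k _ => by simp), ← C_mul]
      simp only [anom]
      simp only [zero_add, mul_one, if_true, mul_zero, pow_zero, C_1, one_mul]
      rw [add_comm]; congr 2; ring
    · simp
  simp only [mul_add, sum_add_distrib, h4, h5, h6] at hmain
  have h7 : ∑ k ∈ range (2 * B + 2), C (z⁻¹ ^ (2 * k)) * (2 * vir k (Φ n)) = 2 * ez z (Φ n) := by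
    rw [h3, mul_sum]; exact sum_congr rfl fun k _ => by ring
  have h8 : ∑ k ∈ range (2 * B + 2), C (z⁻¹ ^ (2 * k)) * (8 * dd k (Φ (n + 1)))
      = 8 * (C (z ^ 2) * dz z (Φ (n + 1))
        - (C (z ^ 4) * dz z (Φ (n + 1)) - C (z ^ 2) * pderiv 0 (Φ (n + 1)))) := by
    rw [← h1, ← h2, ← sum_sub_distrib, mul_sum]
    exact sum_congr rfl fun k _ => by rw [dd_apply]; ring
  rw [h7, h8] at hmain
  rw [C_sub]
  linear_combination -hmain
end PainleveOne
end

/-! ### Taylor coefficients at the origin and their vanishing pattern. -/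

noncomputable section
namespace PainleveOne
open MvPolynomial Finset

/-- The derivation with constant coefficients `∑ₖ cₖ ∂ₖ`. -/
def cd (c : ℕ → ℂ) : Derivation ℂ Fock Fock := mkDerivation ℂ fun k => C (c k)

theorem cd_X (c : ℕ → ℂ) (k : ℕ) : cd c (X k) = C (c k) := mkDerivation_X _ _ _

theorem pderiv_eq_cd (k : ℕ) : (pderiv k : Derivation ℂ Fock Fock) = cd (Pi.single k 1) := by
  apply derivation_ext; intro i
  rw [cd_X, pderiv_X, Pi.single_apply, Pi.single_apply]; split_ifs <;> simp

theorem cd_comm (c d : ℕ → ℂ) (f : Fock) : cd c (cd d f) = cd d (cd c f) := by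
  have : ⁅cd c, cd d⁆ = 0 := by
    apply derivation_ext; intro j
    rw [Derivation.commutator_apply, cd_X, cd_X]; simp
  have h := congrArg (fun D => D f) this
  simp only [Derivation.commutator_apply, Derivation.coe_zero, Pi.zero_apply] at h
  exact sub_eq_zero.1 h

instance : LeftCommutative fun (c : ℕ → ℂ) (f : Fock) => cd c f := ⟨cd_comm⟩

/-- The composition of the derivations `cd c` over a multiset of `c`s. -/
def dJ (J : Multiset (ℕ → ℂ)) (f : Fock) : Fock := J.foldr (fun c g => cd c g) f

@[simp] theorem dJ_zero (f : Fock) : dJ 0 f = f := rfl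

theorem dJ_cons (c : ℕ → ℂ) (J : Multiset (ℕ → ℂ)) (f : Fock) : dJ (c ::ₘ J) f = cd c (dJ J f) :=
  Multiset.foldr_cons _ _ _ _

theorem dJ_cd (c : ℕ → ℂ) (J : Multiset (ℕ → ℂ)) (f : Fock) : dJ J (cd c f) = cd c (dJ J f) := by
  induction J using Multiset.induction_on with
  | empty => rfl
  | cons d J ih => rw [dJ_cons, dJ_cons, ih, cd_comm]

theorem dJ_cons' (c : ℕ → ℂ) (J : Multiset (ℕ → ℂ)) (f : Fock) : dJ (c ::ₘ J) f = dJ J (cd c f) := by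
  rw [dJ_cons, dJ_cd]

theorem dJ_add (J : Multiset (ℕ → ℂ)) (f g : Fock) : dJ J (f + g) = dJ J f + dJ J g := by
  induction J using Multiset.induction_on with
  | empty => rfl
  | cons d J ih => rw [dJ_cons, dJ_cons, dJ_cons, ih, map_add]

theorem dJ_C_mul (J : Multiset (ℕ → ℂ)) (a : ℂ) (f : Fock) : dJ J (C a * f) = C a * dJ J f := by
  induction J using Multiset.induction_on with
  | empty => rfl
  | cons d J ih => rw [dJ_cons, dJ_cons, ih, D_C_mul]

/-- `dJ J` followed by evaluation at the origin. -/
def dev (J : Multiset (ℕ → ℂ)) : Fock →ₗ[ℂ] ℂ where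
  toFun f := constantCoeff (dJ J f)
  map_add' f g := by rw [dJ_add, map_add]
  map_smul' a f := by rw [MvPolynomial.smul_eq_C_mul, dJ_C_mul]; simp

theorem dev_apply (J : Multiset (ℕ → ℂ)) (f : Fock) : dev J f = constantCoeff (dJ J f) := rfl

theorem dev_C_mul (J : Multiset (ℕ → ℂ)) (a : ℂ) (f : Fock) : dev J (C a * f) = a * dev J f := by
  rw [← MvPolynomial.smul_eq_C_mul, map_smul, smul_eq_mul]

theorem dev_cons (c : ℕ → ℂ) (J : Multiset (ℕ → ℂ)) (f : Fock) :
    dev (c ::ₘ J) f = dev J (cd c f) := by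
  rw [dev_apply, dJ_cons', dev_apply]

theorem dev_C {J : Multiset (ℕ → ℂ)} (a : ℂ) (hJ : J ≠ 0) : dev J (C a) = 0 := by
  induction J using Multiset.induction_on with
  | empty => exact absurd rfl hJ
  | cons c J ih => rw [dev_cons, cd, derivation_C, map_zero]

theorem insert_val_map {ι α : Type*} [DecidableEq ι] (v : ι → α) {i : ι} {s : Finset ι} (hi : i ∉ s) :
    (insert i s).val.map v = v i ::ₘ s.val.map v := by
  rw [insert_val_of_notMem hi, Multiset.map_cons]

/-- The iterated Leibniz rule; its sum over subsets is the source of the splittings I ⊔ J in the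
topological recursion. -/
theorem dJ_mul {ι : Type*} [DecidableEq ι] (v : ι → ℕ → ℂ) (s : Finset ι) (f g : Fock) :
    dJ (s.val.map v) (f * g)
      = ∑ I ∈ s.powerset, dJ (I.val.map v) f * dJ ((s \ I).val.map v) g := by
  induction s using Finset.induction_on generalizing f g with
  | empty => simp
  | insert i s hi ih =>
    rw [insert_val_map v hi, dJ_cons', Derivation.leibniz, smul_eq_mul, smul_eq_mul, dJ_add, ih,
      mul_comm g, ih, sum_powerset_insert hi]
    congr 1 <;> refine sum_congr rfl fun I hI => ?_
    · have hI := mem_powerset.1 hI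
      rw [insert_sdiff_of_notMem _ (fun h => hi (hI h)), insert_val_map v (by simp [hi]), dJ_cons']
    · have hI := mem_powerset.1 hI
      rw [insert_val_map v (fun h => hi (hI h)), dJ_cons',
        insert_sdiff_insert, sdiff_insert_of_notMem hi]

theorem dev_mul {ι : Type*} [DecidableEq ι] (v : ι → ℕ → ℂ) (s : Finset ι) (f g : Fock) :
    dev (s.val.map v) (f * g)
      = ∑ I ∈ s.powerset, dev (I.val.map v) f * dev ((s \ I).val.map v) g := by
  rw [dev_apply, dJ_mul, map_sum]
  simp only [map_mul, dev_apply]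

/-- A derivation that is given by a linear vector field, seen from the derivations `cd c`. -/
theorem cd_linear_comm {E : Derivation ℂ Fock Fock} {c L : ℕ → ℂ}
    (hE : ∀ j, cd c (E (X j)) = C (L j)) (f : Fock) :
    cd c (E f) = E (cd c f) + cd L f := by
  have : ⁅cd c, E⁆ = cd L := by
    apply derivation_ext; intro j
    rw [Derivation.commutator_apply, cd_X, cd_X, hE, derivation_C, sub_zero]
  have h := congrArg (fun D => D f) this
  simp only [Derivation.commutator_apply] at h
  linear_combination h

theorem constantCoeff_derivation {E : Derivation ℂ Fock Fock}
    (hE : ∀ j, constantCoeff (E (X j)) = 0) (f : Fock) : constantCoeff (E f) = 0 := by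
  induction f using MvPolynomial.induction_on with
  | C a => simp
  | add p q hp hq => rw [map_add, map_add, hp, hq, add_zero]
  | mul_X p i hp => rw [Derivation.leibniz]; simp [hp, hE]

/-- The coefficients of E are linear and vanish at the origin, so exactly one of the derivatives has
to fall on them. -/
theorem dev_linear {ι : Type*} [DecidableEq ι] {E : Derivation ℂ Fock Fock}
    (hE : ∀ j, constantCoeff (E (X j)) = 0) (v L : ι → ℕ → ℂ) (s : Finset ι)
    (hL : ∀ i ∈ s, ∀ j, cd (v i) (E (X j)) = C (L i j)) (f : Fock) :
    dev (s.val.map v) (E f) = ∑ i ∈ s, dev ((s.erase i).val.map v) (cd (L i) f) := by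
  induction s using Finset.induction_on generalizing f with
  | empty => simpa [dev_apply] using constantCoeff_derivation hE f
  | insert i s hi ih =>
    rw [insert_val_map v hi, dev_cons, cd_linear_comm (hL i (mem_insert_self _ _)), map_add,
      ih (fun j hj => hL j (mem_insert_of_mem hj)), sum_insert hi, erase_insert hi, add_comm]
    congr 1
    refine sum_congr rfl fun j hj => ?_
    rw [erase_insert_of_ne (by rintro rfl; exact hi hj), insert_val_map v (by simp [hi]), dev_cons,
      cd_comm]

theorem exists_fin_rep {α : Type*} (J : Multiset α) :
    ∃ (m : ℕ) (v : Fin m → α), J = (univ : Finset (Fin m)).val.map v := by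
  refine ⟨J.toList.length, J.toList.get, ?_⟩
  rw [Fin.univ_val_map, List.ofFn_get, Multiset.coe_toList]

theorem dev_X_sq (J : Multiset (ℕ → ℂ)) (hJ : J.card ≠ 2) : dev J (X 0 ^ 2) = 0 := by
  induction J using Multiset.induction_on with
  | empty => simp [dev_apply]
  | cons c J _ =>
    rw [dev_cons, pow_two, Derivation.leibniz, cd_X, smul_eq_mul, ← two_mul, mul_comm (X 0), C_two,
      ← mul_assoc, ← C_mul, dev_C_mul]
    induction J using Multiset.induction_on with
    | empty => simp [dev_apply]
    | cons d J _ =>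
      rw [dev_cons, cd_X, dev_C, mul_zero]
      rintro rfl; simp at hJ

theorem cd_eq_sum (c : ℕ → ℂ) (f : Fock) (B : ℕ) (hB : ∀ k, B ≤ k → pderiv k f = 0) :
    cd c f = ∑ i ∈ range B, C (c i) * pderiv i f := by
  rw [D_eq_sum _ f B hB]
  exact sum_congr rfl fun i _ => by rw [cd_X]

/-- The relation n + 2 = 2g + |J| is respected by every term of the recursion: `vir` keeps g, `quad`
lowers it by one, a product splits it as g₁ + g₂, and the anomalies account for (g, |J|) = (0, 2)
and (1, 0) at n = 0. Outside this pattern the derivatives with different k agree, and those with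
large k vanish. -/
theorem dev_eq_zero {Φ : ℕ → Fock} (hΦ0 : Φ 0 = 0) (hΦc : ∀ n, constantCoeff (Φ n) = 0)
    (hΦ : ∀ n k, dd k (Φ (n + 1)) = C (1 / 8) * (2 * vir k (Φ n) + quad k (Φ n)
      + ∑ p ∈ antidiagonal n, ∑ i ∈ range (k - 1), pderiv i (Φ p.1) * pderiv (k - 2 - i) (Φ p.2)
      + if n = 0 then anom k else 0)) (n : ℕ) (J : Multiset (ℕ → ℂ))
    (hJ : ¬ ∃ g, n + 2 = 2 * g + J.card) : dev J (Φ n) = 0 := by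
  induction n using Nat.strong_induction_on generalizing J with
  | _ n ih =>
  rcases n with _ | n
  · rw [hΦ0, map_zero]
  induction J using Multiset.induction_on with
  | empty => exact hΦc _
  | cons c J _ =>
  rw [Multiset.card_cons] at hJ
  obtain ⟨B, hB⟩ := exists_pderiv_eq_zero (Φ (n + 1))
  suffices h : ∀ k, dev J (pderiv k (Φ (n + 1))) = 0 by
    rw [dev_cons, cd_eq_sum c _ B hB, map_sum]
    exact sum_eq_zero fun k _ => by rw [dev_C_mul, h, mul_zero]
  have hconst : ∀ k, dev J (pderiv k (Φ (n + 1))) = dev J (pderiv (k + 1) (Φ (n + 1))) := by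
    intro k
    rw [← sub_eq_zero, ← map_sub, ← dd_apply, hΦ, dev_C_mul]
    simp only [map_add, map_sum]
    obtain ⟨m, v, rfl⟩ := exists_fin_rep J
    simp only [Multiset.card_map, card_val, card_univ, Fintype.card_fin] at hJ
    have h1 : dev (univ.val.map v) (2 * vir k (Φ n)) = 0 := by
      rw [C_two, dev_C_mul, dev_linear (E := vir k) (v := v) (L := fun i j =>
        if k ≤ j + 1 then (2 * ((j + 1 - k : ℕ) : ℂ) + 1) * v i (j + 1 - k) else 0)]
      · rw [sum_eq_zero, mul_zero]
        intro i _
        rw [← dev_cons]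
        apply ih n (by omega)
        rintro ⟨g, hg⟩
        simp only [Multiset.card_cons, Multiset.card_map, card_val, card_erase_of_mem (mem_univ i),
          card_univ, Fintype.card_fin] at hg
        have := i.pos
        exact hJ ⟨g, by omega⟩
      · intro j
        rw [vir, mkDerivation_X]; split_ifs <;> simp
      · intro i _ j
        rw [vir, mkDerivation_X]
        split_ifs
        · rw [D_C_mul, cd_X, C_mul]
        · simp
    have h2 : dev (univ.val.map v) (quad k (Φ n)) = 0 := by
      rw [quad, map_sum]
      refine sum_eq_zero fun i _ => ?_
      rw [pderiv_eq_cd, pderiv_eq_cd, ← dev_cons, ← dev_cons]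
      apply ih n (by omega)
      rintro ⟨g, hg⟩
      simp only [Multiset.card_cons, Multiset.card_map, card_val, card_univ, Fintype.card_fin] at hg
      exact hJ ⟨g + 1, by omega⟩
    have h3 : ∑ p ∈ antidiagonal n, ∑ i ∈ range (k - 1),
        dev (univ.val.map v) (pderiv i (Φ p.1) * pderiv (k - 2 - i) (Φ p.2)) = 0 := by
      refine sum_eq_zero fun p hp => sum_eq_zero fun i _ => ?_
      have hp := mem_antidiagonal.1 hp
      rw [dev_mul]
      refine sum_eq_zero fun I _ => ?_
      rw [pderiv_eq_cd, pderiv_eq_cd, ← dev_cons, ← dev_cons]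
      by_contra hne
      have h1 := mt (ih p.1 (by omega) (Pi.single i 1 ::ₘ I.val.map v)) (left_ne_zero_of_mul hne)
      have h2 := mt (ih p.2 (by omega) (Pi.single (k - 2 - i) 1 ::ₘ (univ \ I).val.map v))
        (right_ne_zero_of_mul hne)
      rw [not_not] at h1 h2
      obtain ⟨g₁, h1⟩ := h1
      obtain ⟨g₂, h2⟩ := h2
      simp only [Multiset.card_cons, Multiset.card_map, card_val] at h1 h2
      have := card_sdiff_add_card_eq_card (subset_univ I)
      rw [card_univ, Fintype.card_fin] at this
      exact hJ ⟨g₁ + g₂, by omega⟩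
    have h4 : dev (univ.val.map v) (if n = 0 then anom k else 0) = 0 := by
      split_ifs with hn
      · subst hn
        unfold anom
        split_ifs with hk1 hk2
        · apply dev_X_sq
          simp only [Multiset.card_map, card_val, card_univ, Fintype.card_fin]
          rintro rfl; exact hJ ⟨0, by omega⟩
        · apply dev_C
          rw [Ne, ← Multiset.card_eq_zero]
          simp only [Multiset.card_map, card_val, card_univ, Fintype.card_fin]
          rintro rfl; exact hJ ⟨1, by omega⟩
        · exact map_zero _
      · exact map_zero _
    rw [h1, h2, h3, h4]; simp
  intro k
  have : ∀ m, dev J (pderiv k (Φ (n + 1))) = dev J (pderiv (k + m) (Φ (n + 1))) := by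
    intro m; induction m with
    | zero => rfl
    | succ m ihm => rw [ihm, hconst]; rfl
  rw [this B, hB _ (by omega), map_zero]
end PainleveOne
end

/-! ### Residues by small circles, and the recursion kernel. -/

noncomputable section
namespace PainleveOne
open Finset Filter
open scoped Topology Interval

/-- The function `f` has residue `c` at the origin, in the sense of small circle integrals. -/
def HasRes (f : ℂ → ℂ) (c : ℂ) : Prop :=
  ∀ᶠ r in 𝓝[>] (0 : ℝ), CircleIntegrable f 0 r ∧ (∮ z in C(0, r), f z) = 2 * Real.pi * Complex.I * c

theorem HasRes.residueZero_eq {f : ℂ → ℂ} {c : ℂ} (h : HasRes f c) : residueZero f = c := by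
  apply Filter.Tendsto.limUnder_eq
  refine tendsto_const_nhds.congr' ?_
  filter_upwards [h] with r hr
  rw [hr.2, ← mul_assoc, inv_mul_cancel₀, one_mul]
  simp [Real.pi_ne_zero, Complex.I_ne_zero]

theorem HasRes.add {f g : ℂ → ℂ} {c d : ℂ} (hf : HasRes f c) (hg : HasRes g d) :
    HasRes (fun z => f z + g z) (c + d) := by
  filter_upwards [hf, hg] with r h1 h2
  exact ⟨h1.1.add h2.1, by rw [circleIntegral.integral_add h1.1 h2.1, h1.2, h2.2]; ring⟩

theorem HasRes.const_mul {f : ℂ → ℂ} {c : ℂ} (a : ℂ) (hf : HasRes f c) :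
    HasRes (fun z => a * f z) (a * c) := by
  filter_upwards [hf] with r h1
  refine ⟨?_, by rw [circleIntegral.integral_const_mul, h1.2]; ring⟩
  exact h1.1.const_smul (a := a)

theorem HasRes.zero : HasRes (fun _ => 0) 0 := by
  refine Eventually.of_forall fun r => ⟨circleIntegrable_const _ _ _, by simp [circleIntegral]⟩

theorem HasRes.sum {ι : Type*} (s : Finset ι) {f : ι → ℂ → ℂ} {c : ι → ℂ}
    (h : ∀ i ∈ s, HasRes (f i) (c i)) : HasRes (fun z => ∑ i ∈ s, f i z) (∑ i ∈ s, c i) := by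
  classical
  induction s using Finset.induction_on with
  | empty => simpa using HasRes.zero
  | insert i s hi ih =>
    simp only [sum_insert hi]
    exact (h i (mem_insert_self _ _)).add (ih fun j hj => h j (mem_insert_of_mem hj))

theorem HasRes.congr {f g : ℂ → ℂ} {c : ℂ} (hf : HasRes f c) (hfg : ∀ᶠ z in 𝓝[≠] (0 : ℂ), f z = g z) :
    HasRes g c := by
  rw [eventually_nhdsWithin_iff, Metric.eventually_nhds_iff] at hfg
  obtain ⟨ε, hε, H⟩ := hfg
  have hr : ∀ᶠ r in 𝓝[>] (0 : ℝ), r ∈ Set.Ioo 0 ε := Ioo_mem_nhdsGT hε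
  filter_upwards [hf, hr] with r h1 hr
  have hs : Set.EqOn f g (Metric.sphere 0 |r|) := by
    intro z hz
    rw [abs_of_pos hr.1, mem_sphere_zero_iff_norm] at hz
    apply H
    · rw [dist_zero_right, hz]; exact hr.2
    · rintro rfl; simp at hz; exact hr.1.ne hz
  refine ⟨?_, ?_⟩
  · exact IntervalIntegrable.congr (fun θ _ => hs (circleMap_mem_sphere' 0 r θ)) h1.1
  · rw [← h1.2]
    refine circleIntegral.integral_congr hr.1.le fun z hz => (hs ?_).symm
    rwa [abs_of_pos hr.1]

theorem HasRes.div_id {f : ℂ → ℂ} (hf : AnalyticAt ℂ f 0) : HasRes (fun z => f z / z) (f 0) := by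
  obtain ⟨R, hR, hd⟩ := Metric.eventually_nhds_iff.1 hf.eventually_analyticAt
  have hr : ∀ᶠ r in 𝓝[>] (0 : ℝ), r ∈ Set.Ioo 0 R := Ioo_mem_nhdsGT hR
  filter_upwards [hr] with r hr
  have hdiff : ∀ z ∈ Metric.closedBall (0 : ℂ) r, DifferentiableAt ℂ f z := fun z hz =>
    (hd (lt_of_le_of_lt hz hr.2)).differentiableAt
  constructor
  · apply ContinuousOn.circleIntegrable hr.1.le
    intro z hz
    have hz0 : z ≠ 0 := by
      rintro rfl; simp at hz; exact hr.1.ne hz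
    exact ((hdiff z (Metric.sphere_subset_closedBall hz)).continuousAt.div continuousAt_id
      hz0).continuousWithinAt
  · have h := DiffContOnCl.circleIntegral_sub_inv_smul (R := r) (c := (0 : ℂ)) (w := 0) (f := f) (by
      apply DifferentiableOn.diffContOnCl
      intro z hz
      rw [closure_ball _ hr.1.ne'] at hz
      exact (hdiff z hz).differentiableWithinAt) (Metric.mem_ball_self hr.1)
    simp only [smul_eq_mul, sub_zero] at h
    rw [← h]
    have e : (fun z => f z / z) = fun z => z⁻¹ * f z := funext fun z => by rw [div_eq_inv_mul]
    rw [e]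

theorem HasRes.inv_pow (n : ℕ) : HasRes (fun z => (z⁻¹) ^ n) (if n = 1 then 1 else 0) := by
  split_ifs with h
  · subst h
    simpa using HasRes.div_id (f := fun _ => 1) analyticAt_const
  · filter_upwards [self_mem_nhdsWithin] with r hr
    have hr : 0 < r := hr
    constructor
    · apply ContinuousOn.circleIntegrable hr.le
      intro z hz
      have hz0 : z ≠ 0 := by
        rintro rfl; simp at hz; exact hr.ne hz
      exact ((continuousAt_id.inv₀ hz0).pow n).continuousWithinAt
    · have := circleIntegral.integral_sub_zpow_of_ne (n := -(n : ℤ)) (by omega) (0 : ℂ) 0 r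
      simp only [sub_zero, zpow_neg, zpow_natCast] at this
      simp only [_root_.inv_pow, mul_zero, this]

/-- With u = lz, induction on u⁻²ᵏ⁻³/(z₁² - u²) = z₁⁻² (u⁻²ᵏ⁻³ + u⁻²ᵏ⁻¹/(z₁² - u²)): the pure power
has no residue, and k = 0 is a simple pole. -/
theorem HasRes.inv_pow_div {l z₁ : ℂ} (hl : l ≠ 0) (hz₁ : z₁ ≠ 0) (k : ℕ) :
    HasRes (fun z => (l * z)⁻¹ ^ (2 * k + 1) / (z₁ ^ 2 - (l * z) ^ 2)) (z₁⁻¹ ^ (2 * k + 2) / l) := by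
  have hne : ∀ᶠ z in 𝓝 (0 : ℂ), z₁ ^ 2 - (l * z) ^ 2 ≠ 0 := by
    have : ContinuousAt (fun z : ℂ => z₁ ^ 2 - (l * z) ^ 2) 0 := by fun_prop
    exact this.eventually_ne (by simpa using hz₁)
  induction k with
  | zero =>
    have h := HasRes.div_id (f := fun z => l⁻¹ / (z₁ ^ 2 - (l * z) ^ 2))
      (by
        apply AnalyticAt.div analyticAt_const (by fun_prop)
        simpa using hz₁)
    convert h using 1
    · funext z; simp only [mul_zero, zero_add, pow_one, mul_inv]; ring
    · simp; ring
  | succ k ih =>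
    have h := (((HasRes.inv_pow (2 * k + 3)).const_mul (l⁻¹ ^ (2 * k + 3))).add ih).const_mul (z₁⁻¹ ^ 2)
    rw [show z₁⁻¹ ^ 2 * ((l⁻¹ ^ (2 * k + 3) * if 2 * k + 3 = 1 then 1 else 0)
        + z₁⁻¹ ^ (2 * k + 2) / l) = z₁⁻¹ ^ (2 * (k + 1) + 2) / l by
      rw [if_neg (by omega)]; ring] at h
    refine h.congr ?_
    · filter_upwards [self_mem_nhdsWithin, hne.filter_mono nhdsWithin_le_nhds] with z hz hz'
      have hz : z ≠ 0 := hz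
      rw [← mul_pow, ← mul_inv, show 2 * (k + 1) + 1 = 2 * k + 3 by ring,
        show (l * z)⁻¹ ^ (2 * k + 3) = (l * z)⁻¹ ^ (2 * k + 1) * (l * z)⁻¹ ^ 2 by ring]
      have hu : l * z ≠ 0 := mul_ne_zero hl hz
      generalize (l * z)⁻¹ ^ (2 * k + 1) = P
      generalize l * z = u at hu hz' ⊢
      field_simp
      ring

theorem curveX_deriv (a z : ℂ) : deriv (curveX a) z = 2 * z := by
  unfold curveX; simp

/-- The bound keeps the segment from z to -z away from the double pole, and it holds on all small
circles that enter the residue. -/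
theorem segInt_bergman {z z₁ : ℂ} (h : ‖z‖ < ‖z₁‖) :
    segInt (fun ζ => bergman ζ z₁) z (-z) = 2 * z / (z ^ 2 - z₁ ^ 2) := by
  have hne : ∀ s ∈ Set.uIcc (0 : ℝ) 1, z + (s : ℂ) * (-z - z) - z₁ ≠ 0 := by
    intro s hs h0
    rw [Set.uIcc_of_le zero_le_one] at hs
    have : z₁ = ((1 - 2 * s : ℝ) : ℂ) * z := by
      push_cast; linear_combination -h0
    rw [this, norm_mul, Complex.norm_real, Real.norm_eq_abs] at h
    have habs : |1 - 2 * s| ≤ 1 := abs_le.2 ⟨by linarith [hs.2], by linarith [hs.1]⟩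
    nlinarith [norm_nonneg z]
  have hd : ∀ s ∈ Set.uIcc (0 : ℝ) 1, HasDerivAt (fun s : ℝ => -(z + (s : ℂ) * (-z - z) - z₁)⁻¹)
      (bergman (z + (s : ℂ) * (-z - z)) z₁ * (-z - z)) s := by
    intro s hs
    have h1 : HasDerivAt (fun s : ℝ => z + (s : ℂ) * (-z - z) - z₁) (-z - z) s := by
      have := ((Complex.ofRealCLM.hasDerivAt (x := s)).mul_const (-z - z)).const_add z |>.sub_const z₁
      simpa using this
    refine (h1.inv (hne s hs)).neg.congr_deriv ?_
    unfold bergman; ring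
  unfold segInt
  rw [intervalIntegral.integral_eq_sub_of_hasDerivAt hd]
  · have h0 := hne 0 (by simp)
    have h1 := hne 1 (by simp)
    simp only [Complex.ofReal_zero, zero_mul, add_zero, Complex.ofReal_one, one_mul] at h0 h1 ⊢
    have h1' : -z - z₁ ≠ 0 := by intro h; apply h1; linear_combination h
    have h2 : z ^ 2 - z₁ ^ 2 ≠ 0 := by
      intro h; apply mul_ne_zero h0 h1'; linear_combination -h
    rw [show z + (-z - z) - z₁ = -z - z₁ by ring]
    field_simp
    ring
  · apply ContinuousOn.intervalIntegrable
    intro s hs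
    have := hne s hs
    unfold bergman
    apply ContinuousAt.continuousWithinAt
    apply ContinuousAt.mul _ continuousAt_const
    apply ContinuousAt.div continuousAt_const
    · fun_prop
    · exact pow_ne_zero 2 this

theorem kernel_eq {a z z₁ : ℂ} (h : ‖z‖ < ‖z₁‖) :
    kernel a z z₁ = 1 / (8 * z * (z ^ 2 - 3 * a) * (z₁ ^ 2 - z ^ 2)) := by
  rw [kernel, segInt_bergman h, curveX_deriv, curveY, curveY]
  by_cases hz : z = 0
  · simp [hz]
  have h2 : z ^ 2 - z₁ ^ 2 ≠ 0 := by
    intro h'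
    have : ‖z ^ 2‖ = ‖z₁ ^ 2‖ := by rw [sub_eq_zero.1 h']
    rw [norm_pow, norm_pow] at this
    exact h.ne ((sq_eq_sq₀ (norm_nonneg _) (norm_nonneg _)).1 this)
  have h3 : z₁ ^ 2 - z ^ 2 ≠ 0 := fun h' => h2 (by linear_combination -h')
  by_cases ha : z ^ 2 - 3 * a = 0
  · simp [ha]
  · have e : 2 * (2 * z * (z ^ 2 - 3 * a) - 2 * -z * ((-z) ^ 2 - 3 * a)) * (2 * z)
        = 16 * z ^ 2 * (z ^ 2 - 3 * a) := by ring
    rw [e]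
    field_simp
    ring
end PainleveOne
end

/-! ### The loop equation at finitely many marked points. -/

noncomputable section
namespace PainleveOne
open MvPolynomial Finset Filter
open scoped Topology

/-- The free energy of the topological recursion, as a family of polynomials in the times. -/
structure IsFreeEnergy (Φ : ℕ → Fock) : Prop where
  zero : Φ 0 = 0
  const : ∀ n, constantCoeff (Φ n) = 0
  recursion : ∀ n k, dd k (Φ (n + 1)) = C (1 / 8) * (2 * vir k (Φ n) + quad k (Φ n)
      + ∑ p ∈ antidiagonal n, ∑ i ∈ range (k - 1), pderiv i (Φ p.1) * pderiv (k - 2 - i) (Φ p.2)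
      + if n = 0 then anom k else 0)

/-- The coefficients of the insertion `dz z`. -/
def pt (z : ℂ) (k : ℕ) : ℂ := z⁻¹ ^ (2 * k + 2)

theorem dz_eq_cd_pt (z : ℂ) : dz z = cd (pt z) := rfl

theorem pt_neg (z : ℂ) : pt (-z) = pt z := by
  funext k
  rw [pt, pt, inv_neg, show 2 * k + 2 = 2 * (k + 1) by ring, pow_mul, pow_mul, neg_sq]

theorem sum_odd_geom (u : ℂ) (n : ℕ) :
    (1 - u) ^ 2 * ∑ i ∈ range n, (2 * (i : ℂ) + 1) * u ^ i
      = 1 + u - (2 * n + 1) * u ^ n + (2 * n - 1) * u ^ (n + 1) := by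
  induction n with
  | zero => simp
  | succ n ih => rw [sum_range_succ, mul_add, ih]; push_cast; ring

/-- The regular part of the commutator of `dz w` and `2 ez z`. -/
def remainder (z w : ℂ) (j : ℕ) : ℂ :=
  2 * z ^ 2 * w⁻¹ ^ (2 * j + 6) * ((2 * j + 5) - (2 * j + 3) * (z ^ 2 * w⁻¹ ^ 2))
    / (1 - z ^ 2 * w⁻¹ ^ 2) ^ 2

/-- With u = z²/w² the commutator is the finite sum of (2i+1)uⁱ over i < j + 2. The full series (1 +
u)/(1 - u)² gives the two Bergman kernels; the missing tail is `remainder`, which carries a factor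
z² and so vanishes at z = 0. -/
theorem dz_two_ez {z w : ℂ} (hz : z ≠ 0) (hw : w ≠ 0) (h : z ^ 2 ≠ w ^ 2) (j : ℕ) :
    cd (pt w) (((2 : ℂ) • ez z) (X j))
      = C ((bergman z w + bergman (-z) w) * pt z j - remainder z w j) := by
  have h1 : cd (pt w) (((2 : ℂ) • ez z) (X j)) = C (2 * (z⁻¹ ^ (2 * j + 2) * w⁻¹ ^ 2 *
      ∑ i ∈ range (j + 2), (2 * (i : ℂ) + 1) * (z ^ 2 * w⁻¹ ^ 2) ^ i)) := by
    rw [Derivation.smul_apply, ez, mkDerivation_X, Derivation.map_smul, map_sum,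
      MvPolynomial.smul_eq_C_mul, C_mul]
    congr 1
    rw [mul_sum, map_sum, ← sum_range_reflect]
    refine sum_congr rfl fun i hi => ?_
    have hi := mem_range.1 hi
    rw [D_C_mul, vir, mkDerivation_X, if_pos (by omega), D_C_mul, cd_X, ← C_mul, ← C_mul, pt]
    congr 1
    have e : j + 1 - (j + 2 - 1 - i) = i := by omega
    rw [e, show 2 * (j + 2 - 1 - i) = 2 * j + 2 - 2 * i by omega]
    have e2 : z⁻¹ ^ (2 * j + 2 - 2 * i) = z⁻¹ ^ (2 * j + 2) * z ^ (2 * i) := by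
      rw [pow_sub₀ _ (inv_ne_zero hz) (by omega), ← inv_pow, inv_inv]
    rw [e2, mul_pow, ← pow_mul, ← pow_mul]; ring
  rw [h1]
  congr 1
  have hne : 1 - z ^ 2 * w⁻¹ ^ 2 ≠ 0 := by
    intro h0; apply h; field_simp at h0; linear_combination -h0
  have hs := sum_odd_geom (z ^ 2 * w⁻¹ ^ 2) (j + 2)
  have hs' : ∑ i ∈ range (j + 2), (2 * (i : ℂ) + 1) * (z ^ 2 * w⁻¹ ^ 2) ^ i
      = (1 + z ^ 2 * w⁻¹ ^ 2 - (2 * (j + 2 : ℕ) + 1) * (z ^ 2 * w⁻¹ ^ 2) ^ (j + 2)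
        + (2 * (j + 2 : ℕ) - 1) * (z ^ 2 * w⁻¹ ^ 2) ^ (j + 2 + 1)) / (1 - z ^ 2 * w⁻¹ ^ 2) ^ 2 := by
    rw [eq_div_iff (pow_ne_zero 2 hne), ← hs]; ring
  have hb : bergman z w + bergman (-z) w
      = 2 * w⁻¹ ^ 2 * (1 + z ^ 2 * w⁻¹ ^ 2) / (1 - z ^ 2 * w⁻¹ ^ 2) ^ 2 := by
    have h2 : z - w ≠ 0 := fun h0 => h (by linear_combination (z + w) * h0)
    have h3 : -z - w ≠ 0 := fun h0 => h (by linear_combination (w - z) * h0)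
    have h4 : w ^ 2 - z ^ 2 ≠ 0 := fun h0 => h (by linear_combination -h0)
    rw [show 1 - z ^ 2 * w⁻¹ ^ 2 = (w ^ 2 - z ^ 2) / w ^ 2 by field_simp]
    unfold bergman
    field_simp
    ring
  have hp : z⁻¹ ^ (2 * j + 2) * (z ^ 2 * w⁻¹ ^ 2) ^ (j + 2) = z ^ 2 * w⁻¹ ^ (2 * j + 4) := by
    rw [mul_pow, ← pow_mul, ← pow_mul, show 2 * (j + 2) = 2 * j + 2 + 2 by ring, pow_add z,
      inv_pow z, mul_assoc, ← mul_assoc, ← mul_assoc, inv_mul_cancel₀ (pow_ne_zero _ hz), one_mul]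
  rw [hs', hb, remainder, pt, eq_comm, ← sub_eq_zero]
  rw [pow_succ _ (j + 2)]
  push_cast
  generalize z ^ 2 * w⁻¹ ^ 2 = u at hp hne ⊢
  rw [show w⁻¹ ^ (2 * j + 6) = w⁻¹ ^ 2 * w⁻¹ ^ (2 * j + 4) by ring]
  generalize z⁻¹ ^ (2 * j + 2) = P at hp ⊢
  generalize w⁻¹ ^ (2 * j + 4) = Q at hp ⊢
  generalize u ^ (j + 2) = V at hp ⊢
  field_simp
  linear_combination (2 * ((2 * (j : ℂ) + 5) - (2 * j + 3) * u)) * hp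

theorem cd_mul_sub (a : ℂ) (c d : ℕ → ℂ) (f : Fock) :
    cd (fun j => a * c j - d j) f = C a * cd c f - cd d f := by
  have : cd (fun j => a * c j - d j) = a • cd c - cd d := by
    apply derivation_ext; intro j
    rw [Derivation.sub_apply, Derivation.smul_apply, cd_X, cd_X, cd_X, MvPolynomial.smul_eq_C_mul,
      ← C_mul, ← C_sub]
  rw [this, Derivation.sub_apply, Derivation.smul_apply, MvPolynomial.smul_eq_C_mul]

/-- The left side is the bracket of the topological recursion, up to unstable corrections. On the
right only the first term can be singular at z = 0; the others are analytic and vanish there, so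
they are invisible to the residue. -/
theorem loop_equation_dev {Φ : ℕ → Fock} (hΦ : IsFreeEnergy Φ) (n : ℕ) {ι : Type*} [DecidableEq ι]
    (s : Finset ι) (w : ι → ℂ) {z : ℂ} (hz : z ≠ 0) (hw : ∀ i ∈ s, w i ≠ 0)
    (hzw : ∀ i ∈ s, z ^ 2 ≠ w i ^ 2) :
    dev (s.val.map fun i => pt (w i)) (dz z (dz z (Φ n)))
      + ∑ p ∈ antidiagonal n, ∑ I ∈ s.powerset, dev (I.val.map fun i => pt (w i)) (dz z (Φ p.1))
          * dev ((s \ I).val.map fun i => pt (w i)) (dz z (Φ p.2))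
      + ∑ i ∈ s, (bergman z (w i) + bergman (-z) (w i))
          * dev ((s.erase i).val.map fun i => pt (w i)) (dz z (Φ n))
      + (if n = 0 then dev (s.val.map fun i => pt (w i)) (X 0 ^ 2)
          + dev (s.val.map fun i => pt (w i)) (C (z⁻¹ ^ 2 / 4)) else 0)
    = -8 * (z ^ 4 - z ^ 2) * dev (s.val.map fun i => pt (w i)) (dz z (Φ (n + 1)))
      + 8 * z ^ 2 * dev (s.val.map fun i => pt (w i)) (pderiv 0 (Φ (n + 1)))
      + ∑ i ∈ s, dev ((s.erase i).val.map fun i => pt (w i)) (cd (remainder z (w i)) (Φ n)) := by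
  have h := loop_equation hΦ.recursion n hz
  have h8 : (8 : Fock) = C 8 := (map_ofNat C 8).symm
  rw [show (2 : Fock) * ez z (Φ n) = ((2 : ℂ) • ez z) (Φ n) by
    rw [Derivation.smul_apply, MvPolynomial.smul_eq_C_mul, C_two], h8] at h
  generalize z ^ 4 - z ^ 2 = a at h ⊢
  have h := congrArg (dev (s.val.map fun i => pt (w i))) h
  simp only [map_add, map_sub, map_sum, dev_C_mul, mul_sub, map_zero] at h
  simp only [dev_mul] at h
  rw [dev_linear (E := (2 : ℂ) • ez z) (L := fun i j =>
    (bergman z (w i) + bergman (-z) (w i)) * pt z j - remainder z (w i) j)] at h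
  · simp only [cd_mul_sub, map_sub, dev_C_mul, sum_sub_distrib] at h
    rw [← dz_eq_cd_pt] at h
    split_ifs at h ⊢
    · simp only [map_add] at h; linear_combination h
    · simp only [map_zero] at h; linear_combination h
  · intro j
    rw [Derivation.smul_apply, ez, mkDerivation_X, MvPolynomial.smul_eq_C_mul, map_mul, map_sum,
      sum_eq_zero, mul_zero]
    intro k _
    rw [vir, mkDerivation_X]
    split_ifs <;> simp
  · intro i hi j
    exact dz_two_ez hz (hw i hi) (hzw i hi) j
end PainleveOne
end

/-! ### Stable and unstable factors of the quadratic terms. -/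

noncomputable section
namespace PainleveOne
open MvPolynomial Finset Filter
open scoped Topology

/-- The value of a stable factor in the topological recursion. -/
def stab (Φ : ℕ → Fock) (l : ℂ) {n : ℕ} (u : Fin n → ℂ) (z : ℂ) (g : ℕ) (I : Finset (Fin n)) : ℂ :=
  l ^ (5 * (2 * g + I.card - 1) + I.card + 1)
    * dev (I.val.map fun i => pt (l * u i)) (dz (l * z) (Φ (2 * g + I.card - 1)))

/-- The value of an unstable factor in the topological recursion. -/
def unst {n : ℕ} (u : Fin n → ℂ) (z : ℂ) (g : ℕ) (I : Finset (Fin n)) : ℂ :=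
  if g = 0 ∧ I.card = 1 then ∏ i ∈ I, bergman z (u i) else 0

theorem dz_neg (z : ℂ) : dz (-z) = dz z := by rw [dz_eq_cd_pt, pt_neg, dz_eq_cd_pt]

theorem bergman_scale {l : ℂ} (hl : l ≠ 0) (z w : ℂ) : bergman z w = l ^ 2 * bergman (l * z) (l * w) := by
  unfold bergman
  rw [← mul_sub, mul_pow]
  by_cases h : z - w = 0
  · simp [h]
  · field_simp

theorem sum_singletons {n : ℕ} (f : Fin n → ℂ) (G : Finset (Fin n) → ℂ) :
    ∑ I : Finset (Fin n), (if I.card = 1 then ∏ i ∈ I, f i else 0) * G I = ∑ i, f i * G {i} := by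
  symm
  refine sum_of_injOn (fun i => {i}) (fun i _ j _ h => singleton_injective h)
    (fun i _ => mem_coe.2 (mem_univ _)) ?_ ?_
  · intro I _ hI
    rw [if_neg, zero_mul]
    intro hc
    obtain ⟨i, rfl⟩ := card_eq_one.1 hc
    exact hI ⟨i, mem_coe.2 (mem_univ _), rfl⟩
  · intro i _; simp

theorem sum_compl_comm {n : ℕ} (G : Finset (Fin n) → ℂ) : ∑ I, G Iᶜ = ∑ I, G I :=
  Equiv.sum_comp (Function.Involutive.toPerm compl compl_involutive) G

/-- For fixed I, the splitting of g corresponds to a splitting p of N with first part 2g₁ + |I| - 1.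
Terms without partner on either side vanish, because Φ₀ = 0 or by the parity statement
`dev_eq_zero`. -/
theorem sum_stab_stab {Φ : ℕ → Fock} (hΦ : IsFreeEnergy Φ) (l : ℂ) {n : ℕ} (u : Fin n → ℂ) (z : ℂ)
    {g N : ℕ} (hN : N + 2 = 2 * g + n) :
    ∑ g₁ ∈ range (g + 1), ∑ I, stab Φ l u z g₁ I * stab Φ l u (-z) (g - g₁) Iᶜ
      = l ^ (5 * N + n + 2) * ∑ p ∈ antidiagonal N, ∑ I ∈ (univ : Finset (Fin n)).powerset,
        dev (I.val.map fun i => pt (l * u i)) (dz (l * z) (Φ p.1))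
          * dev ((univ \ I).val.map fun i => pt (l * u i)) (dz (l * z) (Φ p.2)) := by
  rw [sum_comm, sum_comm (s := antidiagonal N), mul_sum, powerset_univ]
  refine sum_congr rfl fun I _ => ?_
  have hI : I.card + Iᶜ.card = n := by rw [card_add_card_compl, Fintype.card_fin]
  rw [mul_sum, ← compl_eq_univ_sdiff]
  refine sum_bij_ne_zero (fun g₁ _ _ => (2 * g₁ + I.card - 1, 2 * (g - g₁) + Iᶜ.card - 1)) ?_ ?_ ?_ ?_
  · intro g₁ hg hne
    have h1 : 2 * g₁ + I.card - 1 ≠ 0 := by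
      intro h0; apply hne; rw [stab, h0, hΦ.zero]; simp
    have h2 : 2 * (g - g₁) + Iᶜ.card - 1 ≠ 0 := by
      intro h0; apply hne; rw [stab, stab, h0, hΦ.zero]; simp
    rw [HasAntidiagonal.mem_antidiagonal]
    have := mem_range.1 hg
    simp only
    omega
  · intro g₁ hg hne g₂ hg' hne' heq
    have h1 : 2 * g₁ + I.card - 1 ≠ 0 := by
      intro h0; apply hne; rw [stab, h0, hΦ.zero]; simp
    have := (Prod.ext_iff.1 heq).1
    simp only at this
    omega
  · intro p hp hne
    have hp := HasAntidiagonal.mem_antidiagonal.1 hp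
    have hd : ∀ k (J : Finset (Fin n)), dev (J.val.map fun i => pt (l * u i)) (dz (l * z) (Φ k)) ≠ 0 →
        1 ≤ k ∧ ∃ g, k + 1 = 2 * g + J.card := by
      intro k J hne
      constructor
      · by_contra hk
        rw [show k = 0 by omega, hΦ.zero] at hne; simp at hne
      · rw [dz_eq_cd_pt, ← dev_cons] at hne
        have := mt (dev_eq_zero hΦ.zero hΦ.const hΦ.recursion k _) hne
        rw [not_not, Multiset.card_cons, Multiset.card_map, card_val] at this
        obtain ⟨g, hg⟩ := this
        exact ⟨g, by omega⟩
    obtain ⟨h1, g₁, hg₁⟩ := hd _ _ (left_ne_zero_of_mul (right_ne_zero_of_mul hne))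
    obtain ⟨h2, g₂, hg₂⟩ := hd _ _ (right_ne_zero_of_mul (right_ne_zero_of_mul hne))
    have e1 : 2 * g₁ + I.card - 1 = p.1 := by omega
    have e2 : 2 * (g - g₁) + Iᶜ.card - 1 = p.2 := by omega
    refine ⟨g₁, mem_range.2 (by omega), ?_, Prod.ext e1 e2⟩
    rw [stab, stab, e1, e2, mul_neg, dz_neg]
    have hl : l ^ (5 * N + n + 2) ≠ 0 := left_ne_zero_of_mul hne
    have hl : l ≠ 0 := by rintro rfl; simp at hl
    exact mul_ne_zero (mul_ne_zero (pow_ne_zero _ hl) (left_ne_zero_of_mul (right_ne_zero_of_mul hne)))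
      (mul_ne_zero (pow_ne_zero _ hl) (right_ne_zero_of_mul (right_ne_zero_of_mul hne)))
  · intro g₁ hg hne
    have h1 : 2 * g₁ + I.card - 1 ≠ 0 := by
      intro h0; apply hne; rw [stab, h0, hΦ.zero]; simp
    have h2 : 2 * (g - g₁) + Iᶜ.card - 1 ≠ 0 := by
      intro h0; apply hne; rw [stab, stab, h0, hΦ.zero]; simp
    have := mem_range.1 hg
    rw [stab, stab, mul_neg, dz_neg, show 5 * N + n + 2 = (5 * (2 * g₁ + I.card - 1) + I.card + 1)
      + (5 * (2 * (g - g₁) + Iᶜ.card - 1) + Iᶜ.card + 1) by omega, pow_add]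
    ring

theorem sum_unst_mul {n : ℕ} (u : Fin n → ℂ) (z : ℂ) (g : ℕ) (G : ℕ → Finset (Fin n) → ℂ) :
    ∑ g₁ ∈ range (g + 1), ∑ I, unst u z g₁ I * G (g - g₁) Iᶜ
      = ∑ i, bergman z (u i) * G g (univ.erase i) := by
  rw [sum_eq_single 0]
  · simp only [unst, true_and, Nat.sub_zero]
    rw [sum_singletons (fun i => bergman z (u i)) (fun I => G g Iᶜ)]
    refine sum_congr rfl fun i _ => ?_
    congr 2; ext j; simp
  · intro g₁ _ hg
    exact sum_eq_zero fun I _ => by rw [unst, if_neg (fun h => hg h.1), zero_mul]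
  · intro h; simp at h

theorem sum_mul_unst {n : ℕ} (u : Fin n → ℂ) (z : ℂ) (g : ℕ) (G : ℕ → Finset (Fin n) → ℂ) :
    ∑ g₁ ∈ range (g + 1), ∑ I, G g₁ I * unst u z (g - g₁) Iᶜ
      = ∑ i, bergman z (u i) * G g (univ.erase i) := by
  rw [← sum_unst_mul u z g G, ← sum_range_reflect]
  refine sum_congr rfl fun g₁ hg => ?_
  have := mem_range.1 hg
  rw [← sum_compl_comm]
  refine sum_congr rfl fun I _ => ?_
  rw [compl_compl, mul_comm, show g + 1 - 1 - g₁ = g - g₁ by omega,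
    show g - (g - g₁) = g₁ by omega]

theorem stab_erase {Φ : ℕ → Fock} (l : ℂ) {n : ℕ} (u : Fin n → ℂ) (z : ℂ)
    {g N : ℕ} (hN : N + 2 = 2 * g + n) (i : Fin n) :
    stab Φ l u z g (univ.erase i) = l ^ (5 * N + n)
      * dev ((univ.erase i).val.map fun i => pt (l * u i)) (dz (l * z) (Φ N)) := by
  have h := i.pos
  rw [stab, card_erase_of_mem (mem_univ i), card_univ, Fintype.card_fin,
    show 2 * g + (n - 1) - 1 = N by omega, show 5 * N + (n - 1) + 1 = 5 * N + n by omega]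

/-- Two factors W₀,₂ force g = 0 and two remaining points, so this sum is nonempty only in the
recursion for W₀,₃. -/
theorem sum_unst_unst {n : ℕ} (u : Fin n → ℂ) (z : ℂ) {g N : ℕ} (hN : N + 2 = 2 * g + n) :
    ∑ g₁ ∈ range (g + 1), ∑ I, unst u z g₁ I * unst u (-z) (g - g₁) Iᶜ
      = if N = 0 then ∑ I : Finset (Fin n), if I.card = 1 ∧ Iᶜ.card = 1 then
        (∏ i ∈ I, bergman z (u i)) * ∏ i ∈ Iᶜ, bergman (-z) (u i) else 0 else 0 := by
  have key : ∀ g₁ ∈ range (g + 1), ∀ I : Finset (Fin n), unst u z g₁ I * unst u (-z) (g - g₁) Iᶜ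
      = if g = 0 ∧ I.card = 1 ∧ Iᶜ.card = 1 then
        (∏ i ∈ I, bergman z (u i)) * ∏ i ∈ Iᶜ, bergman (-z) (u i) else 0 := by
    intro g₁ hg I
    have := mem_range.1 hg
    unfold unst
    by_cases h1 : g₁ = 0 ∧ I.card = 1
    · by_cases h2 : g - g₁ = 0 ∧ Iᶜ.card = 1
      · rw [if_pos h1, if_pos h2, if_pos ⟨by omega, h1.2, h2.2⟩]
      · rw [if_neg h2, mul_zero, if_neg]
        rintro ⟨h, h3, h4⟩; exact h2 ⟨by omega, h4⟩
    · rw [if_neg h1, zero_mul, if_neg]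
      rintro ⟨h, h3, h4⟩; exact h1 ⟨by omega, h3⟩
  have key' : ∀ I : Finset (Fin n), I.card = 1 ∧ Iᶜ.card = 1 → n = 2 := by
    rintro I ⟨h1, h2⟩
    rw [← Fintype.card_fin n, ← card_add_card_compl I, h1, h2]
  rw [sum_congr rfl fun g₁ hg => sum_congr rfl fun I _ => key g₁ hg I]
  by_cases hg : g = 0
  · subst hg
    simp only [true_and, zero_add, range_one, sum_singleton]
    split_ifs with h
    · rfl
    · exact sum_eq_zero fun I _ => if_neg fun hI => h (by have := key' I hI; omega)
  · simp only [hg, false_and, if_false, sum_const_zero]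
    split_ifs with h
    · symm; exact sum_eq_zero fun I _ => if_neg fun hI => by have := key' I hI; omega
    · rfl
end PainleveOne
end

/-! ### The bracket of the topological recursion in terms of the free energy. -/

noncomputable section
namespace PainleveOne
open MvPolynomial Finset Filter
open scoped Topology

theorem W_two (a : ℂ) (v : Fin 2 → ℂ) : W a 0 2 v = bergman (v 0) (v 1) := by
  rw [W, if_neg (by simp), if_pos (by simp)]; rfl

theorem W_step (a : ℂ) {g n : ℕ} (v : Fin (n + 1) → ℂ) (h : 2 ≤ 2 * g + n) :
    W a g (n + 1) v = residueZero fun z => kernel a z (v 0) *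
      -((if 1 ≤ g then
            W a (g - 1) (n + 2)
              (Fin.cons z (Fin.cons (-z) (Fin.tail v : Fin n → ℂ) : Fin (n + 1) → ℂ))
          else 0)
        + ∑ g₁ : Fin (g + 1), ∑ I : Finset (Fin n),
            if ((g₁ : ℕ) = 0 ∧ I.card = 0) ∨ (g - (g₁ : ℕ) = 0 ∧ Iᶜ.card = 0) then 0
            else
              W a g₁ (I.card + 1)
                  (Fin.cons z fun i => Fin.tail v (I.orderEmbOfFin rfl i))
                * W a (g - g₁) (Iᶜ.card + 1)
                  (Fin.cons (-z) fun j => Fin.tail v (Iᶜ.orderEmbOfFin rfl j))) := by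
  rw [W, if_neg (by omega), if_neg (by omega)]

theorem univ_map_cons {n : ℕ} {α : Type*} (f : ℂ → α) (z : ℂ) (u : Fin n → ℂ) :
    (univ : Finset (Fin (n + 1))).val.map (fun i => f ((Fin.cons z u : Fin (n + 1) → ℂ) i))
      = f z ::ₘ (univ : Finset (Fin n)).val.map fun i => f (u i) := by
  rw [Fin.univ_val_map, Fin.univ_val_map, List.ofFn_succ]
  simp

theorem univ_map_orderEmb {n : ℕ} {α : Type*} (f : Fin n → α) (I : Finset (Fin n)) :
    (univ : Finset (Fin I.card)).val.map (fun i => f (I.orderEmbOfFin rfl i)) = I.val.map f := by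
  have h := congrArg Finset.val (map_orderEmbOfFin_univ I rfl)
  rw [map_val] at h
  have h2 := congrArg (Multiset.map f) h
  rw [Multiset.map_map] at h2
  exact h2

/-- The closed formula for the Eynard–Orantin differentials. -/
def wFormula (Φ : ℕ → Fock) (l : ℂ) (g n : ℕ) (v : Fin n → ℂ) : ℂ :=
  l ^ (5 * (2 * g + n - 2) + n)
    * dev ((univ : Finset (Fin n)).val.map fun i => pt (l * v i)) (Φ (2 * g + n - 2))

/-- For W₀,₂ the stable expression vanishes since Φ₀ = 0; otherwise the unstable one is zero. The
sum therefore covers both cases uniformly. -/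
theorem W_eq_stab_add_unst {Φ : ℕ → Fock} (hΦ : IsFreeEnergy Φ) {a l : ℂ} {n : ℕ}
    {u : Fin n → ℂ} (hu : ∀ i, u i ≠ 0) {z : ℂ} (hz : z ≠ 0) (g : ℕ) (I : Finset (Fin n))
    (hI : ¬ (g = 0 ∧ I.card = 0))
    (hW : ∀ v : Fin (I.card + 1) → ℂ, (∀ i, v i ≠ 0) → 3 ≤ 2 * g + (I.card + 1) →
      W a g (I.card + 1) v = wFormula Φ l g (I.card + 1) v) :
    W a g (I.card + 1) (Fin.cons z fun i => u (I.orderEmbOfFin rfl i))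
      = stab Φ l u z g I + unst u z g I := by
  by_cases h : g = 0 ∧ I.card = 1
  · obtain ⟨rfl, h⟩ := h
    obtain ⟨i, rfl⟩ := card_eq_one.1 h
    rw [stab, unst, if_pos ⟨rfl, h⟩, show 2 * 0 + ({i} : Finset (Fin n)).card - 1 = 0 by simp,
      hΦ.zero]
    have := W_two a (Fin.cons z fun j : Fin 1 => u (({i} : Finset (Fin n)).orderEmbOfFin rfl j))
    simp only [map_zero, mul_zero, zero_add, prod_singleton]
    refine this.trans ?_
    exact congrArg (fun j => bergman z (u j))
      (mem_singleton.1 (orderEmbOfFin_mem ({i} : Finset (Fin n)) rfl (0 : Fin 1)))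
  · rw [unst, if_neg h, add_zero, hW, wFormula, stab, univ_map_cons (fun z => pt (l * z)),
      univ_map_orderEmb (fun i => pt (l * u i)), dev_cons, dz_eq_cd_pt]
    · congr 2
    · intro i
      refine Fin.cases ?_ (fun i => ?_) i
      · simpa using hz
      · simpa using hu _
    · omega

/-- The difference of the unstable quadratic terms and their values at the ramification point. -/
def unstDiff {n : ℕ} (u : Fin n → ℂ) (N : ℕ) (z : ℂ) : ℂ :=
  if N = 0 then ∑ I : Finset (Fin n), if I.card = 1 ∧ Iᶜ.card = 1 then
    (∏ i ∈ I, bergman z (u i)) * (∏ i ∈ Iᶜ, bergman (-z) (u i))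
      - (∏ i ∈ I, (u i)⁻¹ ^ 2) * (∏ i ∈ Iᶜ, (u i)⁻¹ ^ 2) else 0 else 0

theorem dev_X {n : ℕ} (u : Fin n → ℂ) (I : Finset (Fin n)) :
    dev (I.val.map fun i => pt (u i)) (X 0) = if I.card = 1 then ∏ i ∈ I, (u i)⁻¹ ^ 2 else 0 := by
  split_ifs with h
  · obtain ⟨i, rfl⟩ := card_eq_one.1 h
    simp [dev_apply, dJ, cd_X, pt]
  · rcases I.eq_empty_or_nonempty with rfl | ⟨i, hi⟩
    · simp [dev_apply]
    · rw [← insert_erase hi, insert_val_map _ (notMem_erase _ _), dev_cons, cd_X, dev_C]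
      rw [Ne, ← Multiset.card_eq_zero, Multiset.card_map, card_val, card_erase_of_mem hi]
      have := card_pos.2 ⟨i, hi⟩
      omega

/-- The anomaly x₀² contributes the value at z = 0 of the products of two Bergman kernels, since
B(0, u) = u⁻². -/
theorem dev_X_mul_X {n : ℕ} {l : ℂ} (hl : l ≠ 0) (u : Fin n → ℂ) {g N : ℕ} (hN : N + 2 = 2 * g + n) :
    l ^ (5 * N + n + 2) * (if N = 0 then dev (univ.val.map fun i => pt (l * u i)) (X 0 ^ 2) else 0)
      = if N = 0 then ∑ I : Finset (Fin n), if I.card = 1 ∧ Iᶜ.card = 1 then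
        (∏ i ∈ I, (u i)⁻¹ ^ 2) * (∏ i ∈ Iᶜ, (u i)⁻¹ ^ 2) else 0 else 0 := by
  split_ifs with h
  · rw [pow_two (X 0), dev_mul, powerset_univ, mul_sum]
    refine sum_congr rfl fun I _ => ?_
    rw [← compl_eq_univ_sdiff, dev_X (fun i => l * u i), dev_X (fun i => l * u i)]
    by_cases h1 : I.card = 1
    · by_cases h2 : Iᶜ.card = 1
      · rw [if_pos h1, if_pos h2, if_pos ⟨h1, h2⟩]
        have hn : n = 2 := by rw [← Fintype.card_fin n, ← card_add_card_compl I, h1, h2]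
        subst h hn
        simp only [mul_inv, mul_pow, prod_mul_distrib, prod_const, h1, h2]
        field_simp
      · rw [if_neg h2]; simp [h2]
    · rw [if_neg h1]; simp [h1]
  · simp

/-- Under the rescaling by l the bracket agrees with the left side of `loop_equation_dev`, except
that the loop equation sees products of two Bergman kernels only through their values at z = 0. The
difference is `unstDiff`. -/
theorem bracket_eq {Φ : ℕ → Fock} (hΦ : IsFreeEnergy Φ) {a l : ℂ} (hl : l ≠ 0) {g n N : ℕ}
    (hN : N + 2 = 2 * g + n) {u : Fin n → ℂ} (hu : ∀ i, u i ≠ 0)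
    (hW : ∀ g' n' (v : Fin n' → ℂ), 1 ≤ n' → 3 ≤ 2 * g' + n' → 2 * g' + n' < 2 * g + (n + 1) →
      (∀ i, v i ≠ 0) → W a g' n' v = wFormula Φ l g' n' v)
    {z : ℂ} (hz : z ≠ 0) (hzu : ∀ i, z ^ 2 ≠ u i ^ 2) :
    (if 1 ≤ g then W a (g - 1) (n + 2) (Fin.cons z (Fin.cons (-z) u : Fin (n + 1) → ℂ)) else 0)
        + ∑ g₁ : Fin (g + 1), ∑ I : Finset (Fin n),
            (if ((g₁ : ℕ) = 0 ∧ I.card = 0) ∨ (g - (g₁ : ℕ) = 0 ∧ Iᶜ.card = 0) then 0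
            else
              W a g₁ (I.card + 1) (Fin.cons z fun i => u (I.orderEmbOfFin rfl i))
                * W a (g - g₁) (Iᶜ.card + 1) (Fin.cons (-z) fun j => u (Iᶜ.orderEmbOfFin rfl j)))
      = l ^ (5 * N + n + 2) * (-8 * ((l * z) ^ 4 - (l * z) ^ 2)
          * dev (univ.val.map fun i => pt (l * u i)) (dz (l * z) (Φ (N + 1)))
        + 8 * (l * z) ^ 2 * dev (univ.val.map fun i => pt (l * u i)) (pderiv 0 (Φ (N + 1)))
        + ∑ i, dev ((univ.erase i).val.map fun i => pt (l * u i))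
            (cd (remainder (l * z) (l * u i)) (Φ N)))
        + unstDiff u N z := by
  -- For N = 0 and g = 1 the first term is W₀,₂(z, -z) = z⁻²/4, which is the scalar anomaly; in
  -- genus zero the contribution vanishes on the free energy side as well.
  have hfirst : (if 1 ≤ g then
      W a (g - 1) (n + 2) (Fin.cons z (Fin.cons (-z) u : Fin (n + 1) → ℂ)) else 0)
      = l ^ (5 * N + n + 2) * (dev (univ.val.map fun i => pt (l * u i)) (dz (l * z) (dz (l * z) (Φ N)))
        + if N = 0 then dev (univ.val.map fun i => pt (l * u i)) (C ((l * z)⁻¹ ^ 2 / 4)) else 0) := by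
    rcases Nat.eq_zero_or_pos N with h | h
    · subst h
      rw [hΦ.zero]
      simp only [map_zero, if_true, zero_add]
      rcases Nat.eq_zero_or_pos g with hg | hg
      · rw [if_neg (by omega), dev_C, mul_zero]
        rw [Ne, ← Multiset.card_eq_zero, Multiset.card_map, card_val, card_univ, Fintype.card_fin]
        omega
      · obtain rfl : g = 1 := by omega
        obtain rfl : n = 0 := by omega
        rw [if_pos le_rfl]
        refine (W_two _ _).trans ?_
        simp [dev_apply, bergman]
        field_simp
        norm_num
    · rw [if_neg (by omega : ¬ N = 0), add_zero]
      split_ifs with hg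
      · rw [hW _ _ _ (by omega) (by omega) (by omega), wFormula, univ_map_cons (fun z => pt (l * z)),
          univ_map_cons (fun z => pt (l * z)), dev_cons, dev_cons, mul_neg, pt_neg, dz_eq_cd_pt]
        · rw [show 2 * (g - 1) + (n + 2) - 2 = N by omega]; rfl
        · intro i
          refine Fin.cases (by simpa using hz) (fun i => ?_) i
          refine Fin.cases (by simpa using hz) (fun i => ?_) i
          simpa using hu i
      · rw [dz_eq_cd_pt, ← dev_cons, ← dev_cons, dev_eq_zero hΦ.zero hΦ.const hΦ.recursion, mul_zero]
        rintro ⟨g', h'⟩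
        simp only [Multiset.card_cons, Multiset.card_map, card_val, card_univ, Fintype.card_fin] at h'
        omega
  have hsum : ∀ g₁ ∈ range (g + 1), ∀ I : Finset (Fin n),
      (if (g₁ = 0 ∧ I.card = 0) ∨ (g - g₁ = 0 ∧ Iᶜ.card = 0) then 0
            else
              W a g₁ (I.card + 1) (Fin.cons z fun i => u (I.orderEmbOfFin rfl i))
                * W a (g - g₁) (Iᶜ.card + 1) (Fin.cons (-z) fun j => u (Iᶜ.orderEmbOfFin rfl j)))
      = stab Φ l u z g₁ I * stab Φ l u (-z) (g - g₁) Iᶜ + stab Φ l u z g₁ I * unst u (-z) (g - g₁) Iᶜ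
        + unst u z g₁ I * stab Φ l u (-z) (g - g₁) Iᶜ + unst u z g₁ I * unst u (-z) (g - g₁) Iᶜ := by
    intro g₁ hg₁ I
    have hg₁ := mem_range.1 hg₁
    have hI : I.card + Iᶜ.card = n := by rw [card_add_card_compl, Fintype.card_fin]
    have hexc : ∀ z g (J : Finset (Fin n)), g = 0 ∧ J.card = 0 →
        stab Φ l u z g J = 0 ∧ unst u z g J = 0 := by
      rintro z g J ⟨rfl, hJ⟩
      rw [stab, unst, hJ, show 2 * 0 + 0 - 1 = 0 by rfl, hΦ.zero]; simp
    split_ifs with h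
    · rcases h with h | h
      · rw [(hexc z _ _ h).1, (hexc z _ _ h).2]; ring
      · rw [(hexc (-z) _ _ h).1, (hexc (-z) _ _ h).2]; ring
    · push Not at h
      rw [W_eq_stab_add_unst hΦ hu hz _ _ (fun h' => h.1 h'.1 h'.2),
        W_eq_stab_add_unst hΦ hu (neg_ne_zero.2 hz) _ _ (fun h' => h.2 h'.1 h'.2)]
      · ring
      · exact fun v hv h3 => hW _ _ v (by omega) h3 (by omega) hv
      · exact fun v hv h3 => hW _ _ v (by omega) h3 (by omega) hv
  rw [← sum_range (fun g₁ => ∑ I : Finset (Fin n),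
            (if (g₁ = 0 ∧ I.card = 0) ∨ (g - g₁ = 0 ∧ Iᶜ.card = 0) then 0
            else
              W a g₁ (I.card + 1) (Fin.cons z fun i => u (I.orderEmbOfFin rfl i))
                * W a (g - g₁) (Iᶜ.card + 1) (Fin.cons (-z) fun j => u (Iᶜ.orderEmbOfFin rfl j)))),
    sum_congr rfl fun g₁ hg₁ => sum_congr rfl fun I _ => hsum g₁ hg₁ I]
  simp only [sum_add_distrib]
  rw [hfirst, sum_stab_stab hΦ l u z hN, sum_unst_mul u z g (stab Φ l u (-z)),
    sum_mul_unst u (-z) g (stab Φ l u z), sum_unst_unst u z hN]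
  have h := loop_equation_dev hΦ N univ (fun i => l * u i) (mul_ne_zero hl hz)
    (fun i _ => mul_ne_zero hl (hu i))
    (fun i _ h => hzu i (mul_left_cancel₀ (pow_ne_zero 2 hl) (by linear_combination h)))
  have hb : ∀ i, bergman (-z) (u i) * stab Φ l u z g (univ.erase i)
      + bergman z (u i) * stab Φ l u (-z) g (univ.erase i)
      = l ^ (5 * N + n + 2) * ((bergman (l * z) (l * u i) + bergman (-(l * z)) (l * u i))
        * dev ((univ.erase i).val.map fun i => pt (l * u i)) (dz (l * z) (Φ N))) := by
    intro i
    rw [stab_erase l u _ hN, stab_erase l u _ hN, bergman_scale hl, bergman_scale hl z, mul_neg, dz_neg]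
    ring
  have hb' := sum_congr rfl fun i (_ : i ∈ (univ : Finset (Fin n))) => hb i
  rw [sum_add_distrib, ← mul_sum] at hb'
  have hd := dev_X_mul_X hl u hN
  rw [← h]
  unfold unstDiff
  have hU : (if N = 0 then ∑ I : Finset (Fin n), if I.card = 1 ∧ Iᶜ.card = 1 then
    (∏ i ∈ I, bergman z (u i)) * (∏ i ∈ Iᶜ, bergman (-z) (u i))
      - (∏ i ∈ I, (u i)⁻¹ ^ 2) * (∏ i ∈ Iᶜ, (u i)⁻¹ ^ 2) else 0 else 0)
    = (if N = 0 then ∑ I : Finset (Fin n), if I.card = 1 ∧ Iᶜ.card = 1 then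
    (∏ i ∈ I, bergman z (u i)) * (∏ i ∈ Iᶜ, bergman (-z) (u i)) else 0 else 0)
    - (if N = 0 then ∑ I : Finset (Fin n), if I.card = 1 ∧ Iᶜ.card = 1 then
      (∏ i ∈ I, (u i)⁻¹ ^ 2) * (∏ i ∈ Iᶜ, (u i)⁻¹ ^ 2) else 0 else 0) := by
    split_ifs
    · rw [← sum_sub_distrib]
      refine sum_congr rfl fun I _ => ?_
      split_ifs <;> simp
    · simp
  rw [hU, ← hd]
  by_cases h0 : N = 0
  · simp only [if_pos h0]
    linear_combination hb'
  · simp only [if_neg h0]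
    linear_combination hb'
end PainleveOne
end

/-! ### Evaluation of the residue: closed formula for the Eynard–Orantin differentials. -/

noncomputable section
namespace PainleveOne
open MvPolynomial Finset Filter
open scoped Topology

theorem analyticAt_bergman {l w : ℂ} (hw : w ≠ 0) : AnalyticAt ℂ (fun z => bergman (l * z) w) 0 := by
  unfold bergman
  refine AnalyticAt.div analyticAt_const (by fun_prop) ?_
  simpa using hw

theorem analyticAt_unstDiff {n : ℕ} {u : Fin n → ℂ} (hu : ∀ i, u i ≠ 0) (N : ℕ) :
    AnalyticAt ℂ (unstDiff u N) 0 := by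
  unfold unstDiff
  by_cases hN : N = 0
  · simp only [if_pos hN]
    refine Finset.analyticAt_fun_sum _ fun I _ => ?_
    split_ifs
    · refine AnalyticAt.sub (AnalyticAt.mul ?_ ?_) analyticAt_const
      · refine Finset.analyticAt_fun_prod _ fun i _ => ?_
        simpa using analyticAt_bergman (l := 1) (hu i)
      · refine Finset.analyticAt_fun_prod _ fun i _ => ?_
        simpa using analyticAt_bergman (l := -1) (hu i)
    · exact analyticAt_const
  · simp only [if_neg hN]; exact analyticAt_const

theorem unstDiff_zero {n : ℕ} (u : Fin n → ℂ) (N : ℕ) : unstDiff u N 0 = 0 := by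
  unfold unstDiff
  split_ifs
  · refine sum_eq_zero fun I _ => ?_
    split_ifs <;> simp [bergman]
  · rfl

theorem analyticAt_remainder (l : ℂ) {w : ℂ} (j : ℕ) :
    AnalyticAt ℂ (fun z => remainder (l * z) w j) 0 := by
  unfold remainder
  refine AnalyticAt.div (by fun_prop) (by fun_prop) ?_
  simp

theorem remainder_zero (w : ℂ) : remainder 0 w = 0 := by
  funext j; simp [remainder]

theorem analyticAt_cd_remainder (l w : ℂ) (J : Multiset (ℕ → ℂ)) (f : Fock) :
    AnalyticAt ℂ (fun z => dev J (cd (remainder (l * z) w) f)) 0 := by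
  obtain ⟨B, hB⟩ := exists_pderiv_eq_zero f
  simp only [fun z => cd_eq_sum (remainder (l * z) w) f B hB, map_sum, dev_C_mul]
  exact Finset.analyticAt_fun_sum _ fun i _ => (analyticAt_remainder l i).mul analyticAt_const

/-- The kernel z/(z₁² - z²) reproduces even principal parts: its residue pairing replaces z by z₁.
-/
theorem hasRes_dz (f : Fock) (J : Multiset (ℕ → ℂ)) {l z₁ : ℂ} (hl : l ≠ 0) (hz₁ : z₁ ≠ 0) :
    HasRes (fun z => l * z * dev J (dz (l * z) f) / (z₁ ^ 2 - (l * z) ^ 2)) (dev J (dz z₁ f) / l) := by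
  obtain ⟨B, hB⟩ := exists_pderiv_eq_zero f
  have h := HasRes.sum (range B) (fun i _ => (HasRes.inv_pow_div hl hz₁ i).const_mul (dev J (pderiv i f)))
  convert h.congr ?_ using 1
  · rw [dz_eq_sum z₁ f B hB, map_sum, sum_div]
    exact sum_congr rfl fun i _ => by rw [dev_C_mul]; ring
  · filter_upwards [self_mem_nhdsWithin] with z hz
    have hz : z ≠ 0 := hz
    rw [dz_eq_sum (l * z) f B hB, map_sum, mul_sum, sum_div]
    refine sum_congr rfl fun i _ => ?_
    have e : (l * z)⁻¹ ^ (2 * i + 1) = l * z * (l * z)⁻¹ ^ (2 * i + 2) := by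
      have : l * z ≠ 0 := mul_ne_zero hl hz
      rw [pow_succ _ (2 * i + 1)]; field_simp
    rw [dev_C_mul, e]; ring

theorem eventually_ne_sq {w : ℂ} (hw : w ≠ 0) : ∀ᶠ z in 𝓝 (0 : ℂ), z ^ 2 ≠ w ^ 2 := by
  have : ContinuousAt (fun z : ℂ => z ^ 2) 0 := by fun_prop
  exact this.eventually_ne (by simpa using (pow_ne_zero 2 hw).symm)

/-- Induction on 2g + n. The singular part of the bracket has the factor (lz)⁴ - (lz)², and since 3a
= l⁻² this cancels z² - 3a in the kernel, so the residue returns the principal part at z₁.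
Everything else contributes h(z)/z with h analytic and h(0) = 0. -/
theorem W_eq_wFormula {Φ : ℕ → Fock} (hΦ : IsFreeEnergy Φ) {a l : ℂ} (hal : 3 * a * l ^ 2 = 1)
    (g n : ℕ) (v : Fin n → ℂ) (hn : 1 ≤ n) (hgn : 3 ≤ 2 * g + n) (hv : ∀ i, v i ≠ 0) :
    W a g n v = wFormula Φ l g n v := by
  have hl : l ≠ 0 := by rintro rfl; simp at hal
  induction hm : 2 * g + n using Nat.strong_induction_on generalizing g n with
  | _ m ih =>
  obtain ⟨n, rfl⟩ : ∃ k, n = k + 1 := ⟨n - 1, by omega⟩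
  obtain ⟨N, hN⟩ : ∃ N, N + 2 = 2 * g + n := ⟨2 * g + n - 2, by omega⟩
  have hu : ∀ i, (Fin.tail v : Fin n → ℂ) i ≠ 0 := fun i => hv _
  set u : Fin n → ℂ := Fin.tail v
  set z₁ := v 0
  have hz₁ : z₁ ≠ 0 := hv 0
  have hW : ∀ g' n' (v : Fin n' → ℂ), 1 ≤ n' → 3 ≤ 2 * g' + n' → 2 * g' + n' < 2 * g + (n + 1) →
      (∀ i, v i ≠ 0) → W a g' n' v = wFormula Φ l g' n' v := fun g' n' v h1 h2 h3 hv' =>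
    ih _ (by omega) g' n' v h1 h2 hv' rfl
  set J := (univ : Finset (Fin n)).val.map fun i => pt (l * u i) with hJ
  let h : ℂ → ℂ := fun z => -(l ^ (5 * N + n + 2) * (8 * (l * z) ^ 2 * dev J (pderiv 0 (Φ (N + 1)))
        + ∑ i, dev ((univ.erase i).val.map fun i => pt (l * u i))
            (cd (remainder (l * z) (l * u i)) (Φ N))) + unstDiff u N z)
      / (8 * (z ^ 2 - 3 * a) * (z₁ ^ 2 - z ^ 2))
  have ha : a ≠ 0 := by rintro rfl; simp at hal
  have hh : AnalyticAt ℂ h 0 := by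
    refine AnalyticAt.div ?_ (by fun_prop) ?_
    · refine AnalyticAt.neg (AnalyticAt.add (AnalyticAt.mul analyticAt_const (AnalyticAt.add
        (by fun_prop) ?_)) (analyticAt_unstDiff hu N))
      exact Finset.analyticAt_fun_sum _ fun i _ => analyticAt_cd_remainder _ _ _ _
    · simpa using ⟨ha, hz₁⟩
  have hh0 : h 0 = 0 := by
    simp only [h, mul_zero, remainder_zero, unstDiff_zero]
    have : cd 0 = 0 := by
      apply derivation_ext; intro j; rw [cd_X]; simp
    simp [this]
  -- The exponent 5N + n + 7 is 5N + n + 2 from the bracket plus 5 from rescaling the kernel; the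
  -- division by l in the residue leaves 5(N + 1) + (n + 1).
  have hres := ((hasRes_dz (Φ (N + 1)) J hl (mul_ne_zero hl hz₁)).const_mul
    (l ^ (5 * N + n + 7))).add (HasRes.div_id hh)
  rw [W_step a v (by omega)]
  refine (HasRes.residueZero_eq (c := l ^ (5 * N + n + 7) *
    (dev J (dz (l * z₁) (Φ (N + 1))) / l) + h 0) (hres.congr ?_)).trans ?_
  · have e1 : ∀ᶠ z in 𝓝[≠] (0 : ℂ), ∀ i, z ^ 2 ≠ u i ^ 2 :=
      (eventually_all.2 fun i => eventually_ne_sq (hu i)).filter_mono nhdsWithin_le_nhds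
    have e2 : ∀ᶠ z in 𝓝[≠] (0 : ℂ), z ^ 2 ≠ z₁ ^ 2 :=
      (eventually_ne_sq hz₁).filter_mono nhdsWithin_le_nhds
    have e3 : ∀ᶠ z in 𝓝[≠] (0 : ℂ), z ^ 2 ≠ l⁻¹ ^ 2 :=
      (eventually_ne_sq (inv_ne_zero hl)).filter_mono nhdsWithin_le_nhds
    have e4 : ∀ᶠ z in 𝓝[≠] (0 : ℂ), ‖z‖ < ‖z₁‖ := by
      refine Eventually.filter_mono nhdsWithin_le_nhds ?_
      have : ContinuousAt (fun z : ℂ => ‖z‖) 0 := by fun_prop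
      exact this.eventually_lt_const (by simpa using hz₁)
    filter_upwards [e1, e2, e3, e4, self_mem_nhdsWithin] with z h1 h2 h3 h4 hz
    have hz : z ≠ 0 := hz
    rw [bracket_eq hΦ hl hN hu hW hz h1, kernel_eq h4]
    simp only [h]
    have h3a : 3 * a = l⁻¹ ^ 2 := by field_simp; linear_combination hal
    rw [h3a]
    have d1 : z ^ 2 - l⁻¹ ^ 2 ≠ 0 := sub_ne_zero.2 h3
    have d2 : z₁ ^ 2 - z ^ 2 ≠ 0 := sub_ne_zero.2 h2.symm
    rw [show (l * z₁) ^ 2 - (l * z) ^ 2 = l ^ 2 * (z₁ ^ 2 - z ^ 2) by ring,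
      show (l * z) ^ 4 - (l * z) ^ 2 = l ^ 4 * z ^ 2 * (z ^ 2 - l⁻¹ ^ 2) by field_simp,
      show l ^ (5 * N + n + 7) = l ^ 5 * l ^ (5 * N + n + 2) by ring]
    generalize z ^ 2 - l⁻¹ ^ 2 = A at d1 ⊢
    generalize z₁ ^ 2 - z ^ 2 = B at d2 ⊢
    rw [← hJ]
    generalize dev J (dz (l * z) (Φ (N + 1))) = w
    generalize (∑ i, dev ((univ.erase i).val.map fun i => pt (l * u i))
            (cd (remainder (l * z) (l * u i)) (Φ N))) = R
    generalize dev J (pderiv 0 (Φ (N + 1))) = U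
    generalize unstDiff u N z = D
    generalize l ^ (5 * N + n + 2) = L
    field_simp
    ring
  · rw [hh0, add_zero, wFormula, show v = Fin.cons z₁ u from (Fin.cons_self_tail v).symm,
      univ_map_cons (fun z => pt (l * z)), dev_cons, ← dz_eq_cd_pt,
      show 2 * g + (n + 1) - 2 = N + 1 by omega,
      show 5 * (N + 1) + (n + 1) = 5 * N + n + 6 by ring,
      show 5 * N + n + 7 = 5 * N + n + 6 + 1 by ring, pow_succ _ (5 * N + n + 6)]
    field_simp
    rfl
end PainleveOne
end

/-! ### Open free energies and Taylor's formula on the diagonal. -/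

noncomputable section
namespace PainleveOne
open MvPolynomial Finset Filter
open scoped Topology

/-- The times of the diagonal specialization: the primitives of `pt z`. -/
def ipt (z : ℂ) (k : ℕ) : ℂ := -z⁻¹ ^ (2 * k + 1) / (2 * k + 1)

theorem halfCircleInt_congr {f g : ℂ → ℂ} {z : ℂ} (hz : z ≠ 0) (h : ∀ ζ, ζ ≠ 0 → f ζ = g ζ) :
    halfCircleInt f z = halfCircleInt g z := by
  unfold halfCircleInt
  congr 1; funext θ
  rw [h _ (mul_ne_zero hz (Complex.exp_ne_zero _))]

theorem multiInt_congr {n : ℕ} {f g : (Fin n → ℂ) → ℂ} {v : Fin n → ℂ} (hv : ∀ i, v i ≠ 0)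
    (h : ∀ w, (∀ i, w i ≠ 0) → f w = g w) : multiInt n f v = multiInt n g v := by
  induction n with
  | zero => exact h _ hv
  | succ n ih =>
    refine halfCircleInt_congr (hv 0) fun ζ hζ => ih (fun i => hv _) fun w hw => h _ ?_
    intro i
    refine Fin.cases hζ (fun i => hw i) i

/-- An odd primitive of each component of ζ ↦ `pt (l * ζ)` is that of `ipt (l * ζ)` divided by l.
Its increment from -z to z is twice its value at z, and these factors 2 will cancel the 2⁻ⁿ in the
open free energy. -/
theorem halfCircleInt_dz {l z : ℂ} (hl : l ≠ 0) (hz : z ≠ 0) (c : ℂ) (J : Multiset (ℕ → ℂ)) (f : Fock) :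
    halfCircleInt (fun ζ => c * dev (pt (l * ζ) ::ₘ J) f) z
      = c * (2 / l) * dev (ipt (l * z) ::ₘ J) f := by
  obtain ⟨B, hB⟩ := exists_pderiv_eq_zero f
  have hexp : ∀ θ : ℝ, z * Complex.exp (θ * Complex.I) ≠ 0 := fun θ =>
    mul_ne_zero hz (Complex.exp_ne_zero _)
  have hderiv : ∀ θ : ℝ, HasDerivAt
      (fun θ : ℝ => c * l⁻¹ * dev (ipt (l * (z * Complex.exp (θ * Complex.I))) ::ₘ J) f)
      (c * dev (pt (l * (z * Complex.exp (θ * Complex.I))) ::ₘ J) f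
        * (Complex.I * z * Complex.exp (θ * Complex.I))) θ := by
    intro θ
    simp only [dev_cons, cd_eq_sum _ f B hB, map_sum, dev_C_mul]
    have he : HasDerivAt (fun θ : ℝ => z * Complex.exp (θ * Complex.I))
        (Complex.I * z * Complex.exp (θ * Complex.I)) θ := by
      have h1 : HasDerivAt (fun θ : ℝ => (θ : ℂ) * Complex.I) (1 * Complex.I) θ :=
        (Complex.ofRealCLM.hasDerivAt (x := θ)).mul_const _
      refine (h1.cexp.const_mul z).congr_deriv ?_
      ring
    have hi : ∀ k, HasDerivAt (fun θ : ℝ => ipt (l * (z * Complex.exp (θ * Complex.I))) k)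
        (pt (l * (z * Complex.exp (θ * Complex.I))) k * (l * (Complex.I * z * Complex.exp (θ * Complex.I)))) θ := by
      intro k
      unfold ipt pt
      have hne := mul_ne_zero hl (hexp θ)
      have := ((((he.const_mul l).inv hne).pow (2 * k + 1)).neg).div_const (2 * (k : ℂ) + 1)
      refine this.congr_deriv ?_
      have h2 : (2 * (k : ℂ) + 1) ≠ 0 := by exact_mod_cast Nat.succ_ne_zero (2 * k)
      push_cast
      rw [pow_add _ (2 * k) 2]
      simp only [Pi.inv_apply]
      field_simp
    have := (HasDerivAt.fun_sum (u := range B) fun i _ =>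
      (hi i).mul_const (dev J (pderiv i f))).const_mul (c * l⁻¹)
    refine this.congr_deriv ?_
    rw [mul_sum, mul_sum, sum_mul]
    refine sum_congr rfl fun i _ => ?_
    field_simp
  unfold halfCircleInt
  rw [intervalIntegral.integral_eq_sub_of_hasDerivAt (fun θ _ => hderiv θ)]
  · have h1 : ipt (l * (z * Complex.exp ((-Real.pi : ℝ) * Complex.I))) = fun k => (-1) * ipt (l * z) k - 0 := by
      funext k
      have : Complex.exp ((-Real.pi : ℝ) * Complex.I) = -1 := by
        push_cast; rw [neg_mul, Complex.exp_neg, Complex.exp_pi_mul_I]; norm_num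
      rw [this, ipt, ipt, mul_neg_one, mul_neg, inv_neg, Odd.neg_pow ⟨k, rfl⟩]; ring
    have h0 : Complex.exp ((0 : ℝ) * Complex.I) = 1 := by simp
    rw [h1, h0, mul_one, dev_cons, dev_cons, cd_mul_sub]
    have : (cd fun _ => 0) f = 0 := by
      rw [cd_eq_sum _ f B hB]; simp
    rw [this, sub_zero, dev_C_mul]
    ring
  · apply Continuous.intervalIntegrable
    simp only [dev_cons, cd_eq_sum _ f B hB, map_sum, dev_C_mul, pt]
    have : ∀ θ : ℝ, l * (z * Complex.exp (θ * Complex.I)) ≠ 0 := fun θ => mul_ne_zero hl (hexp θ)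
    fun_prop (disch := assumption)

theorem multiInt_dev {l : ℂ} (hl : l ≠ 0) (f : Fock) (c : ℂ) {n : ℕ} (J : Multiset (ℕ → ℂ))
    {v : Fin n → ℂ} (hv : ∀ i, v i ≠ 0) :
    multiInt n (fun w => c * dev ((univ : Finset (Fin n)).val.map (fun i => pt (l * w i)) + J) f) v
      = c * (2 / l) ^ n * dev ((univ : Finset (Fin n)).val.map (fun i => ipt (l * v i)) + J) f := by
  induction n generalizing J with
  | zero => simp [multiInt]
  | succ n ih =>
    have h : ∀ ζ, multiInt n (fun w => c * dev ((univ : Finset (Fin (n + 1))).val.map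
        (fun i => pt (l * (Fin.cons ζ w : Fin (n + 1) → ℂ) i)) + J) f) (Fin.tail v)
        = c * (2 / l) ^ n * dev (pt (l * ζ) ::ₘ
          ((univ : Finset (Fin n)).val.map (fun i => ipt (l * Fin.tail v i)) + J)) f := by
      intro ζ
      simp only [univ_map_cons (fun z => pt (l * z)), Multiset.cons_add]
      simp only [← Multiset.add_cons]
      exact ih (pt (l * ζ) ::ₘ J) (fun i => hv _)
    rw [multiInt]
    simp only [h]
    rw [halfCircleInt_dz hl (hv 0), ← Multiset.cons_add, ← univ_map_cons (fun z => ipt (l * z)),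
      Fin.cons_self_tail]
    ring

theorem openF_eq {Φ : ℕ → Fock} (hΦ : IsFreeEnergy Φ) {a l : ℂ} (hal : 3 * a * l ^ 2 = 1)
    (g n : ℕ) (v : Fin n → ℂ) (hn : 1 ≤ n) (hgn : 3 ≤ 2 * g + n) (hv : ∀ i, v i ≠ 0) :
    openF a g n v = l ^ (5 * (2 * g + n - 2))
      * dev ((univ : Finset (Fin n)).val.map fun i => ipt (l * v i)) (Φ (2 * g + n - 2)) := by
  have hl : l ≠ 0 := by rintro rfl; simp at hal
  rw [openF, multiInt_congr hv (fun w hw => W_eq_wFormula hΦ hal g n w hn hgn hw)]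
  have := multiInt_dev hl (Φ (2 * g + n - 2)) (l ^ (5 * (2 * g + n - 2) + n)) (n := n) 0 hv
  simp only [add_zero] at this
  unfold wFormula
  rw [this, div_pow, pow_add]
  field_simp

/-- Restriction of a polynomial to a line through the origin. -/
def lineRestrict (c : ℕ → ℂ) : Fock →ₐ[ℂ] Polynomial ℂ :=
  aeval fun k => Polynomial.C (c k) * Polynomial.X

theorem derivative_lineRestrict (c : ℕ → ℂ) (f : Fock) :
    Polynomial.derivative (lineRestrict c f) = lineRestrict c (cd c f) := by
  induction f using MvPolynomial.induction_on with
  | C a => rw [cd, derivation_C, map_zero, lineRestrict, algHom_C, ← Polynomial.C_eq_algebraMap,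
      Polynomial.derivative_C]
  | add p q hp hq => simp only [map_add, hp, hq]
  | mul_X p i hp =>
    rw [map_mul, Polynomial.derivative_mul, hp, Derivation.leibniz, cd_X]
    simp only [smul_eq_mul, map_add, map_mul]
    have h1 : lineRestrict c (X i) = Polynomial.C (c i) * Polynomial.X := aeval_X _ _
    have h2 : lineRestrict c (C (c i)) = Polynomial.C (c i) := by
      rw [lineRestrict, algHom_C, ← Polynomial.C_eq_algebraMap]
    rw [h1, h2, Polynomial.derivative_C_mul_X]
    ring

theorem coeff_lineRestrict (c : ℕ → ℂ) (f : Fock) (n : ℕ) :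
    (lineRestrict c f).coeff n * n.factorial = dev (Multiset.replicate n c) f := by
  induction n generalizing f with
  | zero =>
    simp only [Nat.factorial_zero, Nat.cast_one, mul_one, Multiset.replicate_zero, dev_apply, dJ_zero]
    rw [Polynomial.coeff_zero_eq_eval_zero]
    induction f using MvPolynomial.induction_on with
    | C a => simp [lineRestrict]
    | add p q hp hq => simp only [map_add, Polynomial.eval_add, hp, hq]
    | mul_X p i hp => simp [lineRestrict]
  | succ n ih =>
    rw [Multiset.replicate_succ, dev_cons, ← ih, ← derivative_lineRestrict, Polynomial.coeff_derivative,
      Nat.factorial_succ]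
    push_cast; ring

theorem exists_taylor (c : ℕ → ℂ) (f : Fock) : ∃ B, ∀ M, B ≤ M →
    ∑ n ∈ range M, dev (Multiset.replicate n c) f / n.factorial = eval c f := by
  refine ⟨(lineRestrict c f).natDegree + 1, fun M hM => ?_⟩
  have h : ∀ g : Fock, eval c g = (lineRestrict c g).eval 1 := by
    intro g
    induction g using MvPolynomial.induction_on with
    | C a => simp [lineRestrict]
    | add p q hp hq => simp only [map_add, Polynomial.eval_add, hp, hq]
    | mul_X p i hp => simp [hp, lineRestrict]
  rw [h, Polynomial.eval_eq_sum_range' (show (lineRestrict c f).natDegree < M from hM)]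
  refine sum_congr rfl fun n _ => ?_
  rw [← coeff_lineRestrict, one_pow, mul_one]
  exact mul_div_cancel_right₀ _ (Nat.cast_ne_zero.2 (Nat.factorial_ne_zero n))

/-- The sum over (g, n) with weights 1/n! is the Taylor expansion of one polynomial; the orders n
that are not of the form m + 3 - 2g do not contribute by `dev_eq_zero`, and n = 0 does not because
of the normalization of the constant term. -/
theorem S_eq {Φ : ℕ → Fock} (hΦ : IsFreeEnergy Φ) {q₀ : ℂ → ℂ} {z ℓ : ℂ → ℂ → ℂ} {x t l : ℂ}
    (hal : 3 * q₀ t * l ^ 2 = 1) (hz : z x t ≠ 0) (m : ℕ) :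
    S q₀ z ℓ (m + 2) x t = l ^ (5 * (m + 1)) * eval (ipt (l * z x t)) (Φ (m + 1)) := by
  obtain ⟨B, hB⟩ := exists_taylor (ipt (l * z x t)) (Φ (m + 1))
  rw [← hB (B + (m + 4)) (by omega), mul_sum, S]
  refine sum_of_injOn (fun gn => gn.2) ?_ ?_ ?_ ?_
  · intro p hp q hq h
    simp only [coe_filter, Set.mem_ofPred_eq] at hp hq h
    exact Prod.ext (by omega) h
  · intro p hp
    simp only [coe_filter, Set.mem_ofPred_eq, mem_product, mem_range] at hp
    simp only [coe_range, Set.mem_Iio]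
    omega
  · intro n _ hn
    have : dev (Multiset.replicate n (ipt (l * z x t))) (Φ (m + 1)) = 0 := by
      rcases Nat.eq_zero_or_pos n with rfl | hpos
      · exact hΦ.const _
      · apply dev_eq_zero hΦ.zero hΦ.const hΦ.recursion
        rintro ⟨g, hg⟩
        rw [Multiset.card_replicate] at hg
        refine hn ⟨(g, n), ?_, rfl⟩
        simp only [coe_filter, Set.mem_ofPred_eq, mem_product, mem_range]
        omega
    rw [this, zero_div, mul_zero]
  · intro p hp
    simp only [mem_filter] at hp
    rw [openF_eq hΦ hal _ _ _ hp.2.1 (by omega) (fun _ => hz), show 2 * p.1 + p.2 - 2 = m + 1 by omega,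
      Multiset.map_const', card_val, card_univ, Fintype.card_fin, mul_div_assoc]
end PainleveOne
end

/-! ### Laurent polynomials and the diagonal specialization of the loop equation. -/

noncomputable section
namespace PainleveOne
open Finset Filter
open scoped Topology

/-- Laurent polynomials in the uniformizing coordinate `z`. -/
abbrev Lau := LaurentPolynomial ℂ

open LaurentPolynomial

/-- The derivative of Laurent polynomials, as a linear map. -/
def lauDerivLin : Lau →ₗ[ℂ] Lau where
  toFun f := f.coeff.sum fun n a => C (a * n) * T (n - 1)
  map_add' f g := by
    rw [AddMonoidAlgebra.coeff_add, Finsupp.sum_add_index']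
    · intro n; simp
    · intro n a b; rw [add_mul, map_add C, add_mul]
  map_smul' r f := by
    rw [AddMonoidAlgebra.coeff_smul, Finsupp.sum_smul_index', RingHom.id_apply, Finsupp.smul_sum]
    · refine Finsupp.sum_congr fun n _ => ?_
      rw [LaurentPolynomial.smul_eq_C_mul, smul_eq_mul, mul_assoc r, map_mul C, mul_assoc]
    · intro n; simp

theorem lauDerivLin_C_mul_T (a : ℂ) (n : ℤ) : lauDerivLin (C a * T n) = C (a * n) * T (n - 1) := by
  have : (C a * T n : Lau).coeff = Finsupp.single n a := by
    rw [← single_eq_C_mul_T]; rfl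
  change (C a * T n : Lau).coeff.sum (fun n a => (C (a * n) * T (n - 1) : Lau)) = _
  rw [this, Finsupp.sum_single_index]
  simp

/-- The derivation `d/dz` of Laurent polynomials. -/
def lauDeriv : Derivation ℂ Lau Lau := Derivation.mk' lauDerivLin fun f g => by
  simp only [smul_eq_mul]
  induction f using LaurentPolynomial.induction_on' with
  | add p q hp hq => rw [add_mul, map_add, hp, hq, map_add]; ring
  | C_mul_T n a =>
    induction g using LaurentPolynomial.induction_on' with
    | add p q hp hq => rw [mul_add, map_add, hp, hq, map_add]; ring
    | C_mul_T m b =>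
      have h : ∀ (a b : ℂ) (n m : ℤ), (C a * T n : Lau) * (C b * T m) = C (a * b) * T (n + m) := by
        intro a b n m; rw [T_add, map_mul C]; ring
      rw [h, lauDerivLin_C_mul_T, lauDerivLin_C_mul_T, lauDerivLin_C_mul_T, h, h,
        show n + (m - 1) = n + m - 1 by ring, show m + (n - 1) = n + m - 1 by ring, ← add_mul,
        ← map_add C]
      congr 2; push_cast; ring

theorem lauDeriv_C_mul_T (a : ℂ) (n : ℤ) : lauDeriv (C a * T n) = C (a * n) * T (n - 1) :=
  lauDerivLin_C_mul_T a n

theorem lauDeriv_T (n : ℤ) : lauDeriv (T n) = C (n : ℂ) * T (n - 1) := by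
  simpa using lauDeriv_C_mul_T 1 n

theorem lauDeriv_C (a : ℂ) : lauDeriv (C a) = 0 := by
  simpa using lauDeriv_C_mul_T a 0

/-- Evaluation of a Laurent polynomial at a nonzero point. -/
def levHom {ζ : ℂ} (h : ζ ≠ 0) : Lau →+* ℂ := LaurentPolynomial.eval₂ (RingHom.id ℂ) (Units.mk0 ζ h)

@[simp] theorem levHom_C {ζ : ℂ} (h : ζ ≠ 0) (a : ℂ) : levHom h (C a) = a := by simp [levHom]

@[simp] theorem levHom_T {ζ : ℂ} (h : ζ ≠ 0) (n : ℤ) : levHom h (T n) = ζ ^ n := by simp [levHom]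

open Classical in
/-- The function on `ℂ` that is given by a Laurent polynomial. -/
def lev (F : Lau) (ζ : ℂ) : ℂ := if h : ζ ≠ 0 then levHom h F else 0

theorem lev_eq (F : Lau) {ζ : ℂ} (h : ζ ≠ 0) : lev F ζ = levHom h F := dif_pos h

theorem hasDerivAt_lev (F : Lau) {ζ : ℂ} (h : ζ ≠ 0) : HasDerivAt (lev F) (lev (lauDeriv F) ζ) ζ := by
  induction F using LaurentPolynomial.induction_on' with
  | add p q hp hq =>
    have := hp.add hq
    rw [map_add, show lev (lauDeriv p + lauDeriv q) ζ = lev (lauDeriv p) ζ + lev (lauDeriv q) ζ by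
      simp only [lev_eq _ h, map_add]]
    refine this.congr_of_eventuallyEq ?_
    filter_upwards [isOpen_ne.mem_nhds h] with w hw
    have hw : w ≠ 0 := hw
    simp only [Pi.add_apply, lev_eq _ hw, map_add]
  | C_mul_T n a =>
    have := (hasDerivAt_zpow n ζ (Or.inl h)).const_mul a
    rw [lauDeriv_C_mul_T, lev_eq _ h, map_mul, levHom_C, levHom_T, mul_assoc]
    refine this.congr_of_eventuallyEq ?_
    filter_upwards [isOpen_ne.mem_nhds h] with w hw
    have hw : w ≠ 0 := hw
    simp [lev_eq _ hw]

theorem lau_eq_zero {F : Lau} (h : ∀ ζ (hζ : ζ ≠ 0), levHom hζ F = 0) : F = 0 := by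
  obtain ⟨n, p, hp⟩ := LaurentPolynomial.exists_T_pow F
  have hp0 : p = 0 := by
    by_contra hne
    have hfin := (p.roots.toFinset.finite_toSet)
    have hsub : {ζ : ℂ | ζ ≠ 0} ⊆ p.roots.toFinset := by
      intro ζ hζ
      have hζ : ζ ≠ 0 := hζ
      have h1 := congrArg (levHom hζ) hp
      rw [map_mul, h ζ hζ, zero_mul, levHom, LaurentPolynomial.eval₂_toLaurent] at h1
      rw [mem_coe, Multiset.mem_toFinset, Polynomial.mem_roots hne, Polynomial.IsRoot, ← h1,
        Units.val_mk0, Polynomial.eval₂_id]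
    have : (Set.univ : Set ℂ).Finite := by
      refine ((hfin.subset hsub).union (Set.finite_singleton 0)).subset fun ζ _ => ?_
      by_cases hζ : ζ = 0
      · right; exact hζ
      · left; exact hζ
    exact Set.infinite_univ this
  rw [hp0, map_zero] at hp
  exact (LaurentPolynomial.isUnit_T (n : ℤ)).mul_left_eq_zero.1 hp.symm

/-- The diagonal specialization, as an algebra homomorphism into Laurent polynomials. -/
def diag : Fock →ₐ[ℂ] Lau :=
  MvPolynomial.aeval fun k : ℕ => C (-1 / (2 * (k : ℂ) + 1)) * T (-(2 * (k : ℤ) + 1))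

theorem zpow_neg_odd (ζ : ℂ) (k : ℕ) : ζ ^ (-(2 * (k : ℤ) + 1)) = ζ⁻¹ ^ (2 * k + 1) := by
  rw [zpow_neg, ← inv_zpow, show (2 * (k : ℤ) + 1) = ((2 * k + 1 : ℕ) : ℤ) by push_cast; ring,
    zpow_natCast]

theorem levHom_diag {ζ : ℂ} (h : ζ ≠ 0) (f : Fock) :
    levHom h (diag f) = MvPolynomial.eval (ipt ζ) f := by
  induction f using MvPolynomial.induction_on with
  | C a => simp [diag, ← LaurentPolynomial.C_eq_algebraMap]
  | add p q hp hq => rw [map_add, map_add, map_add, hp, hq]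
  | mul_X p i hp =>
    rw [map_mul, map_mul, hp, map_mul, MvPolynomial.eval_X, diag, MvPolynomial.aeval_X, map_mul,
      levHom_C, levHom_T, zpow_neg_odd, ipt]
    ring

theorem levHom_diag_X {ζ : ℂ} (h : ζ ≠ 0) (i : ℕ) :
    levHom h (lauDeriv (diag (MvPolynomial.X i))) = pt ζ i ∧
    levHom h (lauDeriv (lauDeriv (diag (MvPolynomial.X i)))) = -(2 * i + 2) * ζ⁻¹ ^ (2 * i + 3) := by
  have h2 : (2 * (i : ℂ) + 1) ≠ 0 := by exact_mod_cast Nat.succ_ne_zero (2 * i)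
  rw [diag, MvPolynomial.aeval_X, lauDeriv_C_mul_T, lauDeriv_C_mul_T]
  simp only [map_mul, levHom_C, levHom_T]
  constructor
  · rw [show -(2 * (i : ℤ) + 1) - 1 = -((2 * i + 2 : ℕ) : ℤ) by push_cast; ring, zpow_neg, zpow_natCast,
      ← inv_pow, pt]
    push_cast
    field_simp
  · rw [show -(2 * (i : ℤ) + 1) - 1 - 1 = -((2 * i + 3 : ℕ) : ℤ) by push_cast; ring, zpow_neg,
      zpow_natCast, ← inv_pow]
    push_cast
    field_simp
    ring

theorem levHom_deriv_diag {ζ : ℂ} (h : ζ ≠ 0) (f : Fock) :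
    levHom h (lauDeriv (diag f)) = MvPolynomial.eval (ipt ζ) (dz ζ f) := by
  induction f using MvPolynomial.induction_on with
  | C a =>
    rw [diag, MvPolynomial.algHom_C, ← LaurentPolynomial.C_eq_algebraMap, lauDeriv_C, dz,
      MvPolynomial.derivation_C, map_zero, map_zero]
  | add p q hp hq => simp only [map_add, hp, hq]
  | mul_X p i hp =>
    rw [map_mul, Derivation.leibniz, Derivation.leibniz, dz_eq_cd_pt, cd_X, ← dz_eq_cd_pt]
    simp only [smul_eq_mul, map_add, map_mul, hp, levHom_diag h, (levHom_diag_X h i).1,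
      MvPolynomial.eval_C]

/-- Chain rule along the curve ζ ↦ `ipt ζ`, with velocity `pt ζ`: a Hessian term, and the gradient
paired with the acceleration. -/
theorem levHom_deriv_deriv_diag {ζ : ℂ} (h : ζ ≠ 0) (f : Fock) :
    levHom h (lauDeriv (lauDeriv (diag f))) = MvPolynomial.eval (ipt ζ) (dz ζ (dz ζ f))
      + MvPolynomial.eval (ipt ζ) (cd (fun k => -(2 * k + 2) * ζ⁻¹ ^ (2 * k + 3)) f) := by
  induction f using MvPolynomial.induction_on with
  | C a =>
    rw [diag, MvPolynomial.algHom_C, ← LaurentPolynomial.C_eq_algebraMap, lauDeriv_C, dz,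
      MvPolynomial.derivation_C, cd, MvPolynomial.derivation_C]
    simp
  | add p q hp hq => simp only [map_add, hp, hq]; ring
  | mul_X p i hp =>
    have e : dz ζ (MvPolynomial.X i) = MvPolynomial.C (pt ζ i) := by rw [dz_eq_cd_pt, cd_X]
    have e0 : dz ζ (MvPolynomial.C (pt ζ i)) = 0 := by rw [dz, MvPolynomial.derivation_C]
    simp only [map_mul, Derivation.leibniz, map_add, smul_eq_mul, hp, levHom_diag h,
      (levHom_diag_X h i).1, (levHom_diag_X h i).2, MvPolynomial.eval_C, e, e0, cd_X, levHom_deriv_diag h, map_zero]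
    ring

/-- Derivations that agree on the generators after evaluation agree after evaluation. -/
theorem eval_derivation_ext {c : ℕ → ℂ} {D E : Derivation ℂ Fock Fock}
    (h : ∀ j, MvPolynomial.eval c (D (MvPolynomial.X j)) = MvPolynomial.eval c (E (MvPolynomial.X j)))
    (f : Fock) : MvPolynomial.eval c (D f) = MvPolynomial.eval c (E f) := by
  induction f using MvPolynomial.induction_on with
  | C a => rw [MvPolynomial.derivation_C, MvPolynomial.derivation_C]
  | add p q hp hq => simp only [map_add, hp, hq]
  | mul_X p i hp => simp only [Derivation.leibniz, map_add, smul_eq_mul, map_mul, hp, h]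

theorem two_mul_add_one_mul_ipt (ζ : ℂ) (k : ℕ) : (2 * (k : ℂ) + 1) * ipt ζ k = -ζ⁻¹ ^ (2 * k + 1) := by
  have h2 : (2 * (k : ℂ) + 1) ≠ 0 := by exact_mod_cast Nat.succ_ne_zero (2 * k)
  rw [ipt]; field_simp

/-- On the diagonal (2i+1)xᵢ = -ζ⁻²ⁱ⁻¹, so each of the j + 2 terms for the variable of index j
equals -ζ⁻²ʲ⁻³. Writing 2(j + 2) as (2j + 2) + 2 separates the acceleration of the curve from a
multiple of its velocity. -/
theorem eval_ez {ζ : ℂ} (h : ζ ≠ 0) (f : Fock) :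
    2 * MvPolynomial.eval (ipt ζ) (ez ζ f)
      = MvPolynomial.eval (ipt ζ) (cd (fun k => -(2 * k + 2) * ζ⁻¹ ^ (2 * k + 3)) f)
        - 2 / ζ * MvPolynomial.eval (ipt ζ) (dz ζ f) := by
  have := eval_derivation_ext (c := ipt ζ) (D := (2 : ℂ) • ez ζ)
    (E := cd (fun k => -(2 * k + 2) * ζ⁻¹ ^ (2 * k + 3)) - (2 / ζ) • dz ζ) (fun j => by
      rw [Derivation.smul_apply, Derivation.sub_apply, Derivation.smul_apply, cd_X, dz_eq_cd_pt, cd_X,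
        ez, MvPolynomial.mkDerivation_X, MvPolynomial.smul_eval, map_sub, MvPolynomial.smul_eval,
        MvPolynomial.eval_C, MvPolynomial.eval_C, map_sum]
      have : ∀ k ∈ range (j + 2), MvPolynomial.eval (ipt ζ)
          (MvPolynomial.C (ζ⁻¹ ^ (2 * k)) * vir k (MvPolynomial.X j)) = -ζ⁻¹ ^ (2 * j + 3) := by
        intro k hk
        have hk := mem_range.1 hk
        rw [map_mul, MvPolynomial.eval_C, vir, MvPolynomial.mkDerivation_X, if_pos (by omega), map_mul,
          MvPolynomial.eval_C, MvPolynomial.eval_X, two_mul_add_one_mul_ipt, mul_neg, ← pow_add]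
        congr 2; omega
      rw [sum_congr rfl this, sum_const, card_range, nsmul_eq_mul, pt]
      push_cast
      rw [pow_succ _ (2 * j + 2)]
      field_simp
      ring) f
  rw [Derivation.smul_apply, Derivation.sub_apply, Derivation.smul_apply, MvPolynomial.smul_eval, map_sub,
    MvPolynomial.smul_eval] at this
  exact this

theorem eval_vir_zero {ζ : ℂ} (f : Fock) :
    MvPolynomial.eval (ipt ζ) (vir 0 f) = -ζ⁻¹ * MvPolynomial.eval (ipt ζ) (dz ζ f) := by
  have := eval_derivation_ext (c := ipt ζ) (D := vir 0) (E := (-ζ⁻¹) • dz ζ) (fun j => by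
      rw [Derivation.smul_apply, dz_eq_cd_pt, cd_X, vir, MvPolynomial.mkDerivation_X, if_pos (by omega),
        MvPolynomial.smul_eval, MvPolynomial.eval_C, map_mul, MvPolynomial.eval_C, MvPolynomial.eval_X,
        two_mul_add_one_mul_ipt, pt, Nat.sub_zero]
      ring) f
  rwa [Derivation.smul_apply, MvPolynomial.smul_eval] at this

theorem eval_eu {ζ : ℂ} (h : ζ ≠ 0) (f : Fock) :
    MvPolynomial.eval (ipt ζ) (eu f) = -ζ * MvPolynomial.eval (ipt ζ) (dz ζ f) := by
  have := eval_derivation_ext (c := ipt ζ) (D := eu) (E := (-ζ) • dz ζ) (fun j => by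
      rw [Derivation.smul_apply, dz_eq_cd_pt, cd_X, eu, MvPolynomial.mkDerivation_X,
        MvPolynomial.smul_eval, MvPolynomial.eval_C, map_mul, MvPolynomial.eval_C, MvPolynomial.eval_X,
        two_mul_add_one_mul_ipt, pt]
      rw [pow_succ _ (2 * j + 1)]
      field_simp) f
  rwa [Derivation.smul_apply, MvPolynomial.smul_eval] at this

/-- After specialization the only term that is not a ζ-derivative is ∂₀Φ. The constraint k = 0
replaces it by ∂₁Φ, and the variation identity replaces that by the scaling derivative and the
constants c n; this explains the multiples 8ζ² and 3ζ² in the combination. -/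
theorem diagonal_equation {Φ : ℕ → Fock} (hΦ : IsFreeEnergy Φ) {c : ℕ → ℂ}
    (hc : ∀ n : ℕ, eu (Φ n) - MvPolynomial.C (5 * (n : ℂ)) * Φ n
      + MvPolynomial.C (8 / 3) * MvPolynomial.pderiv 1 (Φ (n + 1)) = MvPolynomial.C (c n)) (n : ℕ) :
    (C 8 : Lau) * (T 4 - T 2) * lauDeriv (diag (Φ (n + 1))) + lauDeriv (lauDeriv (diag (Φ n)))
      + ∑ p ∈ antidiagonal n, lauDeriv (diag (Φ p.1)) * lauDeriv (diag (Φ p.2))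
      - C 2 * T (-1) * lauDeriv (diag (Φ n)) - (C 3 * T 3 - C 2 * T 1) * lauDeriv (diag (Φ n))
      - (C (15 * (n : ℂ)) : Lau) * T 2 * diag (Φ n) + (if n = 0 then (C (5 / 4) : Lau) * T (-2) - 1 else 0)
      - (C (3 * c n) : Lau) * T 2 = 0 := by
  apply lau_eq_zero
  intro ζ hζ
  have h1 := congrArg (MvPolynomial.eval (ipt ζ)) (loop_equation hΦ.recursion n hζ)
  have h2 := congrArg (MvPolynomial.eval (ipt ζ)) (hc n)
  have h3 := congrArg (MvPolynomial.eval (ipt ζ)) (hΦ.recursion n 0)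
  rw [dd_apply] at h3
  have e2 : MvPolynomial.eval (ipt ζ) (2 : Fock) = 2 := map_ofNat _ 2
  have e8 : MvPolynomial.eval (ipt ζ) (8 : Fock) = 8 := map_ofNat _ 8
  simp only [map_add, map_sub, map_mul, map_sum, MvPolynomial.eval_C, e2, e8, eval_ez hζ] at h1
  simp only [map_add, map_sub, map_mul, MvPolynomial.eval_C, eval_eu hζ] at h2
  simp only [map_add, map_sub, map_mul, MvPolynomial.eval_C, e2, eval_vir_zero, quad, Nat.zero_sub,
    range_zero, sum_empty, sum_const_zero, add_zero] at h3
  simp only [map_add, map_sub, map_mul, map_sum, levHom_C, levHom_T, levHom_deriv_deriv_diag hζ,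
    levHom_deriv_diag hζ, levHom_diag hζ]
  have ez4 : ζ ^ (4 : ℤ) = ζ ^ 4 := by norm_cast
  have ez3 : ζ ^ (3 : ℤ) = ζ ^ 3 := by norm_cast
  have ez2 : ζ ^ (2 : ℤ) = ζ ^ 2 := by norm_cast
  have em2 : ζ ^ (-2 : ℤ) = ζ⁻¹ ^ 2 := by rw [zpow_neg, ez2, inv_pow]
  by_cases h0 : n = 0
  · subst h0
    have hx : ipt ζ 0 = -ζ⁻¹ := by simp [ipt]
    simp only [if_true, map_add, map_sub, map_mul, map_pow, MvPolynomial.eval_C, MvPolynomial.eval_X, levHom_C,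
      levHom_T, map_one, map_zero, anom, hx, zero_add, ez4, ez3, ez2, zpow_neg_one, zpow_one, em2] at h1 h2 h3 ⊢
    push_cast at h1 h2 h3 ⊢
    have hi : ζ * ζ⁻¹ = 1 := mul_inv_cancel₀ hζ
    linear_combination h1 + 8 * ζ ^ 2 * h3 + 3 * ζ ^ 2 * h2 - 2 * ζ * MvPolynomial.eval (ipt ζ) (dz ζ (Φ 0)) * hi + (ζ * ζ⁻¹ + 1) * hi
  · simp only [if_neg h0, map_zero, ez4, ez3, ez2, zpow_neg_one, zpow_one] at h1 h2 h3 ⊢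
    have hi : ζ * ζ⁻¹ = 1 := mul_inv_cancel₀ hζ
    linear_combination h1 + 8 * ζ ^ 2 * h3 + 3 * ζ ^ 2 * h2 - 2 * ζ * MvPolynomial.eval (ipt ζ) (dz ζ (Φ n)) * hi
end PainleveOne
end

/-! ### The linear equation for the residual of the evolution equation. -/

noncomputable section
namespace PainleveOne
open Finset

/-- Derivations of a commutative ring. -/
structure RingDer (A : Type*) [CommRing A] extends A →+ A where
  leibniz' : ∀ a b, toFun (a * b) = a * toFun b + b * toFun a

namespace RingDer
variable {A : Type*} [CommRing A]

instance : FunLike (RingDer A) A A where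
  coe D := D.toFun
  coe_injective D E h := by
    obtain ⟨⟨⟨f, _⟩, _⟩, _⟩ := D; obtain ⟨⟨⟨g, _⟩, _⟩, _⟩ := E; congr

instance : AddMonoidHomClass (RingDer A) A A where
  map_add D := D.map_add'
  map_zero D := D.map_zero'

theorem leibniz (D : RingDer A) (a b : A) : D (a * b) = a * D b + b * D a := D.leibniz' a b

theorem leibniz_pow (D : RingDer A) (a : A) (n : ℕ) : D (a ^ n) = n * a ^ (n - 1) * D a := by
  induction n with
  | zero =>
    have := D.leibniz 1 1
    simp at this
    simp [this]
  | succ n ih =>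
    rw [pow_succ, leibniz, ih]
    rcases n with _ | n
    · simp
    · simp only [Nat.add_sub_cancel]; push_cast; ring

theorem map_natCast (D : RingDer A) (n : ℕ) : D n = 0 := by
  have h1 : D 1 = 0 := by simpa using D.leibniz_pow 1 0
  induction n with
  | zero => simp
  | succ n ih => rw [Nat.cast_succ, map_add, ih, h1, add_zero]

end RingDer

/-- The residual `2(u - Q) T - Y + p` of the evolution equation satisfies a linear equation with
inhomogeneity given by the residuals of the Painlevé equation and of the Hamiltonian. -/
theorem residual_identity {A : Type*} [CommRing A] (d θ : RingDer A)
    {κ Y T u Q s p r h R : A} (hR : R = (u - Q) * T + (u - Q) * T - Y + p)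
    (dκ : d κ = 0) (du : d u = 2) (dQ : d Q = 0) (dp : d p = 0) (dh : d h = 0)
    (θκ : θ κ = 15 * κ) (θu : θ u = 6 * u - 4) (θQ : θ Q = 6 * Q - 4 + 8 * s)
    (θp : θ p = 9 * p + 8 * r) (θh : θ h = 18 * h + 8 - 8 * Q) (hs : κ * s = p)
    (hT : 4 * d T = θ Y - 9 * Y) (hcomm : d (θ Y) = θ (d Y) + 6 * d Y)
    (hY : κ * d Y + 2 * Y ^ 2 - 4 * (κ * T) = 8 * u ^ 3 - 16 * u ^ 2 + 8 * u + 4 * h) :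
    2 * ((u - Q) * (κ * d (d R) + 4 * Y * d R - κ * (θ R - 9 * R)) - 4 * κ * d R - 8 * Y * R - 8 * p * R)
      = 16 * ((6 * Q ^ 2 - 8 * Q + 2 - κ * r) * u
        + (2 * h - 2 * Q ^ 3 + 2 * Q + κ * r * Q - p ^ 2)) := by
  -- In the application μ² = 3q₀, κ = ħ/μ⁵, Y = ħS_x/μ³, T = ħS_t/μ, d = 2μ²∂_x and θ = 8μ⁴∂_t.
  -- Since 8μ³μ' = -3, a division by μᵏ adds 3k to the weight under θ; hence 6 for u and Q, 9 for Y
  -- and p, 15 for κ, 18 for h.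
  have hn : ∀ n : ℕ, [n.AtLeastTwo] → d (OfNat.ofNat n : A) = 0 := fun n _ => d.map_natCast n
  have hn' : ∀ n : ℕ, [n.AtLeastTwo] → θ (OfNat.ofNat n : A) = 0 := fun n _ => θ.map_natCast n
  have d1 : d R = 4 * T + 2 * (u - Q) * d T - d Y := by
    rw [hR]
    simp only [map_add, map_sub, RingDer.leibniz, du, dQ, dp]; ring
  have d2 : d (d R) = 8 * d T + 2 * (u - Q) * d (d T) - d (d Y) := by
    rw [d1]
    simp only [map_add, map_sub, RingDer.leibniz, du, dQ, hn]; ring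
  have t1 : θ R = 2 * (6 * u - 6 * Q - 8 * s) * T + 2 * (u - Q) * θ T - θ Y + 9 * p + 8 * r := by
    rw [hR]
    simp only [map_add, map_sub, RingDer.leibniz, θu, θQ, θp]; ring
  have hdT := congrArg d hT
  simp only [map_sub, RingDer.leibniz, hn] at hdT
  have hdY := congrArg d hY
  simp only [map_add, map_sub, RingDer.leibniz, RingDer.leibniz_pow, hn, dκ, du, dh,
    Nat.add_one_sub_one] at hdY
  have hθY := congrArg θ hY
  simp only [map_add, map_sub, RingDer.leibniz, RingDer.leibniz_pow, hn', θκ, θu, θh,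
    Nat.add_one_sub_one] at hθY
  push_cast at hdY hθY
  rw [d2, d1, t1, hR]
  linear_combination (u - Q) ^ 2 * (hθY - 18 * hY) - 2 * (u - Q) * hdY + 8 * hY
    + κ * (u - Q) ^ 2 * hdT + κ * (u - Q) ^ 2 * hcomm + 4 * Y * (u - Q) ^ 2 * hT - 2 * κ * (u - Q) * hT
    + 32 * (u - Q) * T * hs

/-- The action of a derivation on power series, with weight `k` for the indeterminate. -/
def psDeriv {R : Type*} [CommRing R] (D : RingDer R) (k : ℕ) : RingDer (PowerSeries R) where
  toFun F := PowerSeries.mk fun n => D (PowerSeries.coeff n F) + (k * n) • PowerSeries.coeff n F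
  map_zero' := by ext1 n; simp
  map_add' F G := by
    ext1 n; simp only [PowerSeries.coeff_mk, map_add, smul_add]; abel
  leibniz' F G := by
    ext1 n
    simp only [PowerSeries.coeff_mk, map_add, PowerSeries.coeff_mul, map_sum, RingDer.leibniz]
    rw [← Finset.Nat.sum_antidiagonal_swap (n := n) (f := fun p => PowerSeries.coeff p.1 G * _), smul_sum,
      ← sum_add_distrib, ← sum_add_distrib]
    refine sum_congr rfl fun p hp => ?_
    rw [← HasAntidiagonal.mem_antidiagonal.1 hp]
    simp only [Prod.fst_swap, Prod.snd_swap, nsmul_eq_mul]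
    push_cast; ring

theorem coeff_psDeriv {R : Type*} [CommRing R] (D : RingDer R) (k : ℕ) (F : PowerSeries R) (n : ℕ) :
    PowerSeries.coeff n (psDeriv D k F)
      = D (PowerSeries.coeff n F) + (k * n) • PowerSeries.coeff n F := by
  change PowerSeries.coeff n (PowerSeries.mk fun n =>
    D (PowerSeries.coeff n F) + (k * n) • PowerSeries.coeff n F) = _
  exact PowerSeries.coeff_mk _ _

open LaurentPolynomial

theorem coeff_T_mul (m : ℤ) (F : Lau) (n : ℤ) : (T m * F).coeff n = F.coeff (n - m) := by
  rw [T, AddMonoidAlgebra.coeff_single_mul_apply, one_mul, neg_add_eq_sub]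

theorem coeff_C_mul (a : ℂ) (F : Lau) (n : ℤ) : (C a * F).coeff n = a * F.coeff n := by
  rw [← LaurentPolynomial.smul_eq_C_mul]; simp

theorem coeff_lauDeriv (F : Lau) (n : ℤ) : (lauDeriv F).coeff n = (n + 1) * F.coeff (n + 1) := by
  induction F using LaurentPolynomial.induction_on' with
  | add p q hp hq => simp only [map_add, AddMonoidAlgebra.coeff_add, Finsupp.add_apply, hp, hq]; ring
  | C_mul_T m a =>
    rw [lauDeriv_C_mul_T, coeff_C_mul, coeff_C_mul, T_apply, T_apply]
    by_cases h : m - 1 = n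
    · obtain rfl : m = n + 1 := by omega
      simp; ring
    · rw [if_neg (by omega), if_neg (by omega)]; simp

/-- A Laurent polynomial of degree at most one that solves the linearized equation vanishes. -/
theorem eq_zero_of_linearized {F : Lau} (hF : ∀ n : ℤ, 2 ≤ n → F.coeff n = 0) {e g : ℂ}
    (h : (T 2 - 1) * ((T 2 - 1) * lauDeriv F - C 2 * T 1 * F) = C e * T 2 + C g) :
    F = 0 ∧ e = 0 ∧ g = 0 := by
  -- Evaluation at ζ = 1, a zero of the left side.
  have heg : e + g = 0 := by
    have := congrArg (levHom one_ne_zero) h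
    simp at this
    exact this.symm
  obtain rfl : g = -e := by linear_combination heg
  have hT : (T 2 - 1 : Lau) ≠ 0 := by
    intro h0
    have := congrArg (fun F : Lau => F.coeff 2) h0
    simp [← LaurentPolynomial.T_zero] at this
  have h1 : (T 2 - 1) * lauDeriv F - C 2 * T 1 * F = C e := by
    apply mul_left_cancel₀ hT
    rw [h, map_neg]; ring
  have hc : ∀ n : ℤ, (n - 3) * F.coeff (n - 1) - (n + 1) * F.coeff (n + 1) = if n = 0 then e else 0 := by
    intro n
    have := congrArg (fun F : Lau => F.coeff n) h1
    simp only [sub_mul, one_mul, mul_assoc, AddMonoidAlgebra.coeff_sub, Finsupp.sub_apply, coeff_T_mul,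
      coeff_C_mul, coeff_lauDeriv, C_apply] at this
    rw [show n - 2 + 1 = n - 1 by ring] at this
    rw [← this]; push_cast; ring
  -- The homogeneous solution ζ² - 1 is excluded by the degree bound: `hc 2` and `hc 1` kill the
  -- coefficients of exponents 1 and 0. A lowest exponent N outside {0, 1} contradicts `hc (N - 1)`,
  -- in which only the coefficient of exponent N is left, with factor -N.
  have hF0 : F = 0 := by
    by_contra hne
    have hs : F.coeff.support.Nonempty := by
      rw [Finsupp.support_nonempty_iff]
      intro h0; apply hne; ext n; rw [h0]; rfl
    have hN := min'_mem _ hs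
    have hmin : ∀ n < F.coeff.support.min' hs, F.coeff n = 0 := fun n hn => by
      by_contra h0
      exact absurd (min'_le _ n (Finsupp.mem_support_iff.2 h0)) (not_le.2 hn)
    set N := F.coeff.support.min' hs
    have hN : F.coeff N ≠ 0 := Finsupp.mem_support_iff.1 hN
    have hN2 : N < 2 := by
      by_contra h2; exact hN (hF N (by omega))
    have r1 : F.coeff 1 = 0 := by
      have := hc 2
      rw [hF (2 + 1) (by norm_num)] at this
      norm_num at this; exact this
    have r0 : F.coeff 0 = 0 := by
      have := hc 1
      rw [hF (1 + 1) (by norm_num)] at this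
      norm_num at this; exact this
    have hN1 : N ≠ 1 := by rintro h; rw [h] at hN; exact hN r1
    have hN0 : N ≠ 0 := by rintro h; rw [h] at hN; exact hN r0
    have := hc (N - 1)
    rw [hmin (N - 1 - 1) (by omega), if_neg (by omega), sub_add_cancel] at this
    have h2 : (N : ℂ) * F.coeff N = 0 := by push_cast at this; linear_combination -this
    exact (mul_ne_zero (Int.cast_ne_zero.2 hN0) hN) h2
  have he : e = 0 := by
    have := hc 0
    rw [hF0] at this
    simpa using this.symm
  exact ⟨hF0, he, by rw [he, neg_zero]⟩
end PainleveOne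
end

/-! ### The Schrödinger equation in weighted form. -/

noncomputable section
namespace PainleveOne
open Finset

/-- The Schrödinger-type equation that follows from the diagonal specialization of the loop equations. -/
theorem schroedinger_identity {A : Type*} [CommRing A] (d θ : RingDer A)
    {κ t m e F G c Y T : A} (tm : t * m = 1) (he : 8 * e = 1)
    (dκ : d κ = 0) (dt : d t = m) (dm : d m = -m ^ 3) (de : d e = 0)
    (θκ : θ κ = 15 * κ) (θt : θ t = 3 * t - 2 * m) (θm : θ m = -3 * m + 2 * m ^ 3) (θe : θ e = 0)
    (hcomm : ∀ a, d (θ a) = θ (d a) + 6 * d a) (hF : F = κ * G)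
    (hdiag : 8 * (t ^ 3 - t) * d G + d (d F) + d F ^ 2 - m ^ 2 * d F - θ F
      + 10 * e * m ^ 4 - m ^ 2 - 24 * e * c = 0)
    (hY : Y = 2 * (t ^ 3 - t) + κ * (4 * e * d F - 2 * e * m ^ 2))
    (hT : T = t + κ * (e * θ F + e * m ^ 2)) :
    4 * d T = θ Y - 9 * Y ∧ κ * d Y + 2 * Y ^ 2 - 4 * (κ * T)
      = 8 * (t ^ 2) ^ 3 - 16 * (t ^ 2) ^ 2 + 8 * t ^ 2 + 4 * (κ ^ 2 * (3 * e * c)) := by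
  have hn : ∀ n : ℕ, [n.AtLeastTwo] → d (OfNat.ofNat n : A) = 0 := fun n _ => d.map_natCast n
  have hn' : ∀ n : ℕ, [n.AtLeastTwo] → θ (OfNat.ofNat n : A) = 0 := fun n _ => θ.map_natCast n
  have h1 := hcomm F
  have hdF : d F = κ * d G := by rw [hF, RingDer.leibniz, dκ]; simp
  have dY : d Y = 2 * (3 * t - m) + κ * (4 * e * d (d F) + 4 * e * m ^ 4) := by
    rw [hY]
    simp only [map_add, map_sub, RingDer.leibniz, RingDer.leibniz_pow, hn, dκ, dt, dm, de]
    push_cast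
    linear_combination (6 * t) * tm
  have dT : d T = m + κ * (e * d (θ F) - 2 * e * m ^ 4) := by
    rw [hT]
    simp only [map_add, RingDer.leibniz, RingDer.leibniz_pow, dκ, dt, dm, de]
    push_cast
    ring
  have θY : θ Y = 18 * t ^ 3 - 18 * t + 4 * m + 15 * (κ * (4 * e * d F - 2 * e * m ^ 2))
      + κ * (4 * e * θ (d F) + 12 * e * m ^ 2 - 8 * e * m ^ 4) := by
    rw [hY]
    simp only [map_add, map_sub, RingDer.leibniz, RingDer.leibniz_pow, hn', θκ, θt, θm, θe]
    push_cast
    linear_combination (-12 * t) * tm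
  -- The first identity is the equality of the mixed derivatives of S; the second is the diagonal
  -- equation rewritten in Y and T, where the potential absorbs the square of the leading term of Y.
  constructor
  · rw [dT, θY, hY, h1]
    ring
  · rw [dY, hY, hT]
    generalize d (d F) = F2 at *
    generalize θ F = F3 at *
    generalize d F = F1 at *
    generalize d G = G1 at *
    linear_combination 4 * e * κ ^ 2 * hdiag + 32 * e * κ * (t ^ 3 - t) * hdF
      + (-2 * κ * t + 2 * κ * m - 4 * e * κ ^ 2 * m ^ 2 * F1 - 4 * e * κ ^ 2 * m ^ 4
        + 4 * e * κ ^ 2 * F1 ^ 2 + 12 * e * κ ^ 2 * c) * he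
      + (16 * e * κ * m - 16 * e * κ * t * (t * m + 1)) * tm
end PainleveOne
end

/-! ### Power series with Laurent polynomial coefficients and the derivations along x and t. -/

noncomputable section
namespace PainleveOne
open Finset LaurentPolynomial

/-- A multiple of `d/dz`, as a derivation of the ring of Laurent polynomials. -/
def mulDeriv (a : Lau) : RingDer Lau where
  toFun f := a * lauDeriv f
  map_zero' := by rw [map_zero, mul_zero]
  map_add' f g := by rw [map_add, mul_add]
  leibniz' f g := by rw [Derivation.leibniz, smul_eq_mul, smul_eq_mul]; ring

/-- The derivation `z⁻¹ d/dz`, which is `2 ∂/∂x`. -/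
def dLau : RingDer Lau := mulDeriv (T (-1))

/-- The derivation `(3z - 2z⁻¹) d/dz`, the part of `8 ∂/∂t` that acts on `z`. -/
def thLau : RingDer Lau := mulDeriv (3 * T 1 - 2 * T (-1))

theorem dLau_apply (f : Lau) : dLau f = T (-1) * lauDeriv f := rfl

theorem thLau_apply (f : Lau) : thLau f = (3 * T 1 - 2 * T (-1)) * lauDeriv f := rfl

/-- Power series in the weighted parameter, with Laurent polynomials as coefficients. -/
abbrev LauS := PowerSeries Lau

/-- The coefficientwise action of `dLau`. -/
def dS : RingDer LauS := psDeriv dLau 0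

/-- The derivation `8 ∂/∂t` for series of weight zero. -/
def thS : RingDer LauS := psDeriv thLau 15

theorem coeff_dS (F : LauS) (n : ℕ) : PowerSeries.coeff n (dS F) = dLau (PowerSeries.coeff n F) := by
  rw [dS, coeff_psDeriv, zero_mul, zero_smul, add_zero]

theorem coeff_thS (F : LauS) (n : ℕ) : PowerSeries.coeff n (thS F)
    = thLau (PowerSeries.coeff n F) + (15 * n) • PowerSeries.coeff n F := coeff_psDeriv _ _ _ _

theorem T_one_mul_T_neg_one : (T 1 : Lau) * T (-1) = 1 := by
  rw [← T_add]; simp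

theorem lauDeriv_T_one : lauDeriv (T 1) = 1 := by
  rw [lauDeriv_T]; simp

theorem lauDeriv_T_neg_one : lauDeriv (T (-1)) = -T (-1) ^ 2 := by
  rw [lauDeriv_T, T_pow]; simp

/-- The derivatives along x and t commute; the 6 comes from the factor μ² that normalizes the
x-derivative. -/
theorem dLau_thLau (f : Lau) : dLau (thLau f) = thLau (dLau f) + 6 * dLau f := by
  have h2 : lauDeriv (2 : Lau) = 0 := lauDeriv.map_natCast 2
  have h3 : lauDeriv (3 : Lau) = 0 := lauDeriv.map_natCast 3
  simp only [dLau_apply, thLau_apply, Derivation.leibniz, map_sub, smul_eq_mul, lauDeriv_T_one,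
    lauDeriv_T_neg_one, h2, h3]
  linear_combination (3 * T (-1) * lauDeriv f) * T_one_mul_T_neg_one

theorem dS_thS (F : LauS) : dS (thS F) = thS (dS F) + 6 * dS F := by
  ext1 n
  have h6 : (6 : LauS) = PowerSeries.C 6 := (map_ofNat PowerSeries.C 6).symm
  rw [coeff_dS, coeff_thS, map_add, map_add, coeff_thS, h6, PowerSeries.coeff_C_mul, coeff_dS, map_nsmul,
    dLau_thLau]
  ring

/-- Constant coefficients. -/
def constS : PowerSeries ℂ →+* LauS := PowerSeries.map LaurentPolynomial.C

theorem coeff_constS (F : PowerSeries ℂ) (n : ℕ) :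
    PowerSeries.coeff n (constS F) = C (PowerSeries.coeff n F) := PowerSeries.coeff_map _ _ _

theorem dLau_C (a : ℂ) : dLau (C a) = 0 := by rw [dLau_apply, lauDeriv_C, mul_zero]

theorem thLau_C (a : ℂ) : thLau (C a) = 0 := by rw [thLau_apply, lauDeriv_C, mul_zero]

theorem dS_constS (F : PowerSeries ℂ) : dS (constS F) = 0 := by
  ext1 n; rw [coeff_dS, coeff_constS, dLau_C, map_zero]

theorem thS_constS {F G : PowerSeries ℂ}
    (h : ∀ n : ℕ, (15 * (n : ℂ)) * PowerSeries.coeff n F = PowerSeries.coeff n G) :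
    thS (constS F) = constS G := by
  ext1 n
  rw [coeff_thS, coeff_constS, coeff_constS, thLau_C, zero_add, ← h, nsmul_eq_mul, map_mul C]
  congr 1
  rw [map_mul C, map_ofNat C, map_natCast C]
  push_cast; rfl

theorem dS_C (f : Lau) : dS (PowerSeries.C f) = PowerSeries.C (dLau f) := by
  ext1 n; rw [coeff_dS, PowerSeries.coeff_C, PowerSeries.coeff_C]; split_ifs <;> simp

theorem thS_C (f : Lau) : thS (PowerSeries.C f) = PowerSeries.C (thLau f) := by
  ext1 n; rw [coeff_thS, PowerSeries.coeff_C, PowerSeries.coeff_C]; split_ifs with h <;> simp [h]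

theorem dS_X : dS PowerSeries.X = 0 := by
  ext1 n; rw [coeff_dS, PowerSeries.coeff_X]; split_ifs <;>
    simp [show dLau 1 = 0 by simpa using dLau.map_natCast 1]

theorem thS_X : thS PowerSeries.X = 15 * PowerSeries.X := by
  ext1 n
  have h6 : (15 : LauS) = PowerSeries.C 15 := (map_ofNat PowerSeries.C 15).symm
  rw [coeff_thS, h6, PowerSeries.coeff_C_mul, PowerSeries.coeff_X]; split_ifs with h <;>
    simp [h, show thLau 1 = 0 by simpa using thLau.map_natCast 1]

/-- The series of `ħ ∂S/∂x` in the uniformizing coordinate. -/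
def YS (P : ℕ → Lau) : LauS :=
  2 * (PowerSeries.C (T 1) ^ 3 - PowerSeries.C (T 1))
    + PowerSeries.X * (4 * PowerSeries.C (C (1 / 8)) * dS (PowerSeries.mk P)
      - 2 * PowerSeries.C (C (1 / 8)) * PowerSeries.C (T (-1)) ^ 2)

/-- The series of `ħ ∂S/∂t` in the uniformizing coordinate. -/
def TS (P : ℕ → Lau) : LauS :=
  PowerSeries.C (T 1) + PowerSeries.X * (PowerSeries.C (C (1 / 8)) * thS (PowerSeries.mk P)
    + PowerSeries.C (C (1 / 8)) * PowerSeries.C (T (-1)) ^ 2)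

/-- The diagonal equation divided by ζ² and collected over all orders, with d/dζ expressed through
ζ⁻¹ d/dζ. -/
theorem diagonal_series {P : ℕ → Lau} {c : ℕ → ℂ}
    (hP : ∀ n : ℕ, (C 8 : Lau) * (T 4 - T 2) * lauDeriv (P (n + 1)) + lauDeriv (lauDeriv (P n))
      + ∑ p ∈ antidiagonal n, lauDeriv (P p.1) * lauDeriv (P p.2)
      - C 2 * T (-1) * lauDeriv (P n) - (C 3 * T 3 - C 2 * T 1) * lauDeriv (P n)
      - (C (15 * (n : ℂ)) : Lau) * T 2 * P n + (if n = 0 then (C (5 / 4) : Lau) * T (-2) - 1 else 0)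
      - (C (3 * c n) : Lau) * T 2 = 0) :
    8 * (PowerSeries.C (T 1) ^ 3 - PowerSeries.C (T 1)) * dS (PowerSeries.mk fun n => P (n + 1))
      + dS (dS (PowerSeries.mk P)) + dS (PowerSeries.mk P) ^ 2
      - PowerSeries.C (T (-1)) ^ 2 * dS (PowerSeries.mk P) - thS (PowerSeries.mk P)
      + 10 * PowerSeries.C (C (1 / 8)) * PowerSeries.C (T (-1)) ^ 4 - PowerSeries.C (T (-1)) ^ 2
      - 24 * PowerSeries.C (C (1 / 8)) * constS (PowerSeries.mk c) = 0 := by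
  ext1 n
  have hC : ∀ k : ℕ, [k.AtLeastTwo] → (OfNat.ofNat k : LauS) = PowerSeries.C (OfNat.ofNat k) := fun k _ =>
    (map_ofNat PowerSeries.C k).symm
  have e8 : (C 8 : Lau) = 8 := map_ofNat C 8
  have e2 : (C 2 : Lau) = 2 := map_ofNat C 2
  have e3 : (C 3 : Lau) = 3 := map_ofNat C 3
  have e54 : (C (5 / 4) : Lau) = 10 * C (1 / 8) := by
    rw [show (10 : Lau) = C 10 from (map_ofNat C 10).symm, ← map_mul C]; norm_num
  have e24 : (C (3 * c n) : Lau) = 24 * C (1 / 8) * C (c n) := by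
    rw [show (24 : Lau) = C 24 from (map_ofNat C 24).symm, ← map_mul C, ← map_mul C]; congr 1; ring
  have e15 : (C (15 * (n : ℂ)) : Lau) = 15 * (n : Lau) := by
    rw [map_mul C, map_ofNat C, map_natCast C]
  have tm := T_one_mul_T_neg_one
  have hd : ∀ f : Lau, lauDeriv f = T 1 * dLau f := fun f => by
    rw [dLau_apply, ← mul_assoc, tm, one_mul]
  have hdd : lauDeriv (lauDeriv (P n)) = dLau (P n) + T 1 ^ 2 * dLau (dLau (P n)) := by
    rw [hd (P n), Derivation.leibniz, lauDeriv_T_one, hd (dLau (P n))]; simp; ring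
  have hsum : ∑ p ∈ antidiagonal n, lauDeriv (P p.1) * lauDeriv (P p.2)
      = T 1 ^ 2 * ∑ p ∈ antidiagonal n, dLau (P p.1) * dLau (P p.2) := by
    rw [mul_sum]; exact sum_congr rfl fun p _ => by rw [hd, hd (P p.2)]; ring
  have T2 : (T 2 : Lau) = T 1 ^ 2 := by rw [T_pow]; rfl
  have T3 : (T 3 : Lau) = T 1 ^ 3 := by rw [T_pow]; rfl
  have T4 : (T 4 : Lau) = T 1 ^ 4 := by rw [T_pow]; rfl
  have Tm2 : (T (-2) : Lau) = T (-1) ^ 2 := by rw [T_pow]; rfl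
  have h := hP n
  rw [hdd, hsum, hd (P n), hd (P (n + 1)), e8, e2, e3, e54, e24, e15, T2, T3, T4, Tm2] at h
  simp only [hC, ← map_pow, ← map_sub, ← map_mul, map_zero]
  simp only [map_add, map_sub (PowerSeries.coeff n), PowerSeries.coeff_C_mul, coeff_dS, PowerSeries.coeff_mk,
    coeff_thS, coeff_constS, PowerSeries.coeff_C]
  simp only [pow_two (dS _), PowerSeries.coeff_mul, coeff_dS, PowerSeries.coeff_mk]
  have hT : (T 1 : Lau) ^ 2 ≠ 0 := pow_ne_zero _ (left_ne_zero_of_mul_eq_one tm)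
  apply mul_left_cancel₀ hT
  rw [thLau_apply, hd (P n), nsmul_eq_mul]
  push_cast
  generalize dLau (dLau (P n)) = b at *
  generalize dLau (P n) = a at *
  by_cases h0 : n = 0
  · simp only [if_pos h0] at h ⊢
    linear_combination h + ((-a) * (T 1 * T (-1) - 1) + 2 * T 1 ^ 2 * a
      + 10 * C (1 / 8) * T (-1) ^ 2 * (T 1 * T (-1) + 1) - (T 1 * T (-1) + 1)) * tm
  · simp only [if_neg h0] at h ⊢
    linear_combination h + ((-a) * (T 1 * T (-1) - 1) + 2 * T 1 ^ 2 * a) * tm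
end PainleveOne
end

/-! ### Formal Hamiltonian, and vanishing of the residuals. -/

noncomputable section
namespace PainleveOne
open Finset LaurentPolynomial

/-- The series `h - 4/27`, where `h` is the Hamiltonian, from the constants of the diagonal equations. -/
def hamS (c : ℕ → ℂ) : PowerSeries ℂ :=
  PowerSeries.X ^ 2 * (3 * PowerSeries.C (1 / 8) * PowerSeries.mk c)

/-- The weighted series of `q + 2 q₀`. -/
def QS (c : ℕ → ℂ) : PowerSeries ℂ := PowerSeries.mk fun n =>
  (if n = 0 then 1 else 0) + (18 - 15 * (n : ℂ)) / 8 * PowerSeries.coeff n (hamS c)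

/-- The weighted series of `dq/dt`. -/
def sS (c : ℕ → ℂ) : PowerSeries ℂ := PowerSeries.mk fun n =>
  (15 * (n : ℂ) - 6) / 8 * PowerSeries.coeff n (QS c) + if n = 0 then 1 / 2 else 0

/-- The weighted series of `p`. -/
def pS (c : ℕ → ℂ) : PowerSeries ℂ := PowerSeries.X * sS c

/-- The weighted series of `dp/dt`. -/
def rS (c : ℕ → ℂ) : PowerSeries ℂ := PowerSeries.mk fun n =>
  (15 * (n : ℂ) - 9) / 8 * PowerSeries.coeff n (pS c)

/-- The difference of the two sides of the evolution equation. -/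
def resS (P : ℕ → Lau) (c : ℕ → ℂ) : LauS :=
  (PowerSeries.C (T 1) ^ 2 - constS (QS c)) * TS P + (PowerSeries.C (T 1) ^ 2 - constS (QS c)) * TS P
    - YS P + constS (pS c)

theorem constS_C (a : ℂ) : constS (PowerSeries.C a) = PowerSeries.C (C a) := by simp [constS]

theorem constS_X : constS PowerSeries.X = PowerSeries.X := by simp [constS]

theorem C_mul_C_eight : (8 : LauS) * PowerSeries.C (C (1 / 8)) = 1 := by
  rw [show (8 : LauS) = PowerSeries.C (C 8) by rw [map_ofNat C, map_ofNat], ← map_mul, ← map_mul C]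
  norm_num

theorem dLau_T_one : dLau (T 1) = T (-1) := by rw [dLau_apply, lauDeriv_T_one, mul_one]

theorem dLau_T_neg_one : dLau (T (-1)) = -T (-1) ^ 3 := by
  rw [dLau_apply, lauDeriv_T_neg_one]; ring

theorem thLau_T_one : thLau (T 1) = 3 * T 1 - 2 * T (-1) := by
  rw [thLau_apply, lauDeriv_T_one, mul_one]

theorem thLau_T_neg_one : thLau (T (-1)) = -3 * T (-1) + 2 * T (-1) ^ 3 := by
  rw [thLau_apply, lauDeriv_T_neg_one]
  linear_combination (-3 * T (-1)) * T_one_mul_T_neg_one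

section
variable {P : ℕ → Lau} {c : ℕ → ℂ}

theorem schroedinger_series (hP0 : P 0 = 0)
    (hP : ∀ n : ℕ, (C 8 : Lau) * (T 4 - T 2) * lauDeriv (P (n + 1)) + lauDeriv (lauDeriv (P n))
      + ∑ p ∈ antidiagonal n, lauDeriv (P p.1) * lauDeriv (P p.2)
      - C 2 * T (-1) * lauDeriv (P n) - (C 3 * T 3 - C 2 * T 1) * lauDeriv (P n)
      - (C (15 * (n : ℂ)) : Lau) * T 2 * P n + (if n = 0 then (C (5 / 4) : Lau) * T (-2) - 1 else 0)
      - (C (3 * c n) : Lau) * T 2 = 0) :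
    4 * dS (TS P) = thS (YS P) - 9 * YS P ∧
    PowerSeries.X * dS (YS P) + 2 * YS P ^ 2 - 4 * (PowerSeries.X * TS P)
      = 8 * (PowerSeries.C (T 1) ^ 2) ^ 3 - 16 * (PowerSeries.C (T 1) ^ 2) ^ 2
        + 8 * PowerSeries.C (T 1) ^ 2 + 4 * constS (hamS c) := by
  have hh : constS (hamS c) = PowerSeries.X ^ 2
      * (3 * PowerSeries.C (C (1 / 8)) * constS (PowerSeries.mk c)) := by
    rw [hamS, map_mul, map_mul, map_mul, map_pow, constS_X, constS_C, map_ofNat]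
  rw [hh]
  refine schroedinger_identity dS thS (t := PowerSeries.C (T 1)) (m := PowerSeries.C (T (-1)))
    (e := PowerSeries.C (C (1 / 8))) (F := PowerSeries.mk P) (G := PowerSeries.mk fun n => P (n + 1))
    ?_ C_mul_C_eight dS_X ?_ ?_ ?_ thS_X ?_ ?_ ?_ dS_thS ?_ (diagonal_series hP) rfl rfl
  · rw [← map_mul, T_one_mul_T_neg_one, map_one]
  · rw [dS_C, dLau_T_one]
  · rw [dS_C, dLau_T_neg_one, map_neg, map_pow]
  · rw [dS_C, dLau_C, map_zero]
  · rw [thS_C, thLau_T_one, map_sub, map_mul, map_mul, map_ofNat, map_ofNat]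
  · rw [thS_C, thLau_T_neg_one, map_add, map_mul, map_mul, map_neg, map_ofNat, map_ofNat, map_pow]
  · rw [thS_C, thLau_C, map_zero]
  · ext1 n
    rcases n with _ | n
    · simp [hP0]
    · simp [PowerSeries.coeff_succ_X_mul]

theorem residual_equation (hT : 4 * dS (TS P) = thS (YS P) - 9 * YS P)
    (hY : PowerSeries.X * dS (YS P) + 2 * YS P ^ 2 - 4 * (PowerSeries.X * TS P)
      = 8 * (PowerSeries.C (T 1) ^ 2) ^ 3 - 16 * (PowerSeries.C (T 1) ^ 2) ^ 2
        + 8 * PowerSeries.C (T 1) ^ 2 + 4 * constS (hamS c)) :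
    2 * ((PowerSeries.C (T 1) ^ 2 - constS (QS c)) * (PowerSeries.X * dS (dS (resS P c))
        + 4 * YS P * dS (resS P c) - PowerSeries.X * (thS (resS P c) - 9 * resS P c))
      - 4 * PowerSeries.X * dS (resS P c) - 8 * YS P * resS P c - 8 * constS (pS c) * resS P c)
      = 16 * (constS (6 * QS c ^ 2 - 8 * QS c + 2 - PowerSeries.X * rS c) * PowerSeries.C (T 1) ^ 2
        + constS (2 * hamS c - 2 * QS c ^ 3 + 2 * QS c + PowerSeries.X * rS c * QS c - pS c ^ 2)) := by
  have hnum : ∀ k : ℕ, [k.AtLeastTwo] → (OfNat.ofNat k : PowerSeries ℂ) = PowerSeries.C (OfNat.ofNat k) :=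
    fun k _ => (map_ofNat PowerSeries.C k).symm
  have h := residual_identity dS thS (κ := PowerSeries.X) (Y := YS P) (T := TS P)
    (u := PowerSeries.C (T 1) ^ 2) (Q := constS (QS c)) (s := constS (sS c)) (p := constS (pS c))
    (r := constS (rS c)) (h := constS (hamS c)) (R := resS P c) rfl dS_X ?_ (dS_constS _) (dS_constS _)
    (dS_constS _) thS_X ?_ ?_ ?_ ?_ ?_ hT (dS_thS _) hY
  · rw [h]
    simp only [map_add, map_sub, map_mul, map_pow, map_ofNat, constS_X]
  · rw [RingDer.leibniz_pow, dS_C, dLau_T_one, mul_assoc]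
    simp only [Nat.add_one_sub_one, pow_one]
    rw [← map_mul, T_one_mul_T_neg_one]; simp
  · rw [RingDer.leibniz_pow, thS_C, thLau_T_one, mul_assoc]
    simp only [Nat.add_one_sub_one, pow_one]
    rw [map_sub, map_mul, map_mul, map_ofNat, map_ofNat]
    have : (PowerSeries.C (T 1) : LauS) * PowerSeries.C (T (-1)) = 1 := by
      rw [← map_mul, T_one_mul_T_neg_one, map_one]
    push_cast
    linear_combination (-4) * this
  · rw [thS_constS (G := 6 * QS c - 4 + 8 * sS c)]
    · simp only [map_add, map_sub, map_mul, map_ofNat]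
    · intro n
      simp only [hnum, map_add, map_sub, PowerSeries.coeff_C_mul, PowerSeries.coeff_C, sS, PowerSeries.coeff_mk]
      split_ifs <;> ring
  · rw [thS_constS (G := 9 * pS c + 8 * rS c)]
    · simp only [map_add, map_mul, map_ofNat]
    · intro n
      simp only [hnum, map_add, PowerSeries.coeff_C_mul, rS, PowerSeries.coeff_mk]
      ring
  -- The coefficients of `QS` are chosen so that this holds: it is the weighted form of H' = -q,
  -- which serves as definition of q.
  · rw [thS_constS (G := 18 * hamS c + 8 - 8 * QS c)]
    · simp only [map_add, map_sub, map_mul, map_ofNat]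
    · intro n
      simp only [hnum, map_add, map_sub, PowerSeries.coeff_C_mul, PowerSeries.coeff_C, QS, PowerSeries.coeff_mk]
      split_ifs <;> ring
  · rw [pS, map_mul, constS_X]

/-- The series all of whose coefficients have degree at most `k`. -/
def DegLE (k : ℤ) (F : LauS) : Prop := ∀ (m : ℕ) (n : ℤ), k < n → (PowerSeries.coeff m F).coeff n = 0

theorem DegLE.add {k : ℤ} {F G : LauS} (hF : DegLE k F) (hG : DegLE k G) : DegLE k (F + G) := by
  intro m n hn; simp [hF m n hn, hG m n hn]

theorem DegLE.sub {k : ℤ} {F G : LauS} (hF : DegLE k F) (hG : DegLE k G) : DegLE k (F - G) := by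
  intro m n hn; simp [hF m n hn, hG m n hn]

theorem DegLE.mono {k l : ℤ} {F : LauS} (hF : DegLE k F) (h : k ≤ l) : DegLE l F :=
  fun m n hn => hF m n (by omega)

theorem DegLE.X_mul {k : ℤ} {F : LauS} (hF : DegLE k F) : DegLE k (PowerSeries.X * F) := by
  intro m n hn
  rcases m with _ | m
  · simp
  · rw [PowerSeries.coeff_succ_X_mul]; exact hF m n hn

theorem DegLE.constS_mul {k : ℤ} {F : LauS} (A : PowerSeries ℂ) (hF : DegLE k F) :
    DegLE k (constS A * F) := by
  intro m n hn
  rw [PowerSeries.coeff_mul]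
  have : ∀ s : Finset (ℕ × ℕ), (∑ p ∈ s, PowerSeries.coeff p.1 (constS A) * PowerSeries.coeff p.2 F).coeff n
      = 0 := by
    intro s
    induction s using Finset.induction_on with
    | empty => simp
    | insert p s hp ih =>
      rw [sum_insert hp, AddMonoidAlgebra.coeff_add, Finsupp.add_apply, ih, coeff_constS, coeff_C_mul,
        hF _ n hn]; simp
  exact this _

theorem DegLE.T_mul {k : ℤ} {F : LauS} (j : ℤ) (hF : DegLE k F) :
    DegLE (k + j) (PowerSeries.C (T j) * F) := by
  intro m n hn
  rw [PowerSeries.coeff_C_mul, coeff_T_mul]; exact hF m _ (by omega)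

theorem DegLE.dS {k : ℤ} {F : LauS} (hF : DegLE k F) : DegLE (k - 2) (dS F) := by
  intro m n hn
  rw [coeff_dS, dLau_apply, coeff_T_mul, coeff_lauDeriv, hF m _ (by omega), mul_zero]

theorem DegLE.thS {k : ℤ} {F : LauS} (hF : DegLE k F) : DegLE k (thS F) := by
  intro m n hn
  have e3 : (3 : Lau) = C 3 := (map_ofNat C 3).symm
  have e2 : (2 : Lau) = C 2 := (map_ofNat C 2).symm
  rw [coeff_thS, thLau_apply, e2, e3, sub_mul, mul_assoc, mul_assoc]
  simp only [AddMonoidAlgebra.coeff_add, AddMonoidAlgebra.coeff_sub, AddMonoidAlgebra.coeff_smul,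
    Finsupp.add_apply, Finsupp.sub_apply, Finsupp.smul_apply, coeff_C_mul, coeff_T_mul, coeff_lauDeriv]
  rw [hF m _ (by omega), hF m _ (by omega), hF m n hn]; simp

theorem DegLE.one : DegLE 0 (1 : LauS) := by
  intro m n hn
  rw [PowerSeries.coeff_one]
  split_ifs
  · rw [← T_zero, T_apply, if_neg (by omega)]
  · simp

/-- The cubic terms of 2uT and of Y cancel, leaving (2 - 2Q)ζ at top degree; in the correction terms
a series of degree at most -1 is multiplied by at most ζ². -/
theorem degLE_resS (hP : DegLE (-1) (PowerSeries.mk P)) : DegLE 1 (resS P c) := by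
  have hY : YS P = 2 * (PowerSeries.C (T 1) ^ 3 - PowerSeries.C (T 1))
    + PowerSeries.X * (4 * PowerSeries.C (C (1 / 8)) * dS (PowerSeries.mk P)
      - 2 * PowerSeries.C (C (1 / 8)) * PowerSeries.C (T (-1)) ^ 2) := rfl
  have hT : TS P = PowerSeries.C (T 1) + PowerSeries.X * (PowerSeries.C (C (1 / 8)) * thS (PowerSeries.mk P)
    + PowerSeries.C (C (1 / 8)) * PowerSeries.C (T (-1)) ^ 2) := rfl
  have hT1 : PowerSeries.C (T 2) = (PowerSeries.C (T 1) : LauS) ^ 2 := by rw [← map_pow, T_pow]; rfl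
  have hm2 : PowerSeries.C (T (-2)) = (PowerSeries.C (T (-1)) : LauS) ^ 2 := by rw [← map_pow, T_pow]; rfl
  have e : resS P c = constS (2 - 2 * QS c) * (PowerSeries.C (T 1) * 1)
      + PowerSeries.X * (constS (2 * PowerSeries.C (1 / 8)) * (PowerSeries.C (T 2)
          * (thS (PowerSeries.mk P) + PowerSeries.C (T (-2)) * 1))
        - constS (2 * QS c * PowerSeries.C (1 / 8)) * (thS (PowerSeries.mk P) + PowerSeries.C (T (-2)) * 1)
        - constS (4 * PowerSeries.C (1 / 8)) * dS (PowerSeries.mk P)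
        + constS (2 * PowerSeries.C (1 / 8)) * (PowerSeries.C (T (-2)) * 1))
      + constS (pS c) * 1 := by
    rw [resS, hY, hT]
    simp only [map_sub, map_mul, map_ofNat, constS_C, hT1, hm2]
    ring
  rw [e]
  have h1 : DegLE (-2) (PowerSeries.C (T (-2)) * 1) := by simpa using DegLE.one.T_mul (-2)
  have h2 := hP.thS.add (h1.mono (by norm_num : (-2 : ℤ) ≤ -1))
  refine (DegLE.add (DegLE.constS_mul _ ?_) (DegLE.X_mul (DegLE.add (DegLE.sub (DegLE.sub
    (DegLE.constS_mul _ ?_) (DegLE.constS_mul _ ?_)) (DegLE.constS_mul _ ?_)) (DegLE.constS_mul _ ?_)))).add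
    (DegLE.constS_mul _ ?_)
  · simpa using DegLE.one.T_mul 1
  · simpa using h2.T_mul 2
  · exact h2.mono (by norm_num)
  · exact hP.dS.mono (by norm_num)
  · exact h1.mono (by norm_num)
  · exact DegLE.one.mono (by norm_num)

/-- Strong induction on the order m. If all lower orders vanish, dividing by the m-th power of the
parameter and setting it to zero leaves the linearized equation with Q = 1 and Y = 2(ζ³ - ζ), where
`eq_zero_of_linearized` annihilates all three coefficients at once. -/
theorem residual_vanishes {c : ℕ → ℂ} (hP : DegLE (-1) (PowerSeries.mk P))
    (h : 2 * ((PowerSeries.C (T 1) ^ 2 - constS (QS c)) * (PowerSeries.X * dS (dS (resS P c))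
        + 4 * YS P * dS (resS P c) - PowerSeries.X * (thS (resS P c) - 9 * resS P c))
      - 4 * PowerSeries.X * dS (resS P c) - 8 * YS P * resS P c - 8 * constS (pS c) * resS P c)
      = 16 * (constS (6 * QS c ^ 2 - 8 * QS c + 2 - PowerSeries.X * rS c) * PowerSeries.C (T 1) ^ 2
        + constS (2 * hamS c - 2 * QS c ^ 3 + 2 * QS c + PowerSeries.X * rS c * QS c - pS c ^ 2))) :
    resS P c = 0 ∧ 6 * QS c ^ 2 - 8 * QS c + 2 - PowerSeries.X * rS c = 0 ∧
      2 * hamS c - 2 * QS c ^ 3 + 2 * QS c + PowerSeries.X * rS c * QS c - pS c ^ 2 = 0 := by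
  have hdeg := degLE_resS (c := c) hP
  generalize hE : 6 * QS c ^ 2 - 8 * QS c + 2 - PowerSeries.X * rS c = E at *
  generalize hG : 2 * hamS c - 2 * QS c ^ 3 + 2 * QS c + PowerSeries.X * rS c * QS c - pS c ^ 2 = G at *
  generalize resS P c = R at *
  suffices H : ∀ m, PowerSeries.coeff m R = 0 ∧ PowerSeries.coeff m E = 0 ∧ PowerSeries.coeff m G = 0 by
    refine ⟨?_, ?_, ?_⟩ <;> ext1 m <;> simp [(H m).1, (H m).2.1, (H m).2.2]
  intro m
  induction m using Nat.strong_induction_on with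
  | _ m ih =>
  obtain ⟨R', hR⟩ := PowerSeries.X_pow_dvd_iff.2 fun k hk => (ih k hk).1
  obtain ⟨E', hE'⟩ := PowerSeries.X_pow_dvd_iff.2 fun k hk => (ih k hk).2.1
  obtain ⟨G', hG'⟩ := PowerSeries.X_pow_dvd_iff.2 fun k hk => (ih k hk).2.2
  have hc : ∀ {A : Type} [CommRing A] (F : PowerSeries A), PowerSeries.coeff m (PowerSeries.X ^ m * F)
      = PowerSeries.constantCoeff F := fun F => by
    have := PowerSeries.coeff_X_pow_mul F m 0
    rwa [zero_add, PowerSeries.coeff_zero_eq_constantCoeff_apply] at this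
  have hd : ∀ F : LauS, dS (PowerSeries.X ^ m * F) = PowerSeries.X ^ m * dS F := fun F => by
    rw [RingDer.leibniz, RingDer.leibniz_pow, dS_X]; ring
  -- The additional 15m comes from the weight of the parameter; like the whole θ-term it is
  -- multiplied by the parameter and drops out at leading order.
  have ht : thS (PowerSeries.X ^ m * R') = PowerSeries.X ^ m * (thS R' + 15 * (m : LauS) * R') := by
    rw [RingDer.leibniz, RingDer.leibniz_pow, thS_X]
    rcases m with _ | m
    · simp
    · rw [Nat.add_sub_cancel]; push_cast; ring
  rw [hR, hE', hG', hc, hc, hc]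
  rw [hR, hE', hG', hd, hd, ht, map_mul, map_mul, map_pow, constS_X] at h
  have h2 : (PowerSeries.C (T 1) ^ 2 - constS (QS c)) * (PowerSeries.X * dS (dS R')
        + 4 * YS P * dS R' - PowerSeries.X * (thS R' + 15 * (m : LauS) * R' - 9 * R'))
      - 4 * PowerSeries.X * dS R' - 8 * YS P * R' - 8 * constS (pS c) * R'
      = 8 * (constS E' * PowerSeries.C (T 1) ^ 2 + constS G') := by
    generalize hL : (PowerSeries.C (T 1) ^ 2 - constS (QS c)) * (PowerSeries.X * dS (dS R')
        + 4 * YS P * dS R' - PowerSeries.X * (thS R' + 15 * (m : LauS) * R' - 9 * R'))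
      - 4 * PowerSeries.X * dS R' - 8 * YS P * R' - 8 * constS (pS c) * R' = L
    generalize hM : 8 * (constS E' * PowerSeries.C (T 1) ^ 2 + constS G') = M
    have h' := mul_left_cancel₀ (pow_ne_zero m (PowerSeries.X_ne_zero : (PowerSeries.X : LauS) ≠ 0))
      (b := 2 * L) (c := 2 * M) (by rw [← hL, ← hM]; linear_combination h)
    linear_combination (4 * PowerSeries.C (C (1 / 8))) * h' - (L - M) * C_mul_C_eight
  have h3 := congrArg PowerSeries.constantCoeff h2
  have hQ0 : PowerSeries.constantCoeff (constS (QS c)) = 1 := by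
    rw [← PowerSeries.coeff_zero_eq_constantCoeff_apply, coeff_constS, QS, PowerSeries.coeff_mk, hamS]
    simp
  have hp0 : PowerSeries.constantCoeff (constS (pS c)) = 0 := by
    rw [pS, map_mul, constS_X]; simp
  have hY0 : PowerSeries.constantCoeff (YS P) = 2 * (T 1 ^ 3 - T 1) := by
    simp [YS, map_ofNat]
  have hd0 : PowerSeries.constantCoeff (dS R') = T (-1) * lauDeriv (PowerSeries.constantCoeff R') := by
    rw [← PowerSeries.coeff_zero_eq_constantCoeff_apply, coeff_dS, dLau_apply,
      PowerSeries.coeff_zero_eq_constantCoeff_apply]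
  have hE0 : PowerSeries.constantCoeff (constS E') = C (PowerSeries.constantCoeff E') := by
    rw [← PowerSeries.coeff_zero_eq_constantCoeff_apply, coeff_constS,
      PowerSeries.coeff_zero_eq_constantCoeff_apply]
  have hG0 : PowerSeries.constantCoeff (constS G') = C (PowerSeries.constantCoeff G') := by
    rw [← PowerSeries.coeff_zero_eq_constantCoeff_apply, coeff_constS,
      PowerSeries.coeff_zero_eq_constantCoeff_apply]
  simp only [map_add, map_sub, map_mul, map_pow, hQ0, hp0, hY0, hd0, hE0, hG0, PowerSeries.constantCoeff_X,
    PowerSeries.constantCoeff_C, map_ofNat] at h3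
  refine eq_zero_of_linearized (fun n hn => ?_) (e := PowerSeries.constantCoeff E')
    (g := PowerSeries.constantCoeff G') ?_
  · rw [← hc, ← hR]; exact hdeg m n (by omega)
  · have h8 : (8 : Lau) * C (1 / 8) = 1 := by
      rw [show (8 : Lau) = C 8 from (map_ofNat C 8).symm, ← map_mul C]; norm_num
    rw [show (T 2 : Lau) = T 1 ^ 2 by rw [T_pow]; rfl]
    simp only [map_ofNat C]
    generalize PowerSeries.constantCoeff R' = f at *
    generalize (C (PowerSeries.constantCoeff E') : Lau) = e at *
    generalize (C (PowerSeries.constantCoeff G') : Lau) = g at *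
    generalize lauDeriv f = f' at *
    linear_combination C (1 / 8) * h3 - C (1 / 8) * 8 * (T 1 ^ 2 - 1) ^ 2 * f' * T_one_mul_T_neg_one
      + (e * T 1 ^ 2 + g - (T 1 ^ 2 - 1) * ((T 1 ^ 2 - 1) * f' - 2 * T 1 * f)) * h8
end
end PainleveOne
end

/-! ### Identification with the given formal Painlevé solution. -/

noncomputable section
namespace PainleveOne
open Finset LaurentPolynomial

theorem coeff_diag (f : Fock) {n : ℤ} (hn : 0 ≤ n) :
    (diag f).coeff n = if n = 0 then MvPolynomial.constantCoeff f else 0 := by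
  induction f using MvPolynomial.induction_on generalizing n with
  | C a =>
    rw [diag, MvPolynomial.aeval_C, ← LaurentPolynomial.C_eq_algebraMap, ← mul_one (C a), coeff_C_mul,
      ← T_zero, T_apply, MvPolynomial.constantCoeff_C]
    split_ifs <;> first | omega | simp
  | add p q hp hq =>
    rw [map_add, AddMonoidAlgebra.coeff_add, Finsupp.add_apply, hp hn, hq hn, map_add]
    split_ifs <;> simp
  | mul_X p i hp =>
    have : diag (p * MvPolynomial.X i)
        = C (-1 / (2 * (i : ℂ) + 1)) * (T (-(2 * (i : ℤ) + 1)) * diag p) := by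
      rw [map_mul, diag, MvPolynomial.aeval_X]; ring
    rw [this, coeff_C_mul, coeff_T_mul, hp (by omega), if_neg (by omega), map_mul,
      MvPolynomial.constantCoeff_X]
    simp

/-- The formal solution of the weighted first Painlevé equation, together with the logarithmic
derivatives of the wave function. -/
theorem formal_solution {Φ : ℕ → Fock} (hΦ : IsFreeEnergy Φ) {c : ℕ → ℂ}
    (hc : ∀ n : ℕ, eu (Φ n) - MvPolynomial.C (5 * (n : ℂ)) * Φ n
      + MvPolynomial.C (8 / 3) * MvPolynomial.pderiv 1 (Φ (n + 1)) = MvPolynomial.C (c n)) :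
    2 * (PowerSeries.C (T 1) ^ 2 - constS (QS c)) * TS (fun n => diag (Φ n))
      = YS (fun n => diag (Φ n)) - constS (pS c) ∧
    PowerSeries.X * dS (YS fun n => diag (Φ n)) + 2 * YS (fun n => diag (Φ n)) ^ 2
      = 2 * PowerSeries.X * (2 * TS fun n => diag (Φ n))
        + 8 * PowerSeries.C (T 1) ^ 2 * (PowerSeries.C (T 1) ^ 2 - 1) ^ 2
        + 2 * constS (pS c) ^ 2 - 8 * constS (QS c) * (constS (QS c) - 1) ^ 2 ∧
    6 * QS c ^ 2 - 8 * QS c + 2 = PowerSeries.X * rS c := by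
  obtain ⟨h1, h2⟩ := schroedinger_series (P := fun n => diag (Φ n)) (c := c) (by simp [hΦ.zero])
    (diagonal_equation hΦ hc)
  have hdeg : DegLE (-1) (PowerSeries.mk fun n => diag (Φ n)) := by
    intro m n hn
    rw [PowerSeries.coeff_mk, coeff_diag _ (by omega), hΦ.const]; simp
  obtain ⟨hR, hE, hG⟩ := residual_vanishes hdeg (residual_equation h1 h2)
  refine ⟨?_, ?_, sub_eq_zero.1 hE⟩
  · rw [resS] at hR; linear_combination hR
  · have hG' : 2 * hamS c = pS c ^ 2 - 4 * QS c * (QS c - 1) ^ 2 := by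
      linear_combination hG + QS c * hE
    have hG2 := congrArg constS hG'
    simp only [map_mul, map_sub, map_pow, map_ofNat, map_one] at hG2
    linear_combination h2 + 2 * hG2

/-- The weighted coefficients of the formal solution `q`. -/
def qs (c : ℕ → ℂ) (n : ℕ) : ℂ := PowerSeries.coeff n (QS c) - if n = 0 then 2 / 3 else 0

theorem qs_zero (c : ℕ → ℂ) : qs c 0 = 1 / 3 := by
  simp [qs, QS, hamS]; norm_num

theorem coeff_sS (c : ℕ → ℂ) (n : ℕ) : PowerSeries.coeff n (sS c) = (15 * (n : ℂ) - 6) / 8 * qs c n := by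
  rw [sS, PowerSeries.coeff_mk, qs]
  split_ifs with h
  · subst h; push_cast; ring
  · ring

theorem qs_recursion {c : ℕ → ℂ} (h : 6 * QS c ^ 2 - 8 * QS c + 2 = PowerSeries.X * rS c) (n : ℕ) :
    4 * qs c (n + 1) + 6 * ∑ i ∈ range n, qs c (i + 1) * qs c (n - i)
      = PowerSeries.coeff n (rS c) := by
  have hq : QS c = PowerSeries.mk (qs c) + PowerSeries.C (2 / 3) := by
    ext1 m
    rw [map_add, PowerSeries.coeff_mk, qs, PowerSeries.coeff_C]; ring
  have h' : 6 * PowerSeries.mk (qs c) ^ 2 - PowerSeries.C (2 / 3) = PowerSeries.X * rS c := by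
    rw [← h, hq]
    have e : (PowerSeries.C (2 / 3) : PowerSeries ℂ) * 3 = 2 := by
      rw [show (3 : PowerSeries ℂ) = PowerSeries.C 3 from (map_ofNat PowerSeries.C 3).symm, ← map_mul,
        show (2 / 3 * 3 : ℂ) = 2 by norm_num, map_ofNat]
    linear_combination (- 4 * PowerSeries.mk (qs c) - 2 * PowerSeries.C (2 / 3) + 1) * e
  have h2 := congrArg (PowerSeries.coeff (n + 1)) h'
  rw [PowerSeries.coeff_succ_X_mul, map_sub, PowerSeries.coeff_C, if_neg (by omega),
    show (6 : PowerSeries ℂ) = PowerSeries.C 6 from (map_ofNat PowerSeries.C 6).symm,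
    PowerSeries.coeff_C_mul, pow_two, PowerSeries.coeff_mul, Nat.sum_antidiagonal_eq_sum_range_succ_mk,
    sum_range_succ, sum_range_succ'] at h2
  simp only [PowerSeries.coeff_mk, Nat.sub_self, Nat.sub_zero, qs_zero, Nat.add_sub_add_right] at h2
  linear_combination h2

theorem coeff_rS (c : ℕ → ℂ) (n : ℕ) :
    PowerSeries.coeff 0 (rS c) = 0 ∧
    PowerSeries.coeff (n + 1) (rS c) = (225 * (n : ℂ) ^ 2 - 36) / 64 * qs c n := by
  constructor
  · rw [rS, PowerSeries.coeff_mk, pS, PowerSeries.coeff_zero_X_mul, mul_zero]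
  · rw [rS, PowerSeries.coeff_mk, pS, PowerSeries.coeff_succ_X_mul, coeff_sS]; push_cast; ring

/-- The second derivative raises the order by two and products add orders, so the recursion respects
parity; order one vanishes because `rS` starts at order one. -/
theorem qs_odd {c : ℕ → ℂ} (h : 6 * QS c ^ 2 - 8 * QS c + 2 = PowerSeries.X * rS c) (n : ℕ) (hn : ¬ Even n) :
    qs c n = 0 := by
  induction n using Nat.strong_induction_on with
  | _ n ih =>
  rcases n with _ | n
  · simp at hn
  have h1 := qs_recursion h n
  rw [Nat.even_add_one, not_not] at hn
  rw [sum_eq_zero] at h1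
  · rcases n with _ | n
    · rw [(coeff_rS c 0).1] at h1; linear_combination h1 / 4
    · rw [(coeff_rS c n).2, ih n (by omega) (by rwa [Nat.even_add_one] at hn)] at h1
      linear_combination h1 / 4
  · intro i hi
    rw [mem_range] at hi
    by_cases he : Even i
    · rw [ih (i + 1) (by omega) (by rwa [Nat.even_add_one, not_not]), zero_mul]
    · rw [ih (n - i) (by omega) (by
        intro h'; rw [Nat.even_sub hi.le] at h'; exact he (h'.1 hn)), mul_zero]

theorem qs_even_recursion {c : ℕ → ℂ} (h : 6 * QS c ^ 2 - 8 * QS c + 2 = PowerSeries.X * rS c) (k : ℕ) :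
    4 * qs c (2 * (k + 1)) = 9 / 16 * (25 * (k : ℂ) ^ 2 - 1) * qs c (2 * k)
      - 6 * ∑ i : Fin k, qs c (2 * (i + 1)) * qs c (2 * (k - i)) := by
  have h1 := qs_recursion h (2 * k + 1)
  rw [(coeff_rS c (2 * k)).2] at h1
  have h2 : ∑ i ∈ range (2 * k + 1), qs c (i + 1) * qs c (2 * k + 1 - i)
      = ∑ i : Fin k, qs c (2 * (i + 1)) * qs c (2 * (k - i)) := by
    rw [Fin.sum_univ_eq_sum_range fun i => qs c (2 * (i + 1)) * qs c (2 * (k - i))]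
    symm
    refine sum_of_injOn (fun i => 2 * i + 1) (fun a _ b _ hab => by simpa using hab) ?_ ?_ ?_
    · intro i hi
      simp only [coe_range, Set.mem_Iio] at hi ⊢; omega
    · intro i hi hi'
      rw [qs_odd h (i + 1), zero_mul]
      intro he
      refine hi' ⟨i / 2, ?_, ?_⟩ <;> simp only [coe_range, Set.mem_Iio, mem_range] at hi ⊢ <;>
        (obtain ⟨j, hj⟩ := he; omega)
    · intro i hi
      rw [mem_range] at hi
      rw [show 2 * k + 1 - (2 * i + 1) = 2 * (k - i) by omega]; rfl
  rw [h2] at h1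
  push_cast at h1
  rw [show 2 * (k + 1) = 2 * k + 1 + 1 by ring]
  linear_combination h1

section
variable {U : Set ℂ} {q₀ : ℂ → ℂ}

theorem branch_ne_zero (hU0 : (0 : ℂ) ∉ U) (hq₀_eq : ∀ t ∈ U, 6 * q₀ t ^ 2 + t = 0) {t : ℂ} (ht : t ∈ U) :
    q₀ t ≠ 0 := by
  intro h0
  have := hq₀_eq t ht
  rw [h0] at this
  apply hU0
  have ht0 : t = 0 := by linear_combination this
  rwa [← ht0]

theorem hasDerivAt_branch (hU : IsOpen U) (hU0 : (0 : ℂ) ∉ U) (hq₀ : DifferentiableOn ℂ q₀ U)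
    (hq₀_eq : ∀ t ∈ U, 6 * q₀ t ^ 2 + t = 0) {t : ℂ} (ht : t ∈ U) :
    HasDerivAt q₀ (-1 / (12 * q₀ t)) t := by
  have hd := ((hq₀ t ht).differentiableAt (hU.mem_nhds ht)).hasDerivAt
  have h1 : HasDerivAt (fun t => 6 * q₀ t ^ 2 + t) 0 t :=
    (hasDerivAt_const t (0 : ℂ)).congr_of_eventuallyEq (by
      filter_upwards [hU.mem_nhds ht] with s hs using hq₀_eq s hs)
  have h2 := h1.unique (((hd.pow 2).const_mul 6).add (hasDerivAt_id t))
  have h0 := branch_ne_zero hU0 hq₀_eq ht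
  refine hd.congr_deriv ?_
  rw [eq_div_iff (mul_ne_zero (by norm_num) h0)]
  push_cast at h2
  simp only [pow_one] at h2
  linear_combination -h2

theorem hasDerivAt_branch_zpow (hU : IsOpen U) (hU0 : (0 : ℂ) ∉ U) (hq₀ : DifferentiableOn ℂ q₀ U)
    (hq₀_eq : ∀ t ∈ U, 6 * q₀ t ^ 2 + t = 0) {t : ℂ} (ht : t ∈ U) (b : ℂ) (n : ℤ) :
    HasDerivAt (fun t => b * (3 * q₀ t) ^ n) (-(3 / 4) * n * b * (3 * q₀ t) ^ (n - 2)) t := by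
  have h0 := branch_ne_zero hU0 hq₀_eq ht
  have h3 : 3 * q₀ t ≠ 0 := mul_ne_zero (by norm_num) h0
  have := ((hasDerivAt_zpow n (3 * q₀ t) (Or.inl h3)).comp t
    ((hasDerivAt_branch hU hU0 hq₀ hq₀_eq ht).const_mul 3)).const_mul b
  refine this.congr_deriv ?_
  rw [show n - 1 = n - 2 + 1 by ring, zpow_add_one₀ h3]
  field_simp
  ring

/-- By homogeneity the k-th coefficient is a constant times (3q₀)^(1-5k): each t-derivative lowers
the exponent by 2, and the division by 12q₀ lowers it once more. The constants obey
`qs_even_recursion`. -/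
theorem qEven_eq (hU : IsOpen U) (hU0 : (0 : ℂ) ∉ U) (hq₀ : DifferentiableOn ℂ q₀ U)
    (hq₀_eq : ∀ t ∈ U, 6 * q₀ t ^ 2 + t = 0) {c : ℕ → ℂ}
    (h : 6 * QS c ^ 2 - 8 * QS c + 2 = PowerSeries.X * rS c) (k : ℕ) {t : ℂ} (ht : t ∈ U) :
    qEven q₀ k t = qs c (2 * k) * (3 * q₀ t) ^ (1 - 5 * (k : ℤ)) := by
  induction k using Nat.strong_induction_on generalizing t with
  | _ k ih =>
  have h0 := branch_ne_zero hU0 hq₀_eq ht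
  have h3 : 3 * q₀ t ≠ 0 := mul_ne_zero (by norm_num) h0
  rcases k with _ | k
  · rw [qEven]; simp [qs_zero]
  have hd : iteratedDeriv 2 (qEven q₀ k) t
      = 9 / 16 * (25 * (k : ℂ) ^ 2 - 1) * qs c (2 * k) * (3 * q₀ t) ^ (1 - 5 * (k : ℤ) - 2 - 2) := by
    have e1 : ∀ s ∈ U, deriv (qEven q₀ k) s
        = -(3 / 4) * ((1 - 5 * (k : ℤ) : ℤ) : ℂ) * qs c (2 * k) * (3 * q₀ s) ^ (1 - 5 * (k : ℤ) - 2) := by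
      intro s hs
      refine ((hasDerivAt_branch_zpow hU hU0 hq₀ hq₀_eq hs _ _).congr_of_eventuallyEq ?_).deriv
      filter_upwards [hU.mem_nhds hs] with r hr using ih k (by omega) hr
    rw [iteratedDeriv_succ, iteratedDeriv_one]
    rw [((hasDerivAt_branch_zpow hU hU0 hq₀ hq₀_eq ht _ _).congr_of_eventuallyEq
      (by filter_upwards [hU.mem_nhds ht] with r hr using e1 r hr)).deriv]
    push_cast; ring
  have hs : ∀ i : Fin k, qEven q₀ (i + 1) t * qEven q₀ (k - i) t
      = qs c (2 * (i + 1)) * qs c (2 * (k - i)) * (3 * q₀ t) ^ (2 - 5 * ((k : ℤ) + 1)) := by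
    intro i
    rw [ih _ (by omega) ht, ih _ (by omega) ht, show (2 - 5 * ((k : ℤ) + 1))
      = (1 - 5 * ((i + 1 : ℕ) : ℤ)) + (1 - 5 * ((k - i : ℕ) : ℤ)) by
        rw [Nat.cast_sub i.2.le]; push_cast; ring, zpow_add₀ h3]
    ring
  rw [qEven]
  dsimp only
  rw [hd, Fintype.sum_congr _ _ hs, ← sum_mul, show 1 - 5 * (k : ℤ) - 2 - 2 = (2 - 5 * ((k : ℤ) + 1)) by ring,
    show 2 - 5 * ((k : ℤ) + 1) = (1 - 5 * ((k + 1 : ℕ) : ℤ)) + 1 by push_cast; ring, zpow_add_one₀ h3]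
  have := qs_even_recursion h k
  generalize ∑ i : Fin k, qs c (2 * (i + 1)) * qs c (2 * (k - i)) = σ at *
  generalize (3 * q₀ t) ^ (1 - 5 * ((k + 1 : ℕ) : ℤ)) = Z
  field_simp
  linear_combination (-48 * Z) * this

theorem qCoeff_eq (hU : IsOpen U) (hU0 : (0 : ℂ) ∉ U) (hq₀ : DifferentiableOn ℂ q₀ U)
    (hq₀_eq : ∀ t ∈ U, 6 * q₀ t ^ 2 + t = 0) {c : ℕ → ℂ}
    (h : 6 * QS c ^ 2 - 8 * QS c + 2 = PowerSeries.X * rS c) (n : ℕ) {t μ l : ℂ} (ht : t ∈ U)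
    (hμ : μ ^ 2 = 3 * q₀ t) (hl : μ * l = 1) :
    qCoeff q₀ n t = μ ^ 2 * (l ^ (5 * n) * qs c n) := by
  rw [qCoeff]
  split_ifs with he
  · obtain ⟨k, rfl⟩ := he
    have hμ0 : μ ≠ 0 := left_ne_zero_of_mul_eq_one hl
    rw [show (k + k) / 2 = k by omega, qEven_eq hU hU0 hq₀ hq₀_eq h k ht, ← hμ,
      show l = μ⁻¹ from eq_inv_of_mul_eq_one_right hl, ← two_mul, zpow_sub₀ (pow_ne_zero 2 hμ0), zpow_one,
      show (5 * (k : ℤ)) = ((5 * k : ℕ) : ℤ) by push_cast; ring, zpow_natCast, ← pow_mul,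
      show 5 * (2 * k) = 2 * (5 * k) by ring, inv_pow]
    field_simp
  · rw [qs_odd h n he, mul_zero, mul_zero]

theorem pCoeff_eq (hU : IsOpen U) (hU0 : (0 : ℂ) ∉ U) (hq₀ : DifferentiableOn ℂ q₀ U)
    (hq₀_eq : ∀ t ∈ U, 6 * q₀ t ^ 2 + t = 0) {c : ℕ → ℂ}
    (h : 6 * QS c ^ 2 - 8 * QS c + 2 = PowerSeries.X * rS c) (n : ℕ) {t μ l : ℂ} (ht : t ∈ U)
    (hμ : μ ^ 2 = 3 * q₀ t) (hl : μ * l = 1) :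
    pCoeff q₀ n t = μ ^ 3 * (l ^ (5 * n) * PowerSeries.coeff n (pS c)) := by
  rcases n with _ | n
  · rw [pCoeff, pS, PowerSeries.coeff_zero_X_mul, mul_zero, mul_zero]
  rw [pCoeff, pS, PowerSeries.coeff_succ_X_mul, coeff_sS]
  by_cases he : Even n
  · obtain ⟨k, rfl⟩ := he
    have hμ0 : μ ≠ 0 := left_ne_zero_of_mul_eq_one hl
    dsimp only
    rw [((hasDerivAt_branch_zpow hU hU0 hq₀ hq₀_eq ht (qs c (2 * k)) (1 - 5 * (k : ℤ))).congr_of_eventuallyEq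
      (by
        filter_upwards [hU.mem_nhds ht] with r hr
        dsimp only [qCoeff]
        rw [if_pos ⟨k, rfl⟩, show (k + k) / 2 = k by omega, qEven_eq hU hU0 hq₀ hq₀_eq h k hr])).deriv,
      ← hμ, show l = μ⁻¹ from eq_inv_of_mul_eq_one_right hl, ← two_mul,
      show 1 - 5 * (k : ℤ) - 2 = -((5 * k + 1 : ℕ) : ℤ) by push_cast; ring, zpow_neg, zpow_natCast, ← pow_mul,
      show 5 * (2 * k + 1) = 2 * (5 * k + 1) + 3 by ring, inv_pow, pow_add]
    push_cast
    field_simp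
    ring
  · have : qCoeff q₀ n = fun _ => 0 := by funext s; rw [qCoeff, if_neg he]
    dsimp only
    rw [this, deriv_const, qs_odd h n he]; simp
end
end PainleveOne
end

/-! ### Evaluation in ℂ((ħ)) and the given branches. -/

noncomputable section
namespace PainleveOne
open Finset LaurentPolynomial

/-! ### Formal series -/

theorem ser_eq (a : ℕ → ℂ) : ser a = HahnSeries.ofPowerSeries ℤ ℂ (PowerSeries.mk a) := rfl

theorem ser_mul (a b : ℕ → ℂ) :
    ser a * ser b = ser fun n => ∑ p ∈ antidiagonal n, a p.1 * b p.2 := by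
  rw [ser_eq, ser_eq, ser_eq, ← map_mul]
  congr 1; ext1 n; simp [PowerSeries.coeff_mul]

theorem ser_add (a b : ℕ → ℂ) : ser a + ser b = ser fun n => a n + b n := by
  rw [ser_eq, ser_eq, ser_eq, ← map_add]
  congr 1

theorem cst_eq (a : ℂ) : cst a = HahnSeries.ofPowerSeries ℤ ℂ (PowerSeries.C a) := by
  rw [cst, HahnSeries.ofPowerSeries_C]

theorem hbar_eq : hbar = HahnSeries.ofPowerSeries ℤ ℂ PowerSeries.X := by
  rw [hbar, HahnSeries.ofPowerSeries_X]

theorem cst_mul_ser (a : ℂ) (b : ℕ → ℂ) : cst a * ser b = ser fun n => a * b n := by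
  rw [ser_eq, ser_eq, cst_eq, ← map_mul]
  congr 1; ext1 n; simp

theorem hbar_mul_ser (a : ℕ → ℂ) : hbar * ser a = ser fun n => Nat.casesOn n 0 a := by
  rw [ser_eq, ser_eq, hbar_eq, ← map_mul]
  congr 1; ext1 n
  rcases n with _ | n
  · simp
  · simp [PowerSeries.coeff_succ_X_mul]

theorem hbar_ne_zero : hbar ≠ 0 := HahnSeries.single_ne_zero one_ne_zero

theorem cst_mul (a b : ℂ) : cst (a * b) = cst a * cst b := map_mul HahnSeries.C a b

theorem cst_add (a b : ℂ) : cst (a + b) = cst a + cst b := map_add HahnSeries.C a b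

theorem cst_pow (a : ℂ) (n : ℕ) : cst (a ^ n) = cst a ^ n := map_pow HahnSeries.C a n

theorem cst_ofNat (n : ℕ) [n.AtLeastTwo] : cst (OfNat.ofNat n) = OfNat.ofNat n := map_ofNat HahnSeries.C n

theorem cst_one : cst 1 = 1 := map_one HahnSeries.C

/-- The substitution of a point of the curve and of `ħ l ^ 5` for the weighted parameter. -/
def evS (l : ℂ) {ζ : ℂ} (h : ζ ≠ 0) : LauS →+* LaurentSeries ℂ :=
  (HahnSeries.ofPowerSeries ℤ ℂ).comp ((PowerSeries.rescale (l ^ 5)).comp (PowerSeries.map (levHom h)))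

theorem evS_eq (l : ℂ) {ζ : ℂ} (h : ζ ≠ 0) (F : LauS) :
    evS l h F = ser fun m => l ^ (5 * m) * lev (PowerSeries.coeff m F) ζ := by
  rw [ser_eq]
  show HahnSeries.ofPowerSeries ℤ ℂ _ = _
  congr 1; ext1 n
  simp [PowerSeries.coeff_rescale, pow_mul, lev_eq _ h]

theorem evS_X (l : ℂ) {ζ : ℂ} (h : ζ ≠ 0) : evS l h PowerSeries.X = cst l ^ 5 * hbar := by
  rw [← cst_pow, cst_eq, hbar_eq, ← map_mul]
  show HahnSeries.ofPowerSeries ℤ ℂ _ = _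
  congr 1; ext1 n
  simp

theorem evS_C (l : ℂ) {ζ : ℂ} (h : ζ ≠ 0) (f : Lau) : evS l h (PowerSeries.C f) = cst (levHom h f) := by
  rw [cst_eq]
  show HahnSeries.ofPowerSeries ℤ ℂ _ = _
  congr 1; ext1 n
  simp only [RingHom.coe_comp, Function.comp_apply, PowerSeries.coeff_rescale, PowerSeries.coeff_map,
    PowerSeries.coeff_C]
  split_ifs with h <;> simp [h]

theorem evS_constS (l : ℂ) {ζ : ℂ} (h : ζ ≠ 0) (A : PowerSeries ℂ) :
    evS l h (constS A) = ser fun m => l ^ (5 * m) * PowerSeries.coeff m A := by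
  rw [evS_eq]; congr 1; funext m
  rw [coeff_constS, lev_eq _ h, levHom_C]

/-! ### Derivatives of the functions `S_m` -/

/-- The domain and the branches that enter the definition of the functions `S_m`. -/
structure BranchData (U : Set ℂ) (q₀ : ℂ → ℂ) (Ω : Set (ℂ × ℂ)) (z ℓ : ℂ → ℂ → ℂ) : Prop where
  isOpen_base : IsOpen U
  zero_notMem : (0 : ℂ) ∉ U
  diff_q : DifferentiableOn ℂ q₀ U
  q_eq : ∀ t ∈ U, 6 * q₀ t ^ 2 + t = 0
  isOpen_total : IsOpen Ω
  mem : ∀ x t : ℂ, (x, t) ∈ Ω → t ∈ U ∧ x ≠ q₀ t ∧ x ≠ -2 * q₀ t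
  diff_z : DifferentiableOn ℂ (Function.uncurry z) Ω
  z_eq : ∀ x t : ℂ, (x, t) ∈ Ω → z x t ^ 2 = x + 2 * q₀ t
  diff_log : DifferentiableOn ℂ (Function.uncurry ℓ) Ω
  log_eq : ∀ x t : ℂ, (x, t) ∈ Ω → Complex.exp (ℓ x t) = curveY (q₀ t) (z x t) / (2 * (x - q₀ t))

theorem S_zero (q₀ : ℂ → ℂ) (z ℓ : ℂ → ℂ → ℂ) (x t : ℂ) :
    S q₀ z ℓ 0 x t = 4 / 5 * z x t ^ 5 - 4 * q₀ t * z x t ^ 3 := by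
  rw [S]
  dsimp only
  generalize z x t = w
  generalize q₀ t = a
  have hd : ∀ ζ : ℂ, deriv (curveX a) ζ = 2 * ζ := fun ζ => by
    have : HasDerivAt (curveX a) (2 * ζ) ζ :=
      ((hasDerivAt_pow 2 ζ).sub_const (2 * a)).congr_deriv (by simp)
    exact this.deriv
  have h1 : ∀ s : ℝ, HasDerivAt (fun s : ℝ => 4 / 5 * (w * (s : ℂ)) ^ 5 - 4 * a * (w * (s : ℂ)) ^ 3)
      (curveY a (0 + (s : ℂ) * (w - 0)) * deriv (curveX a) (0 + (s : ℂ) * (w - 0)) * (w - 0)) s := by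
    intro s
    have hs : HasDerivAt (fun s : ℂ => w * s) w (s : ℂ) := by simpa using (hasDerivAt_id (s : ℂ)).const_mul w
    have := (((hs.pow 5).const_mul (4 / 5)).sub ((hs.pow 3).const_mul (4 * a))).comp_ofReal
    refine this.congr_deriv ?_
    rw [hd, curveY]; push_cast; ring
  rw [segInt, intervalIntegral.integral_eq_sub_of_hasDerivAt (fun s _ => h1 s)]
  · simp
  · apply Continuous.intervalIntegrable
    simp only [hd, curveY]
    fun_prop

theorem hasDerivAt_zcoord_of {f g : ℂ → ℂ} {s g' : ℂ} (hf : DifferentiableAt ℂ f s) (h0 : f s ≠ 0)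
    (hg : HasDerivAt g g' s) (h : ∀ᶠ r in nhds s, f r ^ 2 = g r) : HasDerivAt f (g' / (2 * f s)) s := by
  have h1 := (hg.congr_of_eventuallyEq h).unique (hf.hasDerivAt.pow 2)
  refine hf.hasDerivAt.congr_deriv ?_
  rw [eq_div_iff (mul_ne_zero two_ne_zero h0), h1]
  push_cast; ring

theorem hasDerivAt_log_of {f g : ℂ → ℂ} {s g' : ℂ} (hf : DifferentiableAt ℂ f s)
    (hg : HasDerivAt g g' s) (h : ∀ᶠ r in nhds s, Complex.exp (f r) = g r) : HasDerivAt f (g' / g s) s := by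
  have h1 := (hg.congr_of_eventuallyEq h).unique hf.hasDerivAt.cexp
  refine hf.hasDerivAt.congr_deriv ?_
  rw [← h.self_of_nhds, h1, mul_div_cancel_left₀ _ (Complex.exp_ne_zero _)]

namespace BranchData
variable {U : Set ℂ} {q₀ : ℂ → ℂ} {Ω : Set (ℂ × ℂ)} {z ℓ : ℂ → ℂ → ℂ}

theorem ne_zero (B : BranchData U q₀ Ω z ℓ) {x t : ℂ} (h : (x, t) ∈ Ω) : z x t ≠ 0 := by
  intro h0
  have h1 := B.z_eq x t h
  rw [h0] at h1
  exact (B.mem x t h).2.2 (by linear_combination -h1)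

theorem eventually_x (B : BranchData U q₀ Ω z ℓ) {x t : ℂ} (h : (x, t) ∈ Ω) :
    ∀ᶠ x' in nhds x, (x', t) ∈ Ω :=
  (Continuous.prodMk_left t).continuousAt.eventually (B.isOpen_total.mem_nhds h)

theorem eventually_t (B : BranchData U q₀ Ω z ℓ) {x t : ℂ} (h : (x, t) ∈ Ω) :
    ∀ᶠ t' in nhds t, (x, t') ∈ Ω :=
  (Continuous.prodMk_right x).continuousAt.eventually (B.isOpen_total.mem_nhds h)

theorem comp_x (B : BranchData U q₀ Ω z ℓ) {f : ℂ → ℂ → ℂ} (hf : DifferentiableOn ℂ (Function.uncurry f) Ω)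
    {x t : ℂ} (h : (x, t) ∈ Ω) : DifferentiableAt ℂ (fun x' => f x' t) x := by
  have h1 := (hf _ h).differentiableAt (B.isOpen_total.mem_nhds h)
  exact DifferentiableAt.comp (f := fun x' : ℂ => (x', t)) x h1 (by fun_prop)

theorem comp_t (B : BranchData U q₀ Ω z ℓ) {f : ℂ → ℂ → ℂ} (hf : DifferentiableOn ℂ (Function.uncurry f) Ω)
    {x t : ℂ} (h : (x, t) ∈ Ω) : DifferentiableAt ℂ (fun t' => f x t') t := by
  have h1 := (hf _ h).differentiableAt (B.isOpen_total.mem_nhds h)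
  exact DifferentiableAt.comp (f := fun t' : ℂ => (x, t')) t h1 (by fun_prop)

theorem q_ne_zero (B : BranchData U q₀ Ω z ℓ) {x t : ℂ} (h : (x, t) ∈ Ω) : q₀ t ≠ 0 :=
  branch_ne_zero B.zero_notMem B.q_eq (B.mem x t h).1

theorem hasDerivAt_q (B : BranchData U q₀ Ω z ℓ) {x t : ℂ} (h : (x, t) ∈ Ω) :
    HasDerivAt q₀ (-1 / (12 * q₀ t)) t :=
  hasDerivAt_branch B.isOpen_base B.zero_notMem B.diff_q B.q_eq (B.mem x t h).1

theorem hasDerivAt_z_x (B : BranchData U q₀ Ω z ℓ) {x t : ℂ} (h : (x, t) ∈ Ω) :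
    HasDerivAt (fun x' => z x' t) (1 / (2 * z x t)) x :=
  hasDerivAt_zcoord_of (B.comp_x B.diff_z h) (B.ne_zero h) ((hasDerivAt_id x).add_const (2 * q₀ t))
    ((B.eventually_x h).mono fun _ h' => B.z_eq _ _ h')

theorem hasDerivAt_z_t (B : BranchData U q₀ Ω z ℓ) {x t : ℂ} (h : (x, t) ∈ Ω) :
    HasDerivAt (fun t' => z x t') (2 * (-1 / (12 * q₀ t)) / (2 * z x t)) t :=
  hasDerivAt_zcoord_of (B.comp_t B.diff_z h) (B.ne_zero h) (((B.hasDerivAt_q h).const_mul 2).const_add x)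
    ((B.eventually_t h).mono fun _ h' => B.z_eq _ _ h')

/-- On the curve y = 2z(x - q₀), so the given logarithm is a logarithm of z. -/
theorem exp_log (B : BranchData U q₀ Ω z ℓ) {x t : ℂ} (h : (x, t) ∈ Ω) : Complex.exp (ℓ x t) = z x t := by
  rw [B.log_eq x t h, curveY, B.z_eq x t h]
  have : x - q₀ t ≠ 0 := sub_ne_zero.2 (B.mem x t h).2.1
  field_simp
  ring

/-- No holomorphic root of 3q₀ on all of U is required. The principal square root of q₀(s)/q₀(t) is
differentiable at s = t, where this quotient is 1, while its square is correct for every s. -/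
theorem exists_root (B : BranchData U q₀ Ω z ℓ) {x t μ : ℂ} (h : (x, t) ∈ Ω) (hμ : μ ^ 2 = 3 * q₀ t) :
    ∃ r : ℂ → ℂ, r t = μ ∧ (∀ s, r s ^ 2 = 3 * q₀ s) ∧ HasDerivAt r (-3 / (8 * μ ^ 3)) t := by
  have h0 := B.q_ne_zero h
  have hμ0 : μ ≠ 0 := by rintro rfl; apply h0; linear_combination -hμ / 3
  have hsq : ∀ s, (μ * (q₀ s / q₀ t) ^ ((2 : ℂ)⁻¹)) ^ 2 = 3 * q₀ s := fun s => by
    have : ((q₀ s / q₀ t) ^ ((2 : ℂ)⁻¹)) ^ 2 = q₀ s / q₀ t := by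
      exact_mod_cast Complex.cpow_nat_inv_pow (q₀ s / q₀ t) two_ne_zero
    rw [mul_pow, this, hμ]; field_simp
  have h1 : μ * (q₀ t / q₀ t) ^ ((2 : ℂ)⁻¹) = μ := by rw [div_self h0, Complex.one_cpow, mul_one]
  refine ⟨fun s => μ * (q₀ s / q₀ t) ^ ((2 : ℂ)⁻¹), h1, hsq, ?_⟩
  have hd : DifferentiableAt ℂ (fun s => μ * (q₀ s / q₀ t) ^ ((2 : ℂ)⁻¹)) t := by
    refine (DifferentiableAt.cpow ((B.hasDerivAt_q h).differentiableAt.div_const _)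
      (differentiableAt_const _) ?_).const_mul μ
    rw [div_self h0]; exact Complex.one_mem_slitPlane
  have := hasDerivAt_zcoord_of hd (by rw [h1]; exact hμ0) ((B.hasDerivAt_q h).const_mul 3)
    (Filter.Eventually.of_forall hsq)
  refine this.congr_deriv ?_
  rw [h1, show q₀ t = μ ^ 2 / 3 by rw [hμ]; ring]
  field_simp
  norm_num
end BranchData
end PainleveOne
end

/-! ### Derivatives and holomorphy of the functions S_m. -/

noncomputable section
namespace PainleveOne
open Finset LaurentPolynomial

theorem coeff_YS_zero (P : ℕ → Lau) : PowerSeries.coeff 0 (YS P) = C 2 * (T 1 ^ 3 - T 1) := by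
  rw [PowerSeries.coeff_zero_eq_constantCoeff_apply]
  simp [YS, map_ofNat]

theorem coeff_TS_zero (P : ℕ → Lau) : PowerSeries.coeff 0 (TS P) = T 1 := by
  rw [PowerSeries.coeff_zero_eq_constantCoeff_apply]
  simp [TS]

theorem coeff_YS_succ (P : ℕ → Lau) (n : ℕ) : PowerSeries.coeff (n + 1) (YS P)
    = C (1 / 2) * dLau (P n) - if n = 0 then C (1 / 4) * T (-1) ^ 2 else 0 := by
  have e : YS P = PowerSeries.C (C 2 * (T 1 ^ 3 - T 1)) + PowerSeries.X * (PowerSeries.C (C (1 / 2))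
      * dS (PowerSeries.mk P) - PowerSeries.C (C (1 / 4) * T (-1) ^ 2)) := by
    have h2 : (C (1 / 2) : Lau) = 4 * C (1 / 8) := by
      rw [show (4 : Lau) = C 4 from (map_ofNat C 4).symm, ← map_mul C]; norm_num
    have h4 : (C (1 / 4) : Lau) = 2 * C (1 / 8) := by
      rw [show (2 : Lau) = C 2 from (map_ofNat C 2).symm, ← map_mul C]; norm_num
    rw [YS, h2, h4, map_ofNat C]
    simp only [map_mul, map_sub, map_pow, map_ofNat]
  rw [e, map_add, PowerSeries.coeff_C, if_neg (by omega), zero_add, PowerSeries.coeff_succ_X_mul, map_sub,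
    PowerSeries.coeff_C_mul, coeff_dS, PowerSeries.coeff_mk, PowerSeries.coeff_C]

theorem coeff_TS_succ (P : ℕ → Lau) (n : ℕ) : PowerSeries.coeff (n + 1) (TS P)
    = C (1 / 8) * (thLau (P n) + C (15 * (n : ℂ)) * P n) + if n = 0 then C (1 / 8) * T (-1) ^ 2 else 0 := by
  have e : TS P = PowerSeries.C (T 1) + PowerSeries.X * (PowerSeries.C (C (1 / 8)) * thS (PowerSeries.mk P)
      + PowerSeries.C (C (1 / 8) * T (-1) ^ 2)) := by
    rw [TS]
    simp only [map_mul, map_pow]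
  rw [e, map_add, PowerSeries.coeff_C, if_neg (by omega), zero_add, PowerSeries.coeff_succ_X_mul, map_add,
    PowerSeries.coeff_C_mul, coeff_thS, PowerSeries.coeff_mk, PowerSeries.coeff_C, nsmul_eq_mul]
  congr 4
  rw [map_mul C, map_ofNat C, map_natCast C]; push_cast; rfl

namespace BranchData
variable {U : Set ℂ} {q₀ : ℂ → ℂ} {Ω : Set (ℂ × ℂ)} {z ℓ : ℂ → ℂ → ℂ} {Φ : ℕ → Fock}

theorem root_ne_zero (B : BranchData U q₀ Ω z ℓ) {x t μ : ℂ} (h : (x, t) ∈ Ω) (hμ : μ ^ 2 = 3 * q₀ t) :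
    μ ≠ 0 := by
  have h0 := B.q_ne_zero h
  rintro rfl; apply h0; linear_combination -hμ / 3

/-- The formula holds for either root μ, so it can be used with a root that varies with t without
controlling its sign. -/
theorem S_eq_lev (B : BranchData U q₀ Ω z ℓ) (hΦ : IsFreeEnergy Φ) (m : ℕ) {x t μ : ℂ} (h : (x, t) ∈ Ω)
    (hμ : μ ^ 2 = 3 * q₀ t) :
    S q₀ z ℓ (m + 2) x t = μ⁻¹ ^ (5 * (m + 1)) * lev (diag (Φ (m + 1))) (μ⁻¹ * z x t) := by
  have h1 := B.root_ne_zero h hμ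
  have h2 : μ⁻¹ * z x t ≠ 0 := mul_ne_zero (inv_ne_zero h1) (B.ne_zero h)
  rw [S_eq hΦ (l := μ⁻¹) (by rw [← hμ]; field_simp) (B.ne_zero h), lev_eq _ h2, levHom_diag]

theorem hasDerivAt_S_x (B : BranchData U q₀ Ω z ℓ) (hΦ : IsFreeEnergy Φ) (m : ℕ) {x t μ : ℂ}
    (h : (x, t) ∈ Ω) (hμ : μ ^ 2 = 3 * q₀ t) :
    HasDerivAt (fun x' => S q₀ z ℓ m x' t)
      (μ ^ 3 * (μ⁻¹ ^ (5 * m) * lev (PowerSeries.coeff m (YS fun n => diag (Φ n))) (μ⁻¹ * z x t))) x := by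
  have h1 := B.root_ne_zero h hμ
  have hz := B.ne_zero h
  have h2 : μ⁻¹ * z x t ≠ 0 := mul_ne_zero (inv_ne_zero h1) hz
  have hd := B.hasDerivAt_z_x h
  rcases m with _ | _ | m
  · simp only [S_zero]
    refine (((hd.pow 5).const_mul (4 / 5)).sub ((hd.pow 3).const_mul (4 * q₀ t))).congr_deriv ?_
    rw [coeff_YS_zero, lev_eq _ h2, show q₀ t = μ ^ 2 / 3 by rw [hμ]; ring]
    simp only [map_mul, map_sub, map_pow, levHom_C, levHom_T, zpow_one]
    field_simp
    push_cast
    ring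
  · refine ((hasDerivAt_log_of (B.comp_x B.diff_log h) hd
      ((B.eventually_x h).mono fun _ h' => B.exp_log h')).const_mul (-(1 / 2))).congr_deriv ?_
    rw [coeff_YS_succ, if_pos rfl, hΦ.zero, lev_eq _ h2]
    simp only [map_zero, map_mul, map_sub, map_pow, levHom_C, levHom_T, zpow_neg_one, zero_add, mul_one]
    field_simp
    ring
  · have h3 : HasDerivAt (fun x' => μ⁻¹ ^ (5 * (m + 1)) * lev (diag (Φ (m + 1))) (μ⁻¹ * z x' t))
        (μ⁻¹ ^ (5 * (m + 1)) * (lev (lauDeriv (diag (Φ (m + 1)))) (μ⁻¹ * z x t) * (μ⁻¹ * (1 / (2 * z x t))))) x :=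
      ((hasDerivAt_lev (diag (Φ (m + 1))) h2).comp x (hd.const_mul μ⁻¹)).const_mul _
    refine (h3.congr_of_eventuallyEq
      ((B.eventually_x h).mono fun _ h' => B.S_eq_lev hΦ m h' hμ)).congr_deriv ?_
    rw [coeff_YS_succ, if_neg (by omega), sub_zero, lev_eq _ h2, lev_eq _ h2, dLau_apply]
    simp only [map_mul, levHom_C, levHom_T, zpow_neg_one]
    rw [show 5 * (m + 1 + 1) = 5 * (m + 1) + 5 by ring, pow_add]
    field_simp

theorem hasDerivAt_pdx_S (B : BranchData U q₀ Ω z ℓ) (hΦ : IsFreeEnergy Φ) (m : ℕ) {x t μ : ℂ}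
    (h : (x, t) ∈ Ω) (hμ : μ ^ 2 = 3 * q₀ t) :
    HasDerivAt (fun x' => pdx (S q₀ z ℓ m) x' t)
      (μ * (μ⁻¹ ^ (5 * m) * lev (C (1 / 2) * dLau (PowerSeries.coeff m (YS fun n => diag (Φ n))))
        (μ⁻¹ * z x t))) x := by
  have h1 := B.root_ne_zero h hμ
  have hz := B.ne_zero h
  have h2 : μ⁻¹ * z x t ≠ 0 := mul_ne_zero (inv_ne_zero h1) hz
  have h3 := (((hasDerivAt_lev (PowerSeries.coeff m (YS fun n => diag (Φ n))) h2).comp x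
    ((B.hasDerivAt_z_x h).const_mul μ⁻¹)).const_mul (μ⁻¹ ^ (5 * m))).const_mul (μ ^ 3)
  refine (h3.congr_of_eventuallyEq
    ((B.eventually_x h).mono fun _ h' => (B.hasDerivAt_S_x hΦ m h' hμ).deriv)).congr_deriv ?_
  rw [lev_eq _ h2, lev_eq _ h2, dLau_apply]
  simp only [map_mul, levHom_C, levHom_T, zpow_neg_one]
  field_simp

theorem hasDerivAt_S_t (B : BranchData U q₀ Ω z ℓ) (hΦ : IsFreeEnergy Φ) (m : ℕ) {x t μ : ℂ}
    (h : (x, t) ∈ Ω) (hμ : μ ^ 2 = 3 * q₀ t) :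
    HasDerivAt (fun t' => S q₀ z ℓ m x t')
      (μ * (μ⁻¹ ^ (5 * m) * lev (PowerSeries.coeff m (TS fun n => diag (Φ n))) (μ⁻¹ * z x t))) t := by
  have h1 := B.root_ne_zero h hμ
  have hz := B.ne_zero h
  have h2 : μ⁻¹ * z x t ≠ 0 := mul_ne_zero (inv_ne_zero h1) hz
  have hq : q₀ t = μ ^ 2 / 3 := by rw [hμ]; ring
  have hd := B.hasDerivAt_z_t h
  have hdq := B.hasDerivAt_q h
  rcases m with _ | _ | m
  · simp only [S_zero]
    refine (((hd.pow 5).const_mul (4 / 5)).sub ((hdq.const_mul 4).mul (hd.pow 3))).congr_deriv ?_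
    rw [coeff_TS_zero, lev_eq _ h2, hq]
    simp only [levHom_T, zpow_one, Pi.pow_apply]
    field_simp
    push_cast
    ring
  · refine ((hasDerivAt_log_of (B.comp_t B.diff_log h) hd
      ((B.eventually_t h).mono fun _ h' => B.exp_log h')).const_mul (-(1 / 2))).congr_deriv ?_
    rw [coeff_TS_succ, if_pos rfl, hΦ.zero, lev_eq _ h2, hq]
    simp only [map_zero, map_mul, map_add, map_pow, levHom_C, levHom_T, zpow_neg_one, zero_add, mul_one]
    field_simp
    norm_num
    ring
  -- Both the prefactor and the argument ζ depend on t through the root. The former produces the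
  -- term 15(m + 1), the latter together with the motion of z gives the vector field (3ζ - 2ζ⁻¹)
  -- d/dζ.
  · obtain ⟨r, hr, hr2, hrd⟩ := B.exists_root h hμ
    have hri := hrd.inv (by rwa [hr])
    rw [hr] at hri
    have hζ := hri.mul hd
    have h3 := (hri.pow (5 * (m + 1))).mul ((show HasDerivAt (lev (diag (Φ (m + 1)))) _ ((r⁻¹ * fun t' => z x t') t) by
      rw [Pi.mul_apply, Pi.inv_apply, hr]; exact hasDerivAt_lev (diag (Φ (m + 1))) h2).comp t hζ)
    refine (h3.congr_of_eventuallyEq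
      ((B.eventually_t h).mono fun t' h' => B.S_eq_lev hΦ m h' (hr2 t'))).congr_deriv ?_
    rw [coeff_TS_succ, if_neg (by omega), add_zero]
    simp only [Pi.mul_apply, Pi.inv_apply, Pi.pow_apply, Function.comp_apply, hr]
    rw [lev_eq _ h2, lev_eq _ h2, lev_eq _ h2, thLau_apply, hq]
    simp only [map_mul, map_add, map_sub, map_ofNat, levHom_C, levHom_T, zpow_neg_one, zpow_one]
    rw [show μ⁻¹ ^ (5 * (m + 1 + 1)) = μ⁻¹ ^ (5 * m) * μ⁻¹ ^ 10 by ring,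
      show μ⁻¹ ^ (5 * (m + 1)) = μ⁻¹ ^ (5 * m) * μ⁻¹ ^ 5 by ring,
      show μ⁻¹ ^ (5 * (m + 1) - 1) = μ⁻¹ ^ (5 * m) * μ⁻¹ ^ 4 by
        rw [show 5 * (m + 1) - 1 = 5 * m + 4 by omega, pow_add]]
    generalize μ⁻¹ ^ (5 * m) = A
    generalize levHom h2 (diag (Φ (m + 1))) = D
    generalize levHom h2 (lauDeriv (diag (Φ (m + 1)))) = D'
    push_cast
    field_simp
    ring

theorem differentiableOn_S (B : BranchData U q₀ Ω z ℓ) (hΦ : IsFreeEnergy Φ) (m : ℕ) :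
    DifferentiableOn ℂ (Function.uncurry (S q₀ z ℓ m)) Ω := by
  rintro ⟨x, t⟩ h
  apply DifferentiableAt.differentiableWithinAt
  have hz := (B.diff_z _ h).differentiableAt (B.isOpen_total.mem_nhds h)
  have hq : DifferentiableAt ℂ (fun y : ℂ × ℂ => q₀ y.2) (x, t) :=
    DifferentiableAt.comp (g := q₀) (x, t) (B.hasDerivAt_q h).differentiableAt differentiableAt_snd
  rcases m with _ | _ | m
  · have : Function.uncurry (S q₀ z ℓ 0)
        = fun y : ℂ × ℂ => 4 / 5 * Function.uncurry z y ^ 5 - 4 * q₀ y.2 * Function.uncurry z y ^ 3 := by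
      funext y; exact S_zero _ _ _ _ _
    rw [this]
    exact ((hz.pow 5).const_mul _).sub ((hq.const_mul 4).mul (hz.pow 3))
  · exact ((B.diff_log _ h).differentiableAt (B.isOpen_total.mem_nhds h)).const_mul (-(1 / 2))
  · obtain ⟨μ, hμ⟩ := IsAlgClosed.exists_pow_nat_eq (3 * q₀ t) two_pos
    obtain ⟨r, hr, hr2, hrd⟩ := B.exists_root h hμ
    have h1 := B.root_ne_zero h hμ
    have h2 : μ⁻¹ * z x t ≠ 0 := mul_ne_zero (inv_ne_zero h1) (B.ne_zero h)
    have hri : DifferentiableAt ℂ (fun y : ℂ × ℂ => (r y.2)⁻¹) (x, t) :=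
      DifferentiableAt.comp (g := fun s => (r s)⁻¹) (x, t) (hrd.inv (by rwa [hr])).differentiableAt
        differentiableAt_snd
    have hl : DifferentiableAt ℂ (lev (diag (Φ (m + 1)))) ((r t)⁻¹ * z x t) := by
      rw [hr]; exact (hasDerivAt_lev _ h2).differentiableAt
    have h3 := (hri.pow (5 * (m + 1))).mul
      (DifferentiableAt.comp (f := fun y : ℂ × ℂ => (r y.2)⁻¹ * Function.uncurry z y) (x, t) hl (hri.mul hz))
    refine h3.congr_of_eventuallyEq ?_
    filter_upwards [B.isOpen_total.mem_nhds h] with y hy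
    exact B.S_eq_lev hΦ m hy (hr2 y.2)
end BranchData
end PainleveOne
end

/-! ### Differentiation of WKB exponentials. -/

noncomputable section
namespace PainleveOne
open Finset

theorem constantCoeff_exp_subst {σ : PowerSeries ℂ} (h : PowerSeries.constantCoeff σ = 0) :
    PowerSeries.coeff 0 ((PowerSeries.exp ℂ).subst σ) = 1 := by
  have hσ : PowerSeries.HasSubst σ := PowerSeries.HasSubst.of_constantCoeff_zero' h
  have h1 : (PowerSeries.exp ℂ).subst σ = (PowerSeries.exp ℂ - 1).subst σ + 1 := by
    rw [← PowerSeries.coe_substAlgHom hσ, map_sub, map_one, sub_add_cancel]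
  have h2 : PowerSeries.constantCoeff ((PowerSeries.exp ℂ - 1).subst σ) = 0 :=
    PowerSeries.constantCoeff_subst_eq_zero h _ (by simp)
  rw [h1, map_add, PowerSeries.coeff_zero_eq_constantCoeff_apply, h2]; simp

/-- From E' = Eσ' for E = exp σ, the coefficient of order m + 1 is a finite polynomial expression in
lower ones and in those of σ. Differentiating this recursion in the parameter proves the claim by
induction, without any question of convergence. -/
theorem hasDerivAt_coeff_exp_subst {f : ℕ → ℂ → ℂ} {f' : ℕ → ℂ} {s : ℂ} (h0 : ∀ r, f 0 r = 0)
    (hf : ∀ k, HasDerivAt (f k) (f' k) s) (m : ℕ) :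
    HasDerivAt (fun r => PowerSeries.coeff m ((PowerSeries.exp ℂ).subst (PowerSeries.mk fun k => f k r)))
      (PowerSeries.coeff m ((PowerSeries.exp ℂ).subst (PowerSeries.mk fun k => f k s) * PowerSeries.mk f'))
      s := by
  have hc : ∀ r, PowerSeries.constantCoeff (PowerSeries.mk fun k => f k r) = 0 := fun r => by
    rw [← PowerSeries.coeff_zero_eq_constantCoeff_apply, PowerSeries.coeff_mk, h0]
  have hE : ∀ r, PowerSeries.derivative ℂ ((PowerSeries.exp ℂ).subst (PowerSeries.mk fun k => f k r))
      = (PowerSeries.exp ℂ).subst (PowerSeries.mk fun k => f k r)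
        * PowerSeries.derivative ℂ (PowerSeries.mk fun k => f k r) := fun r => by
    rw [PowerSeries.derivative_subst (PowerSeries.HasSubst.of_constantCoeff_zero' (hc r)),
      PowerSeries.derivative_exp]
  have hr : ∀ r m, PowerSeries.coeff (m + 1) ((PowerSeries.exp ℂ).subst (PowerSeries.mk fun k => f k r))
      = 1 / ((m : ℂ) + 1) * ∑ p ∈ antidiagonal m,
        PowerSeries.coeff p.1 ((PowerSeries.exp ℂ).subst (PowerSeries.mk fun k => f k r))
          * (f (p.2 + 1) r * ((p.2 : ℂ) + 1)) := fun r m => by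
    have := congrArg (PowerSeries.coeff m) (hE r)
    simp only [PowerSeries.coeff_mul, PowerSeries.coeff_derivative, PowerSeries.coeff_mk] at this
    rw [← this]
    have hm : (m : ℂ) + 1 ≠ 0 := by exact_mod_cast Nat.succ_ne_zero m
    field_simp
  induction m using Nat.strong_induction_on with
  | _ m ih =>
  rcases m with _ | m
  · have hf0 : f' 0 = 0 := by
      rw [← (hf 0).deriv, show f 0 = fun _ => 0 from funext h0, deriv_const]
    have e : ∀ r, PowerSeries.coeff 0 ((PowerSeries.exp ℂ).subst (PowerSeries.mk fun k => f k r)) = 1 :=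
      fun r => constantCoeff_exp_subst (hc r)
    simp only [e]
    refine (hasDerivAt_const s (1 : ℂ)).congr_deriv ?_
    rw [PowerSeries.coeff_mul]; simp [hf0]
  · simp only [hr _ m]
    refine ((HasDerivAt.fun_sum fun p hp => (ih p.1 (by
      rw [HasAntidiagonal.mem_antidiagonal] at hp; omega)).mul ((hf (p.2 + 1)).mul_const
        ((p.2 : ℂ) + 1))).const_mul (1 / ((m : ℂ) + 1))).congr_deriv ?_
    have hm : (m : ℂ) + 1 ≠ 0 := by exact_mod_cast Nat.succ_ne_zero m
    -- The claim at order m + 1 is the coefficient m of the formal derivative of the product of E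
    -- with the parameter derivative of σ, expanded by the Leibniz rule.
    rw [div_mul_eq_mul_div, one_mul, div_eq_iff hm, ← PowerSeries.coeff_derivative, Derivation.leibniz, hE,
      smul_eq_mul, smul_eq_mul, map_add, sum_add_distrib, add_comm]
    congr 1
    · rw [PowerSeries.coeff_mul]
      simp only [PowerSeries.coeff_derivative, PowerSeries.coeff_mk]
    · rw [← mul_assoc, mul_comm (PowerSeries.mk f'), PowerSeries.coeff_mul]
      simp only [PowerSeries.coeff_derivative, PowerSeries.coeff_mk]

/-- The amplitude of `exp (∑ ħ ^ (m - 1) u_m)`. -/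
def expAmp (u : ℕ → ℂ → ℂ) (m : ℕ) (r : ℂ) : ℂ :=
  Complex.exp (u 1 r) * PowerSeries.coeff m
    ((PowerSeries.exp ℂ).subst (PowerSeries.mk fun k => if k = 0 then 0 else u (k + 1) r : PowerSeries ℂ))

theorem hasDerivAt_expAmp {u : ℕ → ℂ → ℂ} {y : ℕ → ℂ} {s : ℂ} (hu : ∀ k, HasDerivAt (u k) (y k) s) (m : ℕ) :
    HasDerivAt (expAmp u m) (∑ p ∈ antidiagonal m, y (p.1 + 1) * expAmp u p.2 s) s := by
  have h1 := hasDerivAt_coeff_exp_subst (f := fun k r => if k = 0 then 0 else u (k + 1) r)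
    (f' := fun k => if k = 0 then 0 else y (k + 1)) (s := s) (fun r => if_pos rfl) (fun k => by
      rcases k with _ | k
      · simpa using hasDerivAt_const s (0 : ℂ)
      · simpa using hu (k + 1 + 1)) m
  refine ((hu 1).cexp.mul h1).congr_deriv ?_
  simp only [expAmp]
  generalize (PowerSeries.exp ℂ).subst (PowerSeries.mk fun k => if k = 0 then 0 else u (k + 1) s : PowerSeries ℂ)
    = E
  -- The scalar factor exp(u 1) contributes y 1, which fills the constant term missing in the
  -- exponent series.
  have h2 : PowerSeries.mk (fun k => y (k + 1))
      = PowerSeries.C (y 1) + PowerSeries.mk fun k => if k = 0 then 0 else y (k + 1) := by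
    ext1 k
    rw [map_add, PowerSeries.coeff_mk, PowerSeries.coeff_mk, PowerSeries.coeff_C]
    split_ifs with h <;> simp [h]
  have h3 := congrArg (PowerSeries.coeff m) (congrArg (· * E) h2)
  simp only [add_mul, map_add, PowerSeries.coeff_C_mul] at h3
  rw [PowerSeries.coeff_mul] at h3
  simp only [PowerSeries.coeff_mk] at h3
  simp only [mul_left_comm _ (Complex.exp _), ← mul_sum]
  rw [h3, mul_comm E]; ring

theorem cst_add_hbar_mul_ser (y : ℕ → ℂ) : cst (y 0) + hbar * ser (fun m => y (m + 1)) = ser y := by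
  rw [cst_eq, hbar_eq, ser_eq, ser_eq, ← map_mul, ← map_add]
  congr 1; ext1 n
  rcases n with _ | n
  · simp
  · rw [map_add, PowerSeries.coeff_succ_X_mul]; simp

/-- The coefficients of `ħ` times a derivative of a WKB-type series. -/
theorem ser_cases (a b : ℕ → ℂ) (c : ℂ) (f : ℕ → ℂ) (h0 : f 0 = c * a 0)
    (h1 : ∀ m, f (m + 1) = c * a (m + 1) + b m) : ser f = cst c * ser a + hbar * ser b := by
  rw [cst_mul_ser, hbar_mul_ser, ser_add]
  congr 1; funext m
  rcases m with _ | m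
  · simp [h0]
  · exact h1 m

theorem hdx_ampSer (ψ : WKB) (x t : ℂ) : ψ.hdx.ampSer x t
    = cst (pdx ψ.phase x t) * ψ.ampSer x t + hbar * ser fun m => pdx (ψ.amp m) x t :=
  ser_cases _ _ _ _ rfl fun _ => rfl

theorem hdt_ampSer (ψ : WKB) (x t : ℂ) : ψ.hdt.ampSer x t
    = cst (pdt ψ.phase x t) * ψ.ampSer x t + hbar * ser fun m => pdt (ψ.amp m) x t :=
  ser_cases _ _ _ _ rfl fun _ => rfl

section
variable {s : ℕ → ℂ → ℂ → ℂ} {x t : ℂ} {y yy : ℕ → ℂ}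

theorem hasDerivAt_amp_x (hy : ∀ m, HasDerivAt (fun x' => s m x' t) (y m) x) (m : ℕ) :
    HasDerivAt (fun x' => (expWKB s).amp m x' t)
      (∑ p ∈ antidiagonal m, y (p.1 + 1) * (expWKB s).amp p.2 x t) x :=
  hasDerivAt_expAmp (u := fun m x' => s m x' t) hy m

theorem hasDerivAt_amp_t (hy : ∀ m, HasDerivAt (fun t' => s m x t') (y m) t) (m : ℕ) :
    HasDerivAt (fun t' => (expWKB s).amp m x t')
      (∑ p ∈ antidiagonal m, y (p.1 + 1) * (expWKB s).amp p.2 x t) t :=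
  hasDerivAt_expAmp (u := fun m t' => s m x t') hy m

theorem hbar_mul_ser_sum (y a : ℕ → ℂ) :
    hbar * ser (fun m => ∑ p ∈ antidiagonal m, y (p.1 + 1) * a p.2) = (ser y - cst (y 0)) * ser a := by
  rw [← cst_add_hbar_mul_ser y, ← ser_mul (fun m => y (m + 1))]; ring

theorem hdx_expWKB (hy : ∀ m, HasDerivAt (fun x' => s m x' t) (y m) x) :
    (expWKB s).hdx.ampSer x t = ser y * (expWKB s).ampSer x t := by
  rw [hdx_ampSer, show (fun m => pdx ((expWKB s).amp m) x t)
    = fun m => ∑ p ∈ antidiagonal m, y (p.1 + 1) * (expWKB s).amp p.2 x t from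
      funext fun m => (hasDerivAt_amp_x hy m).deriv, hbar_mul_ser_sum y fun m => (expWKB s).amp m x t,
    show pdx (expWKB s).phase x t = y 0 from (hy 0).deriv, WKB.ampSer]
  ring

theorem hdt_expWKB (hy : ∀ m, HasDerivAt (fun t' => s m x t') (y m) t) :
    (expWKB s).hdt.ampSer x t = ser y * (expWKB s).ampSer x t := by
  rw [hdt_ampSer, show (fun m => pdt ((expWKB s).amp m) x t)
    = fun m => ∑ p ∈ antidiagonal m, y (p.1 + 1) * (expWKB s).amp p.2 x t from
      funext fun m => (hasDerivAt_amp_t hy m).deriv, hbar_mul_ser_sum y fun m => (expWKB s).amp m x t,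
    show pdt (expWKB s).phase x t = y 0 from (hy 0).deriv, WKB.ampSer]
  ring

theorem ser_injective {a b : ℕ → ℂ} (h : ser a = ser b) : a = b := by
  have := HahnSeries.ofPowerSeries_injective h
  funext n
  simpa using congrArg (PowerSeries.coeff n) this

theorem hdx_amp (hy : ∀ m, HasDerivAt (fun x' => s m x' t) (y m) x) (m : ℕ) :
    (expWKB s).hdx.amp m x t = ∑ p ∈ antidiagonal m, pdx (s p.1) x t * (expWKB s).amp p.2 x t := by
  have h := hdx_expWKB hy
  rw [WKB.ampSer, WKB.ampSer, ser_mul] at h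
  rw [congrFun (ser_injective h) m]
  exact sum_congr rfl fun p _ => by rw [show pdx (s p.1) x t = y p.1 from (hy p.1).deriv]

/-- The first amplitude must be known near x before it can be differentiated again, hence the
differentiability on a neighbourhood. The two parts of the product rule give the derivative of the
logarithmic derivative and its square. -/
theorem hdx_hdx_expWKB (hy : ∀ m, HasDerivAt (fun x' => s m x' t) (y m) x)
    (hd : ∀ᶠ x' in nhds x, ∀ m, DifferentiableAt ℂ (fun x' => s m x' t) x')
    (hyy : ∀ m, HasDerivAt (fun x' => pdx (s m) x' t) (yy m) x) :
    (expWKB s).hdx.hdx.ampSer x t = (ser y ^ 2 + hbar * ser yy) * (expWKB s).ampSer x t := by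
  have h1 : ∀ m, pdx ((expWKB s).hdx.amp m) x t
      = ∑ p ∈ antidiagonal m, yy p.1 * (expWKB s).amp p.2 x t
        + ∑ p ∈ antidiagonal m, y p.1 * ∑ r ∈ antidiagonal p.2, y (r.1 + 1) * (expWKB s).amp r.2 x t := by
    intro m
    rw [← sum_add_distrib]
    refine HasDerivAt.deriv ?_
    refine ((HasDerivAt.fun_sum fun p (_ : p ∈ antidiagonal m) =>
      (hyy p.1).mul (hasDerivAt_amp_x hy p.2)).congr_of_eventuallyEq
        (hd.mono fun x' h' => hdx_amp (fun m => (h' m).hasDerivAt) m)).congr_deriv ?_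
    exact sum_congr rfl fun p _ => by rw [show pdx (s p.1) x t = y p.1 from (hy p.1).deriv]
  rw [hdx_ampSer, show (fun m => pdx ((expWKB s).hdx.amp m) x t) = _ from funext h1, ← ser_add,
    ← ser_mul yy fun m => (expWKB s).amp m x t,
    ← ser_mul y fun m => ∑ r ∈ antidiagonal m, y (r.1 + 1) * (expWKB s).amp r.2 x t, mul_add,
    mul_left_comm hbar (ser y), hbar_mul_ser_sum y fun m => (expWKB s).amp m x t, hdx_expWKB hy,
    show pdx (expWKB s).hdx.phase x t = y 0 from (hy 0).deriv, WKB.ampSer]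
  ring
end
end PainleveOne
end

/-! ### Riccati and evolution equations, semi-classical limit and conclusion. -/

noncomputable section
namespace PainleveOne
open Finset LaurentPolynomial

theorem mul_serS (s : ℕ → ℂ → ℂ → ℂ) (x t : ℂ) : hbar * serS s x t = ser fun m => s m x t := by
  rw [serS, mul_inv_cancel_left₀ hbar_ne_zero]

theorem coeff_zero_ofPowerSeries (F : PowerSeries ℂ) :
    (HahnSeries.ofPowerSeries ℤ ℂ F).coeff 0 = PowerSeries.constantCoeff F := by
  have := HahnSeries.ofPowerSeries_apply_coeff (Γ := ℤ) F 0
  simpa using this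

theorem qCoeff_zero (q₀ : ℂ → ℂ) (t : ℂ) : qCoeff q₀ 0 t = q₀ t := by
  simp [qCoeff, qEven]

theorem constantCoeff_mk (a : ℕ → ℂ) : PowerSeries.constantCoeff (PowerSeries.mk a) = a 0 := by
  rw [← PowerSeries.coeff_zero_eq_constantCoeff_apply, PowerSeries.coeff_mk]

theorem cst_sub_qSer (q₀ : ℂ → ℂ) (x t : ℂ) : cst x - qSer q₀ t
    = HahnSeries.ofPowerSeries ℤ ℂ (PowerSeries.C x - PowerSeries.mk fun n => qCoeff q₀ n t) := by
  rw [map_sub, cst_eq, qSer, ser_eq]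

theorem exists_inv_cst_sub_qSer {q₀ : ℂ → ℂ} {x t : ℂ} (h : x ≠ q₀ t) :
    ∃ G, (cst x - qSer q₀ t) * HahnSeries.ofPowerSeries ℤ ℂ G = 1 := by
  refine ⟨(PowerSeries.C x - PowerSeries.mk fun n => qCoeff q₀ n t)⁻¹, ?_⟩
  rw [cst_sub_qSer, ← map_mul, PowerSeries.mul_inv_cancel, map_one]
  rw [map_sub, constantCoeff_mk, qCoeff_zero, PowerSeries.constantCoeff_C]
  exact sub_ne_zero.2 h

theorem fSer_coeff_zero {q₀ : ℂ → ℂ} {x t : ℂ} (h : x ≠ q₀ t) : (fSer q₀ x t).coeff 0 = 0 := by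
  obtain ⟨G, hG⟩ := exists_inv_cst_sub_qSer h
  rw [fSer, div_eq_mul_inv, ← eq_inv_of_mul_eq_one_right hG, hbar_eq, ← map_mul, ← map_neg,
    coeff_zero_ofPowerSeries]
  simp

/-- Since p has no term of order zero, only 4x³ + 2tx - 4q₀³ - 2tq₀ remains, and t = -6q₀² makes q₀
a double root in x. -/
theorem gSer_coeff_zero {q₀ : ℂ → ℂ} {x t : ℂ} (h : x ≠ q₀ t) (ht : 6 * q₀ t ^ 2 + t = 0) :
    (gSer q₀ x t).coeff 0 = -(4 * (x - q₀ t) ^ 2 * (x + 2 * q₀ t)) := by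
  obtain ⟨G, hG⟩ := exists_inv_cst_sub_qSer h
  rw [gSer, div_eq_mul_inv, ← eq_inv_of_mul_eq_one_right hG, hbar_eq, potential, qSer, pSer, ser_eq, ser_eq,
    cst_eq, cst_eq, show (4 : LaurentSeries ℂ) = HahnSeries.ofPowerSeries ℤ ℂ 4 from (map_ofNat _ 4).symm]
  simp only [← map_mul, ← map_pow, ← map_sub, ← map_add, ← map_neg]
  rw [coeff_zero_ofPowerSeries]
  simp only [map_mul, map_pow, map_sub, map_add, map_neg, constantCoeff_mk, qCoeff_zero, pCoeff,
    PowerSeries.constantCoeff_C, PowerSeries.constantCoeff_X, map_ofNat]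
  linear_combination (2 * q₀ t - 2 * x) * ht

namespace BranchData
variable {U : Set ℂ} {q₀ : ℂ → ℂ} {Ω : Set (ℂ × ℂ)} {z ℓ : ℂ → ℂ → ℂ}

/-- The logarithmic derivatives of the wave function satisfy the Riccati equation and the evolution
equation. -/
theorem riccati (B : BranchData U q₀ Ω z ℓ) {x t : ℂ} (h : (x, t) ∈ Ω) :
    ∃ y yy w : ℕ → ℂ, (∀ m, HasDerivAt (fun x' => S q₀ z ℓ m x' t) (y m) x) ∧
      (∀ᶠ x' in nhds x, ∀ m, DifferentiableAt ℂ (fun x' => S q₀ z ℓ m x' t) x') ∧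
      (∀ m, HasDerivAt (fun x' => pdx (S q₀ z ℓ m) x' t) (yy m) x) ∧
      (∀ m, HasDerivAt (fun t' => S q₀ z ℓ m x t') (w m) t) ∧
      2 * (cst x - qSer q₀ t) * ser w = ser y - pSer q₀ t ∧
      ser y ^ 2 + hbar * ser yy = 2 * hbar * ser w + potential q₀ x t := by
  obtain ⟨Φ, c, h0, hcst, hrec, hc⟩ := exists_freeEnergy
  have hΦ : IsFreeEnergy Φ := ⟨h0, hcst, hrec⟩
  obtain ⟨e1, e2, e3⟩ := formal_solution hΦ hc
  obtain ⟨μ, hμ⟩ := IsAlgClosed.exists_pow_nat_eq (3 * q₀ t) two_pos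
  have hμ0 := B.root_ne_zero h hμ
  have hζ : μ⁻¹ * z x t ≠ 0 := mul_ne_zero (inv_ne_zero hμ0) (B.ne_zero h)
  have hU := (B.mem x t h).1
  refine ⟨_, _, _, fun m => B.hasDerivAt_S_x hΦ m h hμ, ?_, fun m => B.hasDerivAt_pdx_S hΦ m h hμ,
    fun m => B.hasDerivAt_S_t hΦ m h hμ, ?_⟩
  · filter_upwards [B.eventually_x h] with x' h' m using (B.hasDerivAt_S_x hΦ m h' hμ).differentiableAt
  have hl : cst μ * cst μ⁻¹ = 1 := by rw [← cst_mul, mul_inv_cancel₀ hμ0, cst_one]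
  -- In the rescaled coordinates q = μ²Q - 2q₀, just as x = μ²u - 2q₀, so x - q = μ²(u - Q).
  have hq : qSer q₀ t = cst μ ^ 2 * evS μ⁻¹ hζ (constS (QS c)) - cst (2 * q₀ t) := by
    rw [evS_constS, ← cst_pow, cst_mul_ser, eq_sub_iff_add_eq, qSer]
    rw [cst_eq, ser_eq, ser_eq, ← map_add]
    congr 1; ext1 n
    rw [map_add, PowerSeries.coeff_mk, PowerSeries.coeff_mk, PowerSeries.coeff_C,
      qCoeff_eq B.isOpen_base B.zero_notMem B.diff_q B.q_eq e3 n hU hμ (mul_inv_cancel₀ hμ0), qs]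
    split_ifs with hn
    · subst hn; linear_combination (-2 / 3 : ℂ) * hμ
    · ring
  have hp : pSer q₀ t = cst μ ^ 3 * evS μ⁻¹ hζ (constS (pS c)) := by
    rw [evS_constS, ← cst_pow, cst_mul_ser, pSer]
    congr 1; funext n
    exact pCoeff_eq B.isOpen_base B.zero_notMem B.diff_q B.q_eq e3 n hU hμ (mul_inv_cancel₀ hμ0)
  have hu : evS μ⁻¹ hζ (PowerSeries.C (T 1)) = cst μ⁻¹ * cst (z x t) := by
    rw [evS_C, levHom_T, zpow_one, cst_mul]
  have hx : cst x = cst μ ^ 2 * (cst μ⁻¹ * cst (z x t)) ^ 2 - cst (2 * q₀ t) := by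
    have : x = (μ * μ⁻¹) ^ 2 * z x t ^ 2 - 2 * q₀ t := by
      rw [mul_inv_cancel₀ hμ0, B.z_eq x t h]; ring
    rw [← mul_pow, ← mul_assoc, ← cst_mul, ← cst_mul, ← cst_pow, mul_pow]
    rw [show cst ((μ * μ⁻¹) ^ 2 * z x t ^ 2) - cst (2 * q₀ t) = cst ((μ * μ⁻¹) ^ 2 * z x t ^ 2 - 2 * q₀ t) from
      (map_sub HahnSeries.C _ _).symm, ← this]
  have ha : 2 * cst μ ^ 2 = 3 * cst (2 * q₀ t) := by
    rw [← cst_pow, hμ, ← cst_ofNat 2, ← cst_ofNat 3, ← cst_mul, ← cst_mul]; congr 1; ring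
  have ht : 2 * cst t = -3 * cst (2 * q₀ t) ^ 2 := by
    have h2 : 2 * t = -3 * (2 * q₀ t) ^ 2 := by linear_combination 2 * B.q_eq t hU
    have h3 := congrArg cst h2
    rwa [cst_mul, cst_mul, cst_pow, cst_ofNat, show cst (-3) = -cst 3 from map_neg HahnSeries.C _,
      cst_ofNat] at h3
  have hY : ∀ F : LauS, ser (fun m => μ ^ 3 * (μ⁻¹ ^ (5 * m) * lev (PowerSeries.coeff m F) (μ⁻¹ * z x t)))
      = cst μ ^ 3 * evS μ⁻¹ hζ F := fun F => by rw [evS_eq, ← cst_pow, cst_mul_ser]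
  have hT : ∀ F : LauS, ser (fun m => μ * (μ⁻¹ ^ (5 * m) * lev (PowerSeries.coeff m F) (μ⁻¹ * z x t)))
      = cst μ * evS μ⁻¹ hζ F := fun F => by rw [evS_eq, cst_mul_ser]
  have hYY : ser (fun m => μ * (μ⁻¹ ^ (5 * m) * lev (C (1 / 2) * dLau (PowerSeries.coeff m
      (YS fun n => diag (Φ n)))) (μ⁻¹ * z x t))) = cst μ * (cst (1 / 2) * evS μ⁻¹ hζ (dS (YS fun n => diag (Φ n)))) := by
    rw [evS_eq, cst_mul_ser, cst_mul_ser]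
    congr 1; funext m
    rw [coeff_dS, lev_eq _ hζ, lev_eq _ hζ, map_mul, levHom_C]; ring
  have hhalf : 2 * cst (1 / 2) = 1 := by
    rw [← cst_ofNat 2, ← cst_mul, ← cst_one]; norm_num
  have f1 := congrArg (evS μ⁻¹ hζ) e1
  have f2 := congrArg (evS μ⁻¹ hζ) e2
  simp only [map_mul, map_sub, map_add, map_pow, map_ofNat, map_one, evS_X, hu] at f1 f2
  rw [hY, hT, hYY, potential, hq, hp, hx, cst_add, cst_mul 4, cst_mul (2 * t), cst_mul 2 t,
    cst_pow, hx,
    cst_ofNat, cst_ofNat]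
  generalize evS μ⁻¹ hζ (YS fun n => diag (Φ n)) = Y at *
  generalize evS μ⁻¹ hζ (TS fun n => diag (Φ n)) = W at *
  generalize evS μ⁻¹ hζ (dS (YS fun n => diag (Φ n))) = V at *
  generalize evS μ⁻¹ hζ (constS (QS c)) = Q at *
  generalize evS μ⁻¹ hζ (constS (pS c)) = p at *
  generalize (cst μ⁻¹ * cst (z x t)) ^ 2 = u at *
  generalize cst μ = M at *
  generalize cst μ⁻¹ = L at *
  -- Balance of weights: the identity for Y² is multiplied by μ⁶, while the parameter evaluates to
  -- ħμ⁻⁵.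
  have h5 : M ^ 6 * L ^ 5 = M := by
    linear_combination M * (M ^ 4 * L ^ 4 + M ^ 3 * L ^ 3 + M ^ 2 * L ^ 2 + M * L + 1) * hl
  have : CharZero (LaurentSeries ℂ) := charZero_of_injective_ringHom (f := HahnSeries.C) HahnSeries.C_injective
  have ha' : cst (2 * q₀ t) = 2 / 3 * M ^ 2 := by linear_combination (-1 / 3) * ha
  have ht' : cst t = -2 / 3 * M ^ 4 := by rw [ha'] at ht; linear_combination ht / 2
  rw [ha', ht']
  constructor
  · linear_combination M ^ 3 * f1
  · linear_combination M ^ 6 / 2 * f2 + (2 * hbar * W - hbar * V / 2) * h5 + hbar * M * V / 2 * hhalf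
end BranchData
end PainleveOne
end

theorem theorem3p3
    -- a domain of the variable `t` that does not contain the origin, and a branch of `√(-t/6)`
    (U : Set ℂ) (hU : IsOpen U) (hU0 : (0 : ℂ) ∉ U)
    (q₀ : ℂ → ℂ) (hq₀ : DifferentiableOn ℂ q₀ U)
    (hq₀_eq : ∀ t ∈ U, 6 * q₀ t ^ 2 + t = 0)
    -- a domain of `(x,t)` that avoids the turning points, with a branch `z` of `√(x + 2q₀)`
    -- and a branch `ℓ` of `log (y / (2(x - q₀)))`
    (Ω : Set (ℂ × ℂ)) (hΩ : IsOpen Ω)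
    (hΩU : ∀ x t : ℂ, (x, t) ∈ Ω → t ∈ U ∧ x ≠ q₀ t ∧ x ≠ -2 * q₀ t)
    (z : ℂ → ℂ → ℂ) (hz : DifferentiableOn ℂ (Function.uncurry z) Ω)
    (hz_eq : ∀ x t : ℂ, (x, t) ∈ Ω → z x t ^ 2 = x + 2 * q₀ t)
    (ℓ : ℂ → ℂ → ℂ) (hℓ : DifferentiableOn ℂ (Function.uncurry ℓ) Ω)
    (hℓ_eq : ∀ x t : ℂ, (x, t) ∈ Ω →
      Complex.exp (ℓ x t) = curveY (q₀ t) (z x t) / (2 * (x - q₀ t))) :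
    -- all the `S_m` are holomorphic, so that the derivatives below are genuine
    (∀ m : ℕ, DifferentiableOn ℂ (Function.uncurry (S q₀ z ℓ m)) Ω) ∧
    ∀ x t : ℂ, (x, t) ∈ Ω →
      -- `ψ = exp S` satisfies both equations of the scalar isomonodromy system
      ((expWKB (S q₀ z ℓ)).hdx.hdx.ampSer x t
          + fSer q₀ x t * (expWKB (S q₀ z ℓ)).hdx.ampSer x t
          + gSer q₀ x t * (expWKB (S q₀ z ℓ)).ampSer x t = 0 ∧
        (expWKB (S q₀ z ℓ)).hdt.ampSer x t
          = 1 / (2 * (cst x - qSer q₀ t)) *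
            ((expWKB (S q₀ z ℓ)).hdx.ampSer x t
              - pSer q₀ t * (expWKB (S q₀ z ℓ)).ampSer x t)) ∧
      -- the Riccati-type equation for `S`
      hbar ^ 2 * (serS (fun m => pdx (S q₀ z ℓ m)) x t ^ 2
            + serS (fun m => pdx (pdx (S q₀ z ℓ m))) x t)
          = hbar / (cst x - qSer q₀ t) *
              (hbar * serS (fun m => pdx (S q₀ z ℓ m)) x t - pSer q₀ t)
            + potential q₀ x t ∧
      -- the `t`-evolution equation for `S`
      hbar * serS (fun m => pdt (S q₀ z ℓ m)) x t
          = 1 / (2 * (cst x - qSer q₀ t)) *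
              (hbar * serS (fun m => pdx (S q₀ z ℓ m)) x t - pSer q₀ t) ∧
      -- the semi-classical limit of the first equation is the spectral curve
      ∀ y : ℂ, y ^ 2 + (fSer q₀ x t).coeff 0 * y + (gSer q₀ x t).coeff 0
          = y ^ 2 - 4 * (x - q₀ t) ^ 2 * (x + 2 * q₀ t) := by
  have B : BranchData U q₀ Ω z ℓ := ⟨hU, hU0, hq₀, hq₀_eq, hΩ, hΩU, hz, hz_eq, hℓ, hℓ_eq⟩
  obtain ⟨Φ, _, h0, hcst, hrec, -⟩ := exists_freeEnergy
  refine ⟨B.differentiableOn_S ⟨h0, hcst, hrec⟩, fun x t h => ?_⟩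
  obtain ⟨y, yy, w, hy, hd, hyy, hw, h1, h2⟩ := B.riccati h
  have hxq := (hΩU x t h).2.1
  -- The leading coefficient x - q₀ is nonzero, so x - q is invertible in ℂ((ħ)) and the evolution
  -- equation can be solved for ħS_t.
  obtain ⟨G, hG⟩ := exists_inv_cst_sub_qSer hxq
  have hD : cst x - qSer q₀ t ≠ 0 := left_ne_zero_of_mul_eq_one hG
  have hsy : hbar * serS (fun m => pdx (S q₀ z ℓ m)) x t = ser y := by
    rw [mul_serS]; congr 1; funext m; exact (hy m).deriv
  have hsyy : hbar * serS (fun m => pdx (pdx (S q₀ z ℓ m))) x t = ser yy := by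
    rw [mul_serS]; congr 1; funext m; exact (hyy m).deriv
  have hsw : hbar * serS (fun m => pdt (S q₀ z ℓ m)) x t = ser w := by
    rw [mul_serS]; congr 1; funext m; exact (hw m).deriv
  have : CharZero (LaurentSeries ℂ) := charZero_of_injective_ringHom (f := HahnSeries.C) HahnSeries.C_injective
  have e1 : ser w = 1 / (2 * (cst x - qSer q₀ t)) * (ser y - pSer q₀ t) := by
    rw [← h1]; field_simp
  have e2 : ser y ^ 2 + hbar * ser yy
      = hbar / (cst x - qSer q₀ t) * (ser y - pSer q₀ t) + potential q₀ x t := by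
    rw [h2, ← h1]; field_simp
  refine ⟨⟨?_, ?_⟩, ?_, ?_, ?_⟩
  · rw [hdx_hdx_expWKB hy hd hyy, hdx_expWKB hy, e2, fSer, gSer]
    field_simp
    ring
  · rw [hdt_expWKB hw, hdx_expWKB hy, e1]; ring
  · rw [hsy, ← e2, ← hsy, ← hsyy]; ring
  · rw [hsy, hsw, e1]
  · intro y'
    rw [fSer_coeff_zero hxq, gSer_coeff_zero hxq (hq₀_eq t (hΩU x t h).1)]; ring
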